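/- \textbf{Conventions.} $\log$ is the logarithm to base $2$ and $\ln$ the natural logarithm. $G$ is a $k$-partite graph with blocks $V_1,\dots,V_k$ of size $n$ each, and $p=n^{-2/D}$. A rectangle is a product $Q=\prod_{i\in[k]}Q_i$ with $Q_i\subseteq V_i$, and $Q_B=\prod_{i\in B}Q_i$ for $B\subseteq[k]$. A tuple has at most one vertex in each block; $N^\cap(t,R)$ is the set of common neighbors of the tuple $t$ in $R$. For a set $E$ of pairs of vertices from distinct blocks, $\chi_E(G)=\prod_{e\in E}\chi_e(G)$, where $\chi_e(G)=\frac{1-p}{p}$ if $e\in E(G)$ and $\chi_e(G)=-1$ otherwise. Pattern graphs $H,F$ are graphs on the vertex set $[k]$; $\mathrm{vc}(H)$ is the minimum size of a vertex cover; for a tuple $t=(v_i)_{i\in B}$ and a graph $H$ on $B$, $H(t)=\{\{v_i,v_j\}:\{i,j\}\in E(H)\}$. \textbf{Measure.} The $k$-clique formula over $G$ has variables $x_v,\bar x_v$ ($v\in V(G)$) and consists of the polynomials $\sum_{v\in V_i}x_v-1$ for $i\in[k]$ and $x_ux_v$ for all $u,v$ in distinct blocks with $\{u,v\}\notin E(G)$.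 For a monomial $m$ let $Q(m)$ be the set of $k$-tuples $t$ such that $m$ evaluates to $1$ under the assignment $x_v=1,\bar x_v=0$ for $v\in t$, and $x_v=0,\bar x_v=1$ for $v\notin t$. Let $\mu_d$ be the linear functional on real polynomials with \[\mu_d(m)=n^{-k}\sum_{t\in Q(m)}\ \sum_{H:\,\mathrm{vc}(H)\le d}\chi_{H(t)}(G)\] for all monomials $m$. For a set $\mathcal P$ of polynomials, a linear functional $\mu$ on real polynomials is a $\delta$-pseudo-measure for $\mathcal P$ if $\mu(1)=1$, and $|\mu(m\cdot q)|\le\delta$ and $\mu(m)\ge-\delta$ for all monomials $m$ and all $q\in\mathcal P$. \textbf{Cores.} For a pattern graph $H$ let $W$ be its lexicographically first minimum vertex cover, $U_1$ the lexicographically first inclusion-maximal subset of $[k]\setminus W$ that can be completely matched into $W$ by edges of $H$, and $U_2$ the lexicographically first inclusion-maximal subset of $[k]\setminus(W\cup U_1)$ that can be completely matched into $W$ by edges of $H$. Put $\mathrm{core}(H)=H[W\cup U_1\cup U_2]$, viewed as a graph on $[k]$. A core is a graph $F$ in the image of this map; $E^\star_F=\bigcup_{H:\,\mathrm{core}(H)=F}E(H)\setminus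 E(F)$, and $V(E(F))$ is the set of non-isolated vertices of $F$. For $B\subseteq[k]$, let $E^\star_F[B]$ be the set of edges in $E^\star_F$ inside $B$. We say that $G$ has $s$-bounded character sums over $Q_B$ for $F$ if $\bigl|\sum_{t\in Q_B}\sum_{H}\chi_{H[B](t)}(G)\bigr|\le s$, where $H$ runs over all graphs with $E(H)=E(F)\cup E$, $E\subseteq E^\star_F[B]$. \textbf{Well-behaved graphs.} Let $C,K>0$. The graph $G$ is $D$-well-behaved with constants $C,K$ if the following hold. \begin{enumerate} \item For all $A\subseteq[k]$ with $|A|\le D/4$, all $i\in[k]\setminus A$, all $B\subseteq A$ and all tuples $t\in\prod_{j\in B}V_j$: $|N^\cap(t,V_i)|\in(1\pm\frac1k)p^{|t|}n$. \item For all integers $\ell,s\ge0$ with $\ell\le D/4$ and $s\ge Ck^4\ell\ln n/p^{2\ell}$, and all rectangles $Q$ such that for each $i$ either $|Q_i|\ge2s$ or $Q_i=\emptyset$, there is a set $W\subseteq V(G)$, $|W|\le s$, such that for all $S\subseteq[k]$ with $|S|\le\ell$, all $t\in\prod_{i\in S}(Q_i\setminus W)$ and all $j\in[k]\setminus S$: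 $|N^\cap(t,Q_j\setminus W)|\in(1\pm\frac1k)p^{|t|}|Q_j\setminus W|$. \item For every core $F$ with $\mathrm{vc}(F)\le D/4$, every rectangle $Q$ with $|Q_i|>n/2$ for all $i\in V(E(F))$, and every $\lambda<1-\log(k)/\log(n)$, $G$ has $s$-bounded character sums over $Q$ for $F$, with $s=6\,p^{-|E(F)|}\,n^{k-\lambda\,\mathrm{vc}(F)/4}$. \item Let $F$ be a core with $\mathrm{vc}(F)\le D/4$, $\Lambda\ge20k\log n$ an integer, $B\subseteq[k]$, $A=V(E(F))\cap B$, and $Q$ a rectangle with $|Q_i|\le4\Lambda$ for all $i\in[k]$ and $|Q_i|>\Lambda$ for all $i\in B$. If $|N^\cap(t,Q_i)|\in(1\pm\frac3k)p^{|t|}|Q_i|$ for all $i\in B\setminus A$, all $A'\subseteq A$ and all $t\in Q_{A'}$, then $G$ has $s$-bounded character sums over $Q_B$ for $F$, with $s=K\,p^{-|E(F[B])|}\bigl(\frac{\Lambda}{10k\log n}\bigr)^{-\mathrm{vc}(F[B])/4}|Q_B|$. \end{enumerate} \textbf{Theorem.} There are constants $\eta,c>0$ and $D_0\in\mathbb N$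 such that for all constants $C,K>0$ there is an $n_0$ with the following property. Let $n\ge n_0$ be an integer, let $D$ be a real number with $D_0<D\le2\log n$, let $k$ be an integer with $D\le k\le n^{1/66}$, and put $d=\eta D$. If $G$ is a $k$-partite graph with $n$ vertices per block that is $D$-well-behaved with constants $C,K$, then the normalized functional $\mu(m)=\mu_d(m)/\mu_d(1)$ is an $n^{-cD}$-pseudo-measure for the $k$-clique formula over $G$. -/

import Mathlib

namespace CliqueSA

noncomputable section

open Classical

/-! ### Pseudo-measures -/

/-- A linear functional `μ` on real polynomials is a `δ`-pseudo-measure for the set `P` of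
polynomials. Monomials are given by their exponent vectors `m`. -/
structure IsPseudoMeasure {σ : Type*} (δ : ℝ) (P : Set (MvPolynomial σ ℝ))
    (μ : MvPolynomial σ ℝ →ₗ[ℝ] ℝ) : Prop where
  one : μ 1 = 1
  axiom_small : ∀ (m : σ →₀ ℕ), ∀ p ∈ P, |μ (MvPolynomial.monomial m 1 * p)| ≤ δ
  nonneg : ∀ m : σ →₀ ℕ, -δ ≤ μ (MvPolynomial.monomial m 1)

/-! ### Block graphs, tuples, rectangles and the clique formula -/

/-- The vertex set of a graph with `k` blocks of size `n`; `(i, a)` is the vertex number `a` of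
block `i`. -/
abbrev Vertex (k n : ℕ) : Type := Fin k × Fin n

/-- The graph has no edge inside a block. -/
def IsBlockPartite {k n : ℕ} (G : SimpleGraph (Vertex k n)) : Prop :=
  ∀ u v, G.Adj u v → u.1 ≠ v.1

/-- A rectangle: the `i`-th side `Q i` is a set of vertices of block `i`. -/
abbrev Rect (k n : ℕ) : Type := Fin k → Finset (Fin n)

/-- The vertices of `Q i`, as a set of vertices of the whole graph. -/
def Rect.side {k n : ℕ} (Q : Rect k n) (i : Fin k) : Finset (Vertex k n) :=
  (Q i).image fun a => (i, a)

/-- A tuple with one vertex in each of the blocks in `S`. -/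
abbrev Tuple {k : ℕ} (n : ℕ) (S : Finset (Fin k)) : Type := S → Fin n

/-- The projection `Q_S` of a rectangle: all tuples on the blocks in `S` with entries in `Q`. -/
def Rect.tuples {k n : ℕ} (Q : Rect k n) (S : Finset (Fin k)) : Finset (Tuple n S) :=
  Fintype.piFinset fun i : S => Q i

/-- The variables of the clique formula: `Sum.inl v` stands for `x_v` and `Sum.inr v` for its twin
variable. -/
abbrev Var (k n : ℕ) : Type := Vertex k n ⊕ Vertex k n

/-- The `k`-clique formula over `G`: the block axioms `∑_{v ∈ V_i} x_v - 1`, and the edge axioms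
`x_u x_v` for the non-edges between distinct blocks. -/
def cliqueFormula {k n : ℕ} (G : SimpleGraph (Vertex k n)) :
    Set (MvPolynomial (Var k n) ℝ) :=
  {q | ∃ i : Fin k, q = (∑ a : Fin n, MvPolynomial.X (Sum.inl (i, a))) - 1} ∪
  {q | ∃ u v : Vertex k n, u.1 ≠ v.1 ∧ ¬ G.Adj u v ∧
    q = MvPolynomial.X (Sum.inl u) * MvPolynomial.X (Sum.inl v)}

/-- The assignment `ρ_t` of a `k`-tuple `t`. -/
def assignment {k n : ℕ} (t : Fin k → Fin n) : Var k n → ℝ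
  | Sum.inl v => if t v.1 = v.2 then 1 else 0
  | Sum.inr v => if t v.1 = v.2 then 0 else 1

/-- The set `Q(m)` of `k`-tuples ruled out by a monomial. -/
def ruledOut {k n : ℕ} (m : Var k n →₀ ℕ) : Finset (Fin k → Fin n) :=
  Finset.univ.filter fun t =>
    MvPolynomial.eval (assignment t) (MvPolynomial.monomial m (1 : ℝ)) = 1

/-! ### Characters and the measure -/

/-- The character `χ_E(G)` of a set `E` of potential edges. -/
def character {V : Type*} (p : ℝ) (G : SimpleGraph V) (E : Finset (Sym2 V)) : ℝ :=
  ∏ e ∈ E, if e ∈ G.edgeSet then (1 - p) / p else -1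

/-- The edge set obtained from a pattern graph `H` by sending vertex `i` to `f i`. -/
def placed {ι V : Type*} [Fintype ι] (H : SimpleGraph ι) (f : ι → V) : Finset (Sym2 V) :=
  H.edgeFinset.image (Sym2.map f)

/-- The size of a minimum vertex cover. -/
def vc {ι : Type*} (H : SimpleGraph ι) : ℕ := H.vertexCoverNum.toNat

/-- `μ_d` of a set of `k`-tuples:
`n^{-k} ∑_{t ∈ T} ∑_{H on [k], vc(H) ≤ d} χ_{H(t)}(G)`, with edge probability `p`. -/
def tupleMeasure {k n : ℕ} (p d : ℝ) (G : SimpleGraph (Vertex k n))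
    (T : Finset (Fin k → Fin n)) : ℝ :=
  ((n : ℝ) ^ k)⁻¹ * ∑ t ∈ T,
    ∑ H ∈ Finset.univ.filter (fun H : SimpleGraph (Fin k) => (vc H : ℝ) ≤ d),
      character p G (placed H fun i => (i, t i))

/-- The linear functional `μ_d` on polynomials, given on monomials by `m ↦ μ_d(Q(m))`. -/
def cliqueMeasure {k n : ℕ} (p d : ℝ) (G : SimpleGraph (Vertex k n)) :
    MvPolynomial (Var k n) ℝ →ₗ[ℝ] ℝ :=
  (MvPolynomial.basisMonomials (Var k n) ℝ).constr ℝ fun m => tupleMeasure p d G (ruledOut m)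

/-- The normalized functional `m ↦ μ_d(m) / μ_d(1)`. -/
def normalizedMeasure {k n : ℕ} (p d : ℝ) (G : SimpleGraph (Vertex k n)) :
    MvPolynomial (Var k n) ℝ →ₗ[ℝ] ℝ :=
  (cliqueMeasure p d G 1)⁻¹ • cliqueMeasure p d G

/-! ### Cores of pattern graphs -/

/-- The lexicographic order on sets of vertices: compare the ascending sequences. -/
def LexLE {k : ℕ} (S T : Finset (Fin k)) : Prop :=
  (S.sort (· ≤ ·)) ≤ (T.sort (· ≤ ·))

/-- The lexicographically first set with property `P` (`∅` if no set has it). -/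
def lexFirst {k : ℕ} (P : Finset (Fin k) → Prop) : Finset (Fin k) :=
  if h : ∃ S, P S ∧ ∀ T, P T → LexLE S T then h.choose else ∅

/-- `lexFirst P` is what its name says as soon as some set has property `P`. -/
theorem lexFirst_spec {k : ℕ} {P : Finset (Fin k) → Prop} (hP : ∃ S, P S) :
    P (lexFirst P) ∧ ∀ T, P T → LexLE (lexFirst P) T := by
  have h : ∃ S, P S ∧ ∀ T, P T → LexLE S T := by
    obtain ⟨S₀, hS₀⟩ := hP
    obtain ⟨S, hS, hmin⟩ := Finset.exists_min_image (Finset.univ.filter P)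
      (fun S : Finset (Fin k) => S.sort (· ≤ ·)) ⟨S₀, by simpa using hS₀⟩
    exact ⟨S, by simpa using hS, fun T hT => hmin T (by simpa using hT)⟩
  unfold lexFirst
  rw [dif_pos h]
  exact h.choose_spec

/-- `W` is a minimum vertex cover of `H`. -/
def IsMinVertexCover {k : ℕ} (H : SimpleGraph (Fin k)) (W : Finset (Fin k)) : Prop :=
  H.IsVertexCover (W : Set (Fin k)) ∧ W.card = vc H

/-- There is a matching in `H` from `U` to `W` that covers all of `U`; it is given by an injective
choice of partners. -/
def CanMatch {k : ℕ} (H : SimpleGraph (Fin k)) (U W : Finset (Fin k)) : Prop :=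
  ∃ f : Fin k → Fin k, Set.InjOn f (U : Set (Fin k)) ∧ ∀ u ∈ U, f u ∈ W ∧ H.Adj u (f u)

/-- The lexicographically first minimum vertex cover of `H`. -/
def coreCover {k : ℕ} (H : SimpleGraph (Fin k)) : Finset (Fin k) :=
  lexFirst (IsMinVertexCover H)

/-- The lexicographically first inclusion-maximal set of vertices outside `X` that can be matched
into `W`. -/
def matchedSet {k : ℕ} (H : SimpleGraph (Fin k)) (W X : Finset (Fin k)) : Finset (Fin k) :=
  lexFirst (Maximal fun U => Disjoint U X ∧ CanMatch H U W)

/-- The set `W ∪ U₁ ∪ U₂` that induces the core of `H`. -/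
def coreSet {k : ℕ} (H : SimpleGraph (Fin k)) : Finset (Fin k) :=
  let W := coreCover H
  let U₁ := matchedSet H W W
  let U₂ := matchedSet H W (W ∪ U₁)
  W ∪ U₁ ∪ U₂

/-- The subgraph `H[B]` induced by `B`, as a graph on all vertices. -/
def restrict {k : ℕ} (H : SimpleGraph (Fin k)) (B : Finset (Fin k)) : SimpleGraph (Fin k) :=
  (H.induce (B : Set (Fin k))).spanningCoe

/-- The map that sends a pattern graph to its core. -/
def core {k : ℕ} (H : SimpleGraph (Fin k)) : SimpleGraph (Fin k) := restrict H (coreSet H)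

/-- The edge set `E*_F`, the union of `H \ F` over all `H` with core `F`. -/
def starEdges {k : ℕ} (F : SimpleGraph (Fin k)) : SimpleGraph (Fin k) :=
  sSup {E | ∃ H, core H = F ∧ E = H \ F}

/-- The family `H(F, E*)` of all graphs `F ∪ E` with `E ⊆ E*`. -/
def family {k : ℕ} (F Estar : SimpleGraph (Fin k)) : Finset (SimpleGraph (Fin k)) :=
  Finset.univ.filter fun H => ∃ E ≤ Estar, H = F ⊔ E

/-! ### Well-behaved graphs -/

/-- The common neighborhood of the tuple `t` in the set `R`. -/
def commonNbhd {k n : ℕ} (G : SimpleGraph (Vertex k n)) {S : Finset (Fin k)} (t : Tuple n S)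
    (R : Finset (Vertex k n)) : Finset (Vertex k n) :=
  R.filter fun v => ∀ i : S, G.Adj ((i : Fin k), t i) v

/-- `|N^∩(t, R)| ∈ (1 ± β) p^{|t|} |R|`. -/
def HasExpectedNbhd {k n : ℕ} (G : SimpleGraph (Vertex k n)) (β p : ℝ) {S : Finset (Fin k)}
    (t : Tuple n S) (R : Finset (Vertex k n)) : Prop :=
  ((commonNbhd G t R).card : ℝ) ∈
    Set.Icc ((1 - β) * (p ^ S.card * R.card)) ((1 + β) * (p ^ S.card * R.card))

/-- `(β, p)`-bounded common neighborhoods from `Q_A` to `R`. -/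
def BoundedNbhds {k n : ℕ} (G : SimpleGraph (Vertex k n)) (β p : ℝ) (Q : Rect k n)
    (A : Finset (Fin k)) (R : Finset (Vertex k n)) : Prop :=
  ∀ B ⊆ A, ∀ t ∈ Q.tuples B, HasExpectedNbhd G β p t R

/-- `(β, p, d)`-bounded common neighborhoods in every block. -/
def BoundedNbhdsInBlocks {k n : ℕ} (G : SimpleGraph (Vertex k n)) (β p d : ℝ) : Prop :=
  ∀ A : Finset (Fin k), (A.card : ℝ) ≤ d → ∀ i ∉ A,
    BoundedNbhds G β p (fun _ => Finset.univ) A (Rect.side (fun _ => Finset.univ) i)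

/-- `(s, w, β, p, d)`-bounded error sets. -/
def BoundedErrorSets {k n : ℕ} (G : SimpleGraph (Vertex k n)) (s w β p d : ℝ) : Prop :=
  ∀ Q : Rect k n, (∀ i, s ≤ ((Q i).card : ℝ) ∨ (Q i).card = 0) →
    ∃ W : Finset (Vertex k n), (W.card : ℝ) ≤ w ∧
      ∀ S : Finset (Fin k), (S.card : ℝ) ≤ d →
        ∀ t ∈ Q.tuples S, (∀ i : S, ((i : Fin k), t i) ∉ W) →
          ∀ j ∉ S, HasExpectedNbhd G β p t (Q.side j \ W)

/-- `s`-bounded character sums over `Q_B` for `F`, where `p` is the edge probability. -/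
def BoundedCharSums {k n : ℕ} (G : SimpleGraph (Vertex k n)) (p s : ℝ) (Q : Rect k n)
    (B : Finset (Fin k)) (F : SimpleGraph (Fin k)) : Prop :=
  |∑ t ∈ Q.tuples B, ∑ H ∈ family F (restrict (starEdges F) B),
    character p G (placed (H.induce (B : Set (Fin k))) fun i => ((i : Fin k), t i))| ≤ s

/-- The graph `G` is `D`-well-behaved, where `C` is the constant in the lower bound on the block
sizes in the second property and `K` is the constant hidden in the `O(·)` of the fourth. -/
structure WellBehaved {k n : ℕ} (C K D : ℝ) (G : SimpleGraph (Vertex k n)) : Prop where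
  nbhds : BoundedNbhdsInBlocks G (1 / k) ((n : ℝ) ^ (-2 / D)) (D / 4)
  error_sets : ∀ ℓ s : ℕ, (ℓ : ℝ) ≤ D / 4 →
    C * (k : ℝ) ^ 4 * ℓ * Real.log n / ((n : ℝ) ^ (-2 / D)) ^ (2 * ℓ) ≤ s →
    BoundedErrorSets G (2 * s) s (1 / k) ((n : ℝ) ^ (-2 / D)) ℓ
  char_sums : ∀ F ∈ Set.range (core (k := k)), (vc F : ℝ) ≤ D / 4 →
    ∀ Q : Rect k n, (∀ i ∈ F.support, (n : ℝ) / 2 < (Q i).card) →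
    ∀ lam : ℝ, lam < 1 - Real.log k / Real.log n →
    BoundedCharSums G ((n : ℝ) ^ (-2 / D))
      (6 * (((n : ℝ) ^ (-2 / D)) ^ F.edgeFinset.card)⁻¹ *
        (n : ℝ) ^ ((k : ℝ) - lam * vc F / 4))
      Q Finset.univ F
  char_sums_local : ∀ F ∈ Set.range (core (k := k)), (vc F : ℝ) ≤ D / 4 →
    ∀ Λ : ℕ, 20 * k * Real.logb 2 n ≤ Λ →
    ∀ B : Finset (Fin k), ∀ Q : Rect k n,
    (∀ i, (Q i).card ≤ 4 * Λ) → (∀ i ∈ B, Λ < (Q i).card) →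
    (∀ i ∈ B, i ∉ F.support →
      BoundedNbhds G (3 / k) ((n : ℝ) ^ (-2 / D)) Q (B.filter (· ∈ F.support)) (Q.side i)) →
    BoundedCharSums G ((n : ℝ) ^ (-2 / D))
      (K * (((n : ℝ) ^ (-2 / D)) ^ (F.induce (B : Set (Fin k))).edgeFinset.card)⁻¹ *
        (Λ / (10 * k * Real.logb 2 n)) ^ (-(vc (F.induce (B : Set (Fin k))) : ℝ) / 4) *
        (Q.tuples B).card)
      Q B F

end

end CliqueSA

/-!
Write `p = n ^ (-2 / D)`, `d = ⌊η D⌋`, and let `χ_H(t)` be the character of a pattern graph `H`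
placed on the `k`-tuple `t`. A monomial `m` corresponds to a rectangle `Q(m)` of tuples, and
`μ_d(m)` is, up to the factor `n ^ (-k)`, the sum over `t ∈ Q(m)` of all `χ_H(t)` with `vc H ≤ d`.
Four things have to be shown: the total mass is at least `1 / 2`, the block axioms hold exactly
(the rectangle of `m` is the disjoint union of the rectangles of `m x_v`, `v ∈ V_i`), the edge
axioms hold up to a small error, and the functional is almost nonnegative on monomials.

*Cores.* The map `core` preserves the minimum vertex covers (`isMinVertexCover_core`), and the
graphs with core `F` are exactly the graphs `F ∪ E` with `E ⊆ E*_F` (`core_eq_iff`). Hence the sum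
of `χ_H(t)` over all `H` with a property that depends only on the core of `H` is a sum of core
sums `coreSum p G F B Q` over cores `F`. There are at most `k ^ (3 w) 2 ^ (9 w ^ 2)` cores with
vertex cover number `w` (`card_cores_le`), because a core lives on `3 w` vertices. All this rests
on Hall's theorem and the exchange property of matchable sets.

*Branching.* Take an arbitrary rectangle in which the blocks outside `B` are single vertices. If
some block in `B` is small, the rectangle splits into few rectangles with a fixed vertex in that
block. Otherwise the error set `W` is removed; the rectangles containing a vertex of `W` again
have a fixed vertex, and there are few of them. In what remains all small tuples have about the
expected number of common neighbors. By a Chernoff bound such a rectangle can be partitioned into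
rectangles with sides of size about `Λ` that inherit this property (`exists_block_partition`), and
the local bound on character sums applies to each of them. So `Q` splits into a good rectangle, with
`|coreSum F| ≤ K ρ' ^ vc(F[B]) |Q|`, and at most `Θ` rectangles with one more fixed vertex
(`WellBehaved.branching`). Fixing a vertex in block `j` turns the factors `1 + χ_e = p⁻¹ 1[e ∈ G]`
at `j` into restrictions to the neighborhood of that vertex. Everything is measured against
`sizeBound`, in which the shrinking of the neighborhoods cancels the factors `p⁻¹`.

*Core sums over arbitrary rectangles* (`Setting.abs_coreSum_le`). A branch fixes a vertex, which
decreases `vc(F[B])` by at most one and gains a factor `Θ / n`, up to powers of `p`. Repeating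
this `vc F` times gives the bound `(2 ^ (3 d) ρ) ^ vc F` for every rectangle, where `ρ` is a negative
power of `n`. Since this beats the number of cores, the total mass is at least `1 / 2`, and sums over
cores with `vc F = d` are at most `n ^ (-Ω(D))`.

*Edge axioms* (`truncSum_nonedge`). If `Q` forces a non-edge `ij`, adding or removing the pattern
edge `ij` changes the sign of the character. All `H` cancel except those with `vc H = d` none of
whose minimum vertex covers meets `{i, j}`, a property of the core.

*Nonnegativity* (`Setting.neg_le_truncSum`). On a good rectangle the empty pattern dominates, so
the truncated sum is nonnegative. On a branch with a fixed vertex in block `j`, the truncated sum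
of level `m + 1` is a multiple of the truncated sum of level `m` over the blocks `B \ {j}`,
restricted to the neighborhood of the vertex, plus core sums with `vc F = m + 1` (`truncSum_fix`).
Iterating this about `d / 2` times, the gains `Θ / n` of the branches accumulate to `n ^ (-Ω(D))`,
and the core sums lost on the way have `vc F ≥ d / 2`.
-/

namespace CliqueSA

noncomputable section

open Classical

/-! ### Matchings into a vertex set -/

/-- The neighbors in `W` of the vertices in `S`. -/
def nbrs {k : ℕ} (H : SimpleGraph (Fin k)) (W S : Finset (Fin k)) : Finset (Fin k) :=
  W.filter fun w => ∃ s ∈ S, H.Adj s w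

theorem mem_nbrs {k : ℕ} {H : SimpleGraph (Fin k)} {W S : Finset (Fin k)} {w : Fin k} :
    w ∈ nbrs H W S ↔ w ∈ W ∧ ∃ s ∈ S, H.Adj s w := by
  simp [nbrs]

theorem nbrs_mono {k : ℕ} {H : SimpleGraph (Fin k)} {W S T : Finset (Fin k)} (h : S ⊆ T) :
    nbrs H W S ⊆ nbrs H W T := by
  intro w hw
  rw [mem_nbrs] at hw ⊢
  exact ⟨hw.1, hw.2.imp fun s hs => ⟨h hs.1, hs.2⟩⟩

/-- Hall's theorem for a finite set of vertices. -/
theorem canMatch_iff_hall {k : ℕ} {H : SimpleGraph (Fin k)} {U W : Finset (Fin k)} :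
    CanMatch H U W ↔ ∀ S ⊆ U, S.card ≤ (nbrs H W S).card := by
  constructor
  · rintro ⟨f, hf, hU⟩ S hS
    rw [← Finset.card_image_of_injOn (hf.mono (by exact_mod_cast hS))]
    refine Finset.card_le_card fun w hw => ?_
    obtain ⟨s, hs, rfl⟩ := Finset.mem_image.1 hw
    exact mem_nbrs.2 ⟨(hU s (hS hs)).1, s, hs, (hU s (hS hs)).2⟩
  · intro h
    have := (Finset.all_card_le_biUnion_card_iff_exists_injective
      (fun u : U => W.filter fun w => H.Adj u w)).1 ?_
    · obtain ⟨f, hf, hfU⟩ := this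
      refine ⟨fun u => if hu : u ∈ U then f ⟨u, hu⟩ else u, ?_, ?_⟩
      · intro a ha b hb hab
        have ha' : a ∈ U := ha
        have hb' : b ∈ U := hb
        simp only [ha', hb', dif_pos] at hab
        exact congrArg Subtype.val (hf hab)
      · intro u hu
        have := hfU ⟨u, hu⟩
        simpa [hu] using this
    · intro s
      have h1 := h (s.map (Function.Embedding.subtype _)) (by
        intro x hx
        obtain ⟨y, -, rfl⟩ := Finset.mem_map.1 hx
        exact y.2)
      rw [Finset.card_map] at h1
      refine h1.trans (Finset.card_le_card fun w hw => ?_)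
      obtain ⟨hw, u, hu, huw⟩ := mem_nbrs.1 hw
      obtain ⟨y, hy, rfl⟩ := Finset.mem_map.1 hu
      exact Finset.mem_biUnion.2 ⟨y, hy, by simpa using ⟨hw, huw⟩⟩

theorem CanMatch.mono {k : ℕ} {H H' : SimpleGraph (Fin k)} {U U' W : Finset (Fin k)}
    (h : CanMatch H U W) (hH : H ≤ H') (hU : U' ⊆ U) : CanMatch H' U' W := by
  obtain ⟨f, hf, hfU⟩ := h
  exact ⟨f, hf.mono (by exact_mod_cast hU), fun u hu => ⟨(hfU u (hU hu)).1, hH (hfU u (hU hu)).2⟩⟩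

theorem canMatch_empty {k : ℕ} (H : SimpleGraph (Fin k)) (W : Finset (Fin k)) :
    CanMatch H ∅ W :=
  ⟨id, by simp, by simp⟩

theorem CanMatch.card_le {k : ℕ} {H : SimpleGraph (Fin k)} {U W : Finset (Fin k)}
    (h : CanMatch H U W) : U.card ≤ W.card :=
  (canMatch_iff_hall.1 h U subset_rfl).trans (Finset.card_le_card (Finset.filter_subset _ _))

/-- Vertices that cannot be added to a matchable set `J` one at a time all have their neighborhoods
inside that of a single tight subset `S` of `J`. -/
theorem exists_tight {k : ℕ} {H : SimpleGraph (Fin k)} {J W Y : Finset (Fin k)}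
    (hJ : CanMatch H J W) (hY : ∀ x ∈ Y, ¬ CanMatch H (insert x J) W) :
    ∃ S ⊆ J, (nbrs H W S).card = S.card ∧ nbrs H W Y ⊆ nbrs H W S := by
  rw [canMatch_iff_hall] at hJ
  induction Y using Finset.induction_on with
  | empty =>
    refine ⟨∅, by simp, by simp [nbrs], ?_⟩
    intro w hw
    simp [mem_nbrs] at hw
  | insert x Y hxY ih =>
    obtain ⟨S, hSJ, hS, hSY⟩ := ih fun y hy => hY y (Finset.mem_insert_of_mem hy)
    have hx := hY x (Finset.mem_insert_self _ _)
    rw [canMatch_iff_hall] at hx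
    push Not at hx
    obtain ⟨R, hR, hRc⟩ := hx
    have hxR : x ∈ R := by
      by_contra hxR
      have := hJ R ((Finset.subset_insert_iff_of_notMem hxR).1 hR)
      omega
    set R' := R.erase x with hR'
    have hR'J : R' ⊆ J := fun y hy =>
      (Finset.mem_insert.1 (hR (Finset.mem_of_mem_erase hy))).resolve_left
        (Finset.ne_of_mem_erase hy)
    have hcard : R'.card + 1 = R.card := Finset.card_erase_add_one hxR
    have h1 := hJ R' hR'J
    have h2 : nbrs H W R' ⊆ nbrs H W R := nbrs_mono (Finset.erase_subset _ _)
    have h3 : nbrs H W R' = nbrs H W R := Finset.eq_of_subset_of_card_le h2 (by omega)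
    refine ⟨S ∪ R', Finset.union_subset hSJ hR'J, ?_, ?_⟩
    -- submodularity of the size of the neighborhood: unions of tight sets are tight
    · have h4 := hJ (S ∪ R') (Finset.union_subset hSJ hR'J)
      have h5 := hJ (S ∩ R') (Finset.inter_subset_left.trans hSJ)
      have h6 : nbrs H W (S ∩ R') ⊆ nbrs H W S ∩ nbrs H W R' :=
        Finset.subset_inter (nbrs_mono Finset.inter_subset_left)
          (nbrs_mono Finset.inter_subset_right)
      have h7 : nbrs H W (S ∪ R') = nbrs H W S ∪ nbrs H W R' := by
        ext w
        simp only [mem_nbrs, Finset.mem_union]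
        constructor
        · rintro ⟨hw, s, hs | hs, hsw⟩
          exacts [Or.inl ⟨hw, s, hs, hsw⟩, Or.inr ⟨hw, s, hs, hsw⟩]
        · rintro (⟨hw, s, hs, hsw⟩ | ⟨hw, s, hs, hsw⟩)
          exacts [⟨hw, s, Or.inl hs, hsw⟩, ⟨hw, s, Or.inr hs, hsw⟩]
      have h8 := Finset.card_union_add_card_inter S R'
      have h9 := Finset.card_union_add_card_inter (nbrs H W S) (nbrs H W R')
      have h10 := Finset.card_le_card h6
      rw [h7] at h4 ⊢
      have h11 : (nbrs H W R').card ≤ R'.card := by rw [h3]; omega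
      omega
    · intro w hw
      obtain ⟨hwW, s, hs, hsw⟩ := mem_nbrs.1 hw
      rcases Finset.mem_insert.1 hs with rfl | hs
      · have : w ∈ nbrs H W R' := by rw [h3]; exact mem_nbrs.2 ⟨hwW, s, hxR, hsw⟩
        exact nbrs_mono Finset.subset_union_right this
      · exact nbrs_mono Finset.subset_union_left (hSY (mem_nbrs.2 ⟨hwW, s, hs, hsw⟩))

/-- The exchange property of the transversal matroid of matchable sets. -/
theorem CanMatch.augment {k : ℕ} {H : SimpleGraph (Fin k)} {J U W : Finset (Fin k)}
    (hJ : CanMatch H J W) (hU : CanMatch H U W) (hc : J.card < U.card) :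
    ∃ x ∈ U, x ∉ J ∧ CanMatch H (insert x J) W := by
  by_contra! hcon
  obtain ⟨S, hSJ, hS, hSY⟩ := exists_tight (Y := U \ J) hJ fun x hx =>
    hcon x (Finset.mem_sdiff.1 hx).1 (Finset.mem_sdiff.1 hx).2
  rw [canMatch_iff_hall] at hU
  have h1 := hU ((U \ J) ∪ (S ∩ U)) (Finset.union_subset Finset.sdiff_subset
    Finset.inter_subset_right)
  have h2 : nbrs H W ((U \ J) ∪ (S ∩ U)) ⊆ nbrs H W S := by
    intro w hw
    obtain ⟨hwW, s, hs, hsw⟩ := mem_nbrs.1 hw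
    rcases Finset.mem_union.1 hs with hs | hs
    · exact hSY (mem_nbrs.2 ⟨hwW, s, hs, hsw⟩)
    · exact mem_nbrs.2 ⟨hwW, s, (Finset.mem_inter.1 hs).1, hsw⟩
  have h3 : Disjoint (U \ J) (S ∩ U) := by
    rw [Finset.disjoint_left]
    intro a ha hb
    exact (Finset.mem_sdiff.1 ha).2 (hSJ (Finset.mem_inter.1 hb).1)
  rw [Finset.card_union_of_disjoint h3] at h1
  have h4 := Finset.card_le_card h2
  have h5 : (S \ U).card ≤ (J \ U).card := Finset.card_le_card (Finset.sdiff_subset_sdiff hSJ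
    subset_rfl)
  have h6 := Finset.card_sdiff_add_card_inter S U
  have h7 := Finset.card_sdiff_add_card_inter J U
  have h8 := Finset.card_sdiff_add_card_inter U J
  rw [Finset.inter_comm U J] at h8
  omega

/-- Repeated exchange: a matchable set `J` that is not larger than `U` can be enlarged by vertices
of `U` to a matchable set of the size of `U`. -/
theorem CanMatch.extend {k : ℕ} {H : SimpleGraph (Fin k)} {J U W : Finset (Fin k)}
    (hJ : CanMatch H J W) (hU : CanMatch H U W) (hc : J.card ≤ U.card) :
    ∃ T, J ⊆ T ∧ T ⊆ J ∪ U ∧ T.card = U.card ∧ CanMatch H T W := by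
  obtain ⟨m, hm⟩ := Nat.exists_eq_add_of_le hc
  induction m generalizing J with
  | zero => exact ⟨J, subset_rfl, Finset.subset_union_left, by omega, hJ⟩
  | succ m ih =>
    obtain ⟨x, hxU, hxJ, hx⟩ := hJ.augment hU (by omega)
    have hcard := Finset.card_insert_of_notMem hxJ
    obtain ⟨T, h1, h2, h3, h4⟩ := ih hx (by omega) (by omega)
    refine ⟨T, (Finset.subset_insert _ _).trans h1, h2.trans ?_, h3, h4⟩
    intro y hy
    rcases Finset.mem_union.1 hy with hy | hy
    · rcases Finset.mem_insert.1 hy with rfl | hy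
      exacts [Finset.mem_union_right _ hxU, Finset.mem_union_left _ hy]
    · exact Finset.mem_union_right _ hy

/-- A set of vertices of `W` that can be matched to vertices outside `X` can also be matched into
any maximal matchable set of vertices outside `X`. -/
theorem match_into_maximal {k : ℕ} {H : SimpleGraph (Fin k)} {U W X Z : Finset (Fin k)}
    (hU : CanMatch H U W)
    (hmax : ∀ x, x ∉ X → x ∉ U → ¬ CanMatch H (insert x U) W) (hZW : Z ⊆ W)
    (h : Fin k → Fin k) (hinj : Set.InjOn h (Z : Set (Fin k)))
    (hZ : ∀ z ∈ Z, h z ∉ X ∧ H.Adj z (h z)) :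
    ∃ g : Fin k → Fin k, Set.InjOn g (Z : Set (Fin k)) ∧ ∀ z ∈ Z, g z ∈ U ∧ H.Adj z (g z) := by
  obtain ⟨S, hSU, hS, hSY⟩ := exists_tight (Y := Finset.univ.filter fun x => x ∉ X ∧ x ∉ U) hU
    fun x hx => hmax x (by simpa using hx : x ∉ X ∧ x ∉ U).1 (by simpa using hx : x ∉ X ∧ x ∉ U).2
  obtain ⟨f, hf, hfU⟩ := hU
  have himg : S.image f = nbrs H W S := by
    refine Finset.eq_of_subset_of_card_le ?_ ?_
    · intro w hw
      obtain ⟨s, hs, rfl⟩ := Finset.mem_image.1 hw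
      exact mem_nbrs.2 ⟨(hfU s (hSU hs)).1, s, hs, (hfU s (hSU hs)).2⟩
    · rw [hS, Finset.card_image_of_injOn (hf.mono (by exact_mod_cast hSU))]
  have hback : ∀ w, w ∈ nbrs H W S → ∃ s ∈ S, f s = w := by
    intro w hw
    rw [← himg] at hw
    exact Finset.mem_image.1 hw
  choose! b hbS hfb using hback
  -- `z` keeps its partner unless it is a neighbor of the tight set `S`, inside which it is
  -- rematched along the perfect matching between `S` and its neighborhood.
  refine ⟨fun z => if z ∈ nbrs H W S then b z else h z, ?_, ?_⟩
  · intro y hy z hz hyz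
    have hnot : ∀ z ∈ Z, z ∉ nbrs H W S → h z ∉ S := fun z hz hzn hzS =>
      hzn (mem_nbrs.2 ⟨hZW hz, h z, hzS, (hZ z hz).2.symm⟩)
    by_cases h1 : y ∈ nbrs H W S <;> by_cases h2 : z ∈ nbrs H W S <;>
      simp only [h1, h2, if_true, if_false] at hyz
    · rw [← hfb y h1, ← hfb z h2, hyz]
    · exact absurd (hyz ▸ hbS y h1) (hnot z hz h2)
    · exact absurd (hyz.symm ▸ hbS z h2) (hnot y hy h1)
    · exact hinj hy hz hyz
  · intro z hz
    by_cases h1 : z ∈ nbrs H W S <;> simp only [h1, if_true, if_false]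
    · refine ⟨hSU (hbS z h1), ?_⟩
      have := (hfU (b z) (hSU (hbS z h1))).2
      rw [hfb z h1] at this
      exact this.symm
    · refine ⟨?_, (hZ z hz).2⟩
      by_contra hzU
      exact h1 (hSY (mem_nbrs.2 ⟨hZW hz, h z, by simpa using ⟨(hZ z hz).1, hzU⟩,
        (hZ z hz).2.symm⟩))

/-! ### Lexicographically first sets -/

theorem LexLE.antisymm {k : ℕ} {S T : Finset (Fin k)} (h1 : LexLE S T) (h2 : LexLE T S) :
    S = T := by
  have := le_antisymm (show S.sort (· ≤ ·) ≤ T.sort (· ≤ ·) from h1) h2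
  rw [← Finset.sort_toFinset S (· ≤ ·), this, Finset.sort_toFinset]

theorem sort_eq_append {k : ℕ} {A : Finset (Fin k)} {x : Fin k} (hx : x ∈ A) :
    A.sort (· ≤ ·) = (A.filter (· < x)).sort (· ≤ ·) ++ x :: (A.filter (x < ·)).sort (· ≤ ·) := by
  refine (Finset.sortedLT_sort A).pairwise.eq_of_mem_iff ?_ ?_
  · rw [List.pairwise_append]
    refine ⟨(Finset.sortedLT_sort _).pairwise, ?_, ?_⟩
    · rw [List.pairwise_cons]
      exact ⟨fun a ha => (Finset.mem_filter.1 ((Finset.mem_sort _).1 ha)).2,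
        (Finset.sortedLT_sort _).pairwise⟩
    · intro a ha b hb
      have ha' := (Finset.mem_filter.1 ((Finset.mem_sort _).1 ha)).2
      rcases List.mem_cons.1 hb with rfl | hb
      · exact ha'
      · exact ha'.trans (Finset.mem_filter.1 ((Finset.mem_sort _).1 hb)).2
  · intro a
    simp only [Finset.mem_sort, List.mem_append, List.mem_cons, Finset.mem_filter]
    constructor
    · intro ha
      rcases lt_trichotomy a x with h | h | h
      exacts [Or.inl ⟨ha, h⟩, Or.inr (Or.inl h), Or.inr (Or.inr ⟨ha, h⟩)]
    · rintro (h | h | h)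
      exacts [h.1, h ▸ hx, h.1]

/-- If two sets agree below `x`, the one that contains `x` precedes the other one, unless the latter
is an initial segment of it. -/
theorem not_lexLE {k : ℕ} {A B : Finset (Fin k)} {x b : Fin k} (hxA : x ∈ A) (hxB : x ∉ B)
    (h : ∀ y < x, y ∈ A ↔ y ∈ B) (hbB : b ∈ B) (hb : x < b) : ¬ LexLE B A := by
  unfold LexLE
  rw [not_le]
  have hne : (B.filter (x < ·)).Nonempty := ⟨b, by simp [hbB, hb]⟩
  set c := (B.filter (x < ·)).min' hne with hc
  have hcm := Finset.min'_mem _ hne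
  rw [← hc, Finset.mem_filter] at hcm
  rw [sort_eq_append hxA, sort_eq_append hcm.1]
  have : B.filter (· < c) = A.filter (· < x) := by
    ext y
    simp only [Finset.mem_filter]
    constructor
    · rintro ⟨hy, hyc⟩
      have hyx : y < x := by
        by_contra hyx
        rcases eq_or_lt_of_le (not_lt.1 hyx) with rfl | hyx
        · exact hxB hy
        · exact absurd (Finset.min'_le _ y (by simp [hy, hyx])) (not_le.2 hyc)
      exact ⟨(h y hyx).2 hy, hyx⟩
    · rintro ⟨hy, hyx⟩
      exact ⟨(h y hyx).1 hy, hyx.trans hcm.2⟩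
  rw [this]
  exact List.append_left_lt (List.cons_lt_cons_iff.2 (Or.inl hcm.2))

theorem lexFirst_eq {k : ℕ} {P : Finset (Fin k) → Prop} {S : Finset (Fin k)} (hS : P S)
    (hmin : ∀ T, P T → LexLE S T) : lexFirst P = S :=
  LexLE.antisymm ((lexFirst_spec ⟨S, hS⟩).2 S hS) (hmin _ (lexFirst_spec ⟨S, hS⟩).1)

theorem exists_maximal_matchable {k : ℕ} (H : SimpleGraph (Fin k)) (W X : Finset (Fin k)) :
    ∃ U, Maximal (fun U => Disjoint U X ∧ CanMatch H U W) U := by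
  obtain ⟨U, hU⟩ := Set.Finite.exists_maximal
    (s := {U : Finset (Fin k) | Disjoint U X ∧ CanMatch H U W}) (Set.toFinite _)
    ⟨∅, by simp, canMatch_empty H W⟩
  exact ⟨U, hU⟩

theorem maximal_matchable_iff {k : ℕ} {H : SimpleGraph (Fin k)} {U W X : Finset (Fin k)} :
    Maximal (fun U => Disjoint U X ∧ CanMatch H U W) U ↔
      (Disjoint U X ∧ CanMatch H U W) ∧ ∀ x, x ∉ X → x ∉ U → ¬ CanMatch H (insert x U) W := by
  constructor
  · intro h
    refine ⟨h.prop, fun x hxX hxU hx => hxU ?_⟩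
    have := h.le_of_ge (y := insert x U) ⟨by
      rw [Finset.disjoint_insert_left]; exact ⟨hxX, h.prop.1⟩, hx⟩ (Finset.subset_insert _ _)
    exact this (Finset.mem_insert_self _ _)
  · rintro ⟨h, hmax⟩
    refine ⟨h, fun V hV hUV x hx => ?_⟩
    by_contra hxU
    exact hmax x (Finset.disjoint_left.1 hV.1 hx) hxU
      (hV.2.mono le_rfl (Finset.insert_subset hx hUV))

/-- Inclusion-maximal matchable sets have maximum size. -/
theorem card_le_of_maximal {k : ℕ} {H : SimpleGraph (Fin k)} {J U W X : Finset (Fin k)}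
    (hU : Maximal (fun U => Disjoint U X ∧ CanMatch H U W) U) (hJX : Disjoint J X)
    (hJ : CanMatch H J W) : J.card ≤ U.card := by
  by_contra! hlt
  obtain ⟨x, hxJ, hxU, hx⟩ := hU.prop.2.augment hJ hlt
  exact (maximal_matchable_iff.1 hU).2 x (Finset.disjoint_left.1 hJX hxJ) hxU hx

/-- The greedy characterization of the lexicographically first maximal matchable set: a vertex is
left out only if it cannot be matched together with the chosen smaller vertices. -/
theorem matchedSet_eq_iff {k : ℕ} {H : SimpleGraph (Fin k)} {U W X : Finset (Fin k)} :
    matchedSet H W X = U ↔ Disjoint U X ∧ CanMatch H U W ∧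
      ∀ x, x ∉ X → x ∉ U → ¬ CanMatch H (insert x (U.filter (· < x))) W := by
  constructor
  · rintro rfl
    obtain ⟨hmax, hmin⟩ := lexFirst_spec (exists_maximal_matchable H W X)
    change Maximal _ (matchedSet H W X) at hmax
    change ∀ T, _ → LexLE (matchedSet H W X) T at hmin
    set U := matchedSet H W X
    refine ⟨hmax.prop.1, hmax.prop.2, fun x hxX hxU hx => ?_⟩
    set J := insert x (U.filter (· < x)) with hJ
    have hJX : Disjoint J X := by
      rw [hJ, Finset.disjoint_insert_left]
      exact ⟨hxX, hmax.prop.1.mono_left (Finset.filter_subset _ _)⟩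
    have hJU := card_le_of_maximal hmax hJX hx
    -- `J` extends to a maximal set `T` that contains `x` and agrees with `U` below `x`
    obtain ⟨T, hJT, hTJ, hTU, hT⟩ := hx.extend hmax.prop.2 hJU
    have hTX : Disjoint T X := Disjoint.mono_left hTJ (by
      rw [Finset.disjoint_union_left]; exact ⟨hJX, hmax.prop.1⟩)
    have hTmax : Maximal (fun U => Disjoint U X ∧ CanMatch H U W) T := by
      rw [maximal_matchable_iff]
      refine ⟨⟨hTX, hT⟩, fun y hyX hyT hy => ?_⟩
      have := card_le_of_maximal hmax (J := insert y T) (by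
        rw [Finset.disjoint_insert_left]; exact ⟨hyX, hTX⟩) hy
      rw [Finset.card_insert_of_notMem hyT] at this
      omega
    have hxT : x ∈ T := hJT (Finset.mem_insert_self _ _)
    have hlow : ∀ y < x, y ∈ T ↔ y ∈ U := by
      intro y hy
      constructor
      · intro hyT
        rcases Finset.mem_union.1 (hTJ hyT) with h | h
        · rcases Finset.mem_insert.1 h with h | h
          · exact absurd h hy.ne
          · exact (Finset.mem_filter.1 h).1
        · exact h
      · intro hyU
        exact hJT (Finset.mem_insert_of_mem (Finset.mem_filter.2 ⟨hyU, hy⟩))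
    have hb : ∃ b ∈ U, x < b := by
      by_contra! hb
      have : U.filter (· < x) = U := Finset.filter_true_of_mem fun y hy =>
        lt_of_le_of_ne (hb y hy) fun h => hxU (h ▸ hy)
      rw [this] at hJ
      rw [hJ, Finset.card_insert_of_notMem hxU] at hJU
      omega
    obtain ⟨b, hbU, hxb⟩ := hb
    exact not_lexLE hxT hxU hlow hbU hxb (hmin T hTmax)
  · rintro ⟨hUX, hU, hgreedy⟩
    have hmax : Maximal (fun U => Disjoint U X ∧ CanMatch H U W) U := by
      rw [maximal_matchable_iff]
      exact ⟨⟨hUX, hU⟩, fun x hxX hxU hx => hgreedy x hxX hxU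
        (hx.mono le_rfl (Finset.insert_subset_insert _ (Finset.filter_subset _ _)))⟩
    refine lexFirst_eq hmax fun T hT => ?_
    by_cases hTU : T = U
    · rw [hTU]; exact le_rfl
    have hne : (symmDiff U T).Nonempty := by
      rw [Finset.nonempty_iff_ne_empty]
      intro h
      exact hTU (symmDiff_eq_bot.1 (by simpa using h)).symm
    set x := (symmDiff U T).min' hne with hx
    have hxm := Finset.min'_mem _ hne
    rw [← hx, Finset.mem_symmDiff] at hxm
    have hlow : ∀ y < x, y ∈ U ↔ y ∈ T := by
      intro y hy
      have : y ∉ symmDiff U T := fun h => absurd (Finset.min'_le _ y h) (not_le.2 hy)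
      rw [Finset.mem_symmDiff] at this
      tauto
    rcases hxm with ⟨hxU, hxT⟩ | ⟨hxT, hxU⟩
    · have hb : ∃ b ∈ T, x < b := by
        by_contra! hb
        refine hxT (hT.le_of_ge hmax.prop (fun y hy => ?_) hxU)
        exact (hlow y (lt_of_le_of_ne (hb y hy) fun h => hxT (h ▸ hy))).2 hy
      obtain ⟨b, hbT, hxb⟩ := hb
      have := not_lexLE hxU hxT hlow hbT hxb
      exact (le_total (U.sort (· ≤ ·)) (T.sort (· ≤ ·))).resolve_right this
    · refine absurd (hT.prop.2.mono le_rfl ?_) (hgreedy x (Finset.disjoint_left.1 hT.prop.1 hxT)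
        hxU)
      refine Finset.insert_subset hxT fun y hy => ?_
      have hy := Finset.mem_filter.1 hy
      exact (hlow y hy.2).1 hy.1

/-! ### Vertex cover numbers -/

theorem vc_le_iff {ι : Type*} [Finite ι] {H : SimpleGraph ι} {m : ℕ} :
    vc H ≤ m ↔ ∃ C : Finset ι, H.IsVertexCover (C : Set ι) ∧ C.card ≤ m := by
  have hne : H.vertexCoverNum ≠ ⊤ := SimpleGraph.vertexCoverNum_ne_top_of_finite
  constructor
  · intro h
    obtain ⟨s, hs, hsc⟩ := H.vertexCoverNum_exists
    refine ⟨(Set.toFinite s).toFinset, by simpa using hsc, ?_⟩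
    rw [← Set.ncard_eq_toFinset_card, Set.ncard, hs]
    exact h
  · rintro ⟨C, hC, hCm⟩
    have := hC.vertexCoverNum_le
    rw [Set.encard_coe_eq_coe_finsetCard] at this
    have h2 := ENat.toNat_le_toNat this (by simp)
    simp only [ENat.toNat_natCast] at h2
    exact h2.trans hCm

theorem vc_le_card {ι : Type*} [Finite ι] {H : SimpleGraph ι} {C : Finset ι}
    (hC : H.IsVertexCover (C : Set ι)) : vc H ≤ C.card :=
  vc_le_iff.2 ⟨C, hC, le_rfl⟩

theorem vc_mono {ι : Type*} [Finite ι] {H H' : SimpleGraph ι} (h : H ≤ H') : vc H ≤ vc H' := by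
  obtain ⟨C, hC, hCm⟩ := (vc_le_iff (H := H')).1 le_rfl
  exact vc_le_iff.2 ⟨C, hC.mono h, hCm⟩

theorem exists_isMinVertexCover {k : ℕ} (H : SimpleGraph (Fin k)) :
    ∃ C, IsMinVertexCover H C := by
  obtain ⟨C, hC, hCm⟩ := (vc_le_iff (H := H)).1 le_rfl
  exact ⟨C, hC, le_antisymm hCm (vc_le_card hC)⟩

theorem vc_eq_zero {k : ℕ} {H : SimpleGraph (Fin k)} : vc H = 0 ↔ H = ⊥ := by
  constructor
  · intro h
    obtain ⟨C, hC, hCm⟩ := (vc_le_iff (m := 0)).1 h.le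
    have : C = ∅ := Finset.card_eq_zero.1 (by omega)
    subst this
    simpa using hC
  · rintro rfl
    exact Nat.le_zero.1 (vc_le_iff.2 ⟨∅, by simp, by simp⟩)

theorem restrict_adj {k : ℕ} {H : SimpleGraph (Fin k)} {B : Finset (Fin k)} {x y : Fin k} :
    (restrict H B).Adj x y ↔ H.Adj x y ∧ x ∈ B ∧ y ∈ B := by
  simp [restrict]

theorem restrict_le {k : ℕ} (H : SimpleGraph (Fin k)) (B : Finset (Fin k)) : restrict H B ≤ H :=
  fun _ _ h => (restrict_adj.1 h).1

theorem vc_induce {k : ℕ} (H : SimpleGraph (Fin k)) (B : Finset (Fin k)) :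
    vc (H.induce (B : Set (Fin k))) = vc (restrict H B) := by
  refine le_antisymm ?_ ?_
  · obtain ⟨C, hC, hCm⟩ := (vc_le_iff (H := restrict H B)).1 le_rfl
    refine vc_le_iff.2 ⟨Finset.univ.filter fun x : (B : Set (Fin k)) => (x : Fin k) ∈ C, ?_, ?_⟩
    · intro x y hxy
      simpa using hC (restrict_adj.2 ⟨hxy, by exact_mod_cast x.2, by exact_mod_cast y.2⟩)
    · refine le_trans ?_ hCm
      refine Finset.card_le_card_of_injOn (fun x => (x : Fin k)) ?_ ?_
      · intro x hx
        simpa using hx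
      · intro x _ y _ hxy
        exact Subtype.ext hxy
  · obtain ⟨C, hC, hCm⟩ := (vc_le_iff (H := H.induce (B : Set (Fin k)))).1 le_rfl
    refine vc_le_iff.2 ⟨C.image Subtype.val, ?_, Finset.card_image_le.trans hCm⟩
    intro x y hxy
    obtain ⟨hxy, hx, hy⟩ := restrict_adj.1 hxy
    have := @hC ⟨x, by exact_mod_cast hx⟩ ⟨y, by exact_mod_cast hy⟩ hxy
    rcases this with h | h
    · exact Or.inl (by simpa using ⟨by exact_mod_cast hx, h⟩)
    · exact Or.inr (by simpa using ⟨by exact_mod_cast hy, h⟩)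

theorem vc_restrict_le_erase {k : ℕ} (H : SimpleGraph (Fin k)) (B : Finset (Fin k)) (j : Fin k) :
    vc (restrict H B) ≤ vc (restrict H (B.erase j)) + 1 := by
  obtain ⟨C, hC, hCm⟩ := (vc_le_iff (H := restrict H (B.erase j))).1 le_rfl
  refine vc_le_iff.2 ⟨insert j C, ?_, (Finset.card_insert_le _ _).trans (by omega)⟩
  intro x y hxy
  obtain ⟨hxy, hx, hy⟩ := restrict_adj.1 hxy
  by_cases hxj : x = j
  · left; simp [hxj]
  by_cases hyj : y = j
  · right; simp [hyj]
  rcases hC (restrict_adj.2 ⟨hxy, Finset.mem_erase.2 ⟨hxj, hx⟩, Finset.mem_erase.2 ⟨hyj, hy⟩⟩) with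
    h | h
  · left; simpa using Or.inr h
  · right; simpa using Or.inr h

/-! ### The structure of cores -/

theorem isMinVertexCover_coreCover {k : ℕ} (H : SimpleGraph (Fin k)) :
    IsMinVertexCover H (coreCover H) :=
  (lexFirst_spec (exists_isMinVertexCover H)).1

/-- The first matched set `U₁` of the core construction. -/
def coreU₁ {k : ℕ} (H : SimpleGraph (Fin k)) : Finset (Fin k) :=
  matchedSet H (coreCover H) (coreCover H)

/-- The second matched set `U₂` of the core construction. -/
def coreU₂ {k : ℕ} (H : SimpleGraph (Fin k)) : Finset (Fin k) :=
  matchedSet H (coreCover H) (coreCover H ∪ coreU₁ H)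

theorem coreSet_eq {k : ℕ} (H : SimpleGraph (Fin k)) :
    coreSet H = coreCover H ∪ coreU₁ H ∪ coreU₂ H := rfl

theorem coreU₁_spec {k : ℕ} (H : SimpleGraph (Fin k)) :
    Disjoint (coreU₁ H) (coreCover H) ∧ CanMatch H (coreU₁ H) (coreCover H) ∧
      ∀ x, x ∉ coreCover H → x ∉ coreU₁ H →
        ¬ CanMatch H (insert x ((coreU₁ H).filter (· < x))) (coreCover H) :=
  matchedSet_eq_iff.1 rfl

theorem coreU₂_spec {k : ℕ} (H : SimpleGraph (Fin k)) :
    Disjoint (coreU₂ H) (coreCover H ∪ coreU₁ H) ∧ CanMatch H (coreU₂ H) (coreCover H) ∧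
      ∀ x, x ∉ coreCover H ∪ coreU₁ H → x ∉ coreU₂ H →
        ¬ CanMatch H (insert x ((coreU₂ H).filter (· < x))) (coreCover H) :=
  matchedSet_eq_iff.1 rfl

theorem coreCover_subset {k : ℕ} (H : SimpleGraph (Fin k)) : coreCover H ⊆ coreSet H :=
  fun _ h => Finset.mem_union_left _ (Finset.mem_union_left _ h)

theorem coreU₁_subset {k : ℕ} (H : SimpleGraph (Fin k)) : coreU₁ H ⊆ coreSet H :=
  fun _ h => Finset.mem_union_left _ (Finset.mem_union_right _ h)

theorem coreU₂_subset {k : ℕ} (H : SimpleGraph (Fin k)) : coreU₂ H ⊆ coreSet H :=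
  fun _ h => Finset.mem_union_right _ h

theorem core_le {k : ℕ} (H : SimpleGraph (Fin k)) : core H ≤ H := restrict_le _ _

theorem card_coreSet_le {k : ℕ} (H : SimpleGraph (Fin k)) : (coreSet H).card ≤ 3 * vc H := by
  have h1 := (coreU₁_spec H).2.1.card_le
  have h2 := (coreU₂_spec H).2.1.card_le
  rw [(isMinVertexCover_coreCover H).2] at h1 h2
  have h3 := Finset.card_union_le (coreCover H ∪ coreU₁ H) (coreU₂ H)
  have h4 := Finset.card_union_le (coreCover H) (coreU₁ H)
  rw [(isMinVertexCover_coreCover H).2] at h4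
  rw [coreSet_eq]
  omega

/-- The greedy condition implies that no vertex at all can be added. -/
theorem CanMatch.not_of_greedy {k : ℕ} {H : SimpleGraph (Fin k)} {U W X : Finset (Fin k)}
    (h : ∀ x, x ∉ X → x ∉ U → ¬ CanMatch H (insert x (U.filter (· < x))) W) :
    ∀ x, x ∉ X → x ∉ U → ¬ CanMatch H (insert x U) W := fun x hX hU hx =>
  h x hX hU (hx.mono le_rfl (Finset.insert_subset_insert _ (Finset.filter_subset _ _)))

/-- A minimum vertex cover of the core of `H` also covers `H`, and it is at least as large as a
minimum vertex cover of `H`. Any part of `W` that such a cover misses is matched into `U₁`, which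
accounts for all its vertices outside `W`; a missed edge leaving the core would force a further one
in `U₂`. -/
theorem cover_of_core {k : ℕ} {H : SimpleGraph (Fin k)} {C : Finset (Fin k)}
    (hC : IsMinVertexCover (core H) C) : H.IsVertexCover (C : Set (Fin k)) ∧ vc H ≤ C.card := by
  have hW := isMinVertexCover_coreCover H
  obtain ⟨hU1d, hU1m, hU1g⟩ := coreU₁_spec H
  obtain ⟨hU2d, hU2m, hU2g⟩ := coreU₂_spec H
  have hWs := coreCover_subset H
  have hU1s := coreU₁_subset H
  have hU2s := coreU₂_subset H
  set W := coreCover H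
  set U₁ := coreU₁ H
  set U₂ := coreU₂ H
  have hedge : ∀ {x y}, H.Adj x y → x ∈ coreSet H → y ∈ coreSet H → x ∈ C ∨ y ∈ C :=
    fun hxy hx hy => hC.1 (restrict_adj.2 ⟨hxy, hx, hy⟩)
  have hCW : C.card ≤ W.card := by
    rw [hC.2, hW.2]; exact vc_mono (core_le H)
  set Z := W \ C with hZ
  have hZW : Z ⊆ W := Finset.sdiff_subset
  have hZind : ∀ x ∈ Z, ∀ y ∈ Z, ¬ H.Adj x y := by
    intro x hx y hy hxy
    rcases hedge hxy (hWs (hZW hx)) (hWs (hZW hy)) with h | h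
    exacts [(Finset.mem_sdiff.1 hx).2 h, (Finset.mem_sdiff.1 hy).2 h]
  -- `Z` is matched out of `W`: for `S ⊆ Z`, exchanging `S` for its neighbors outside `W` gives a
  -- vertex cover, which is not smaller than `W`
  obtain ⟨f, hf, hfZ⟩ : CanMatch H Z (Finset.univ \ W) := by
    rw [canMatch_iff_hall]
    intro S hS
    have hcov : H.IsVertexCover (((W \ S) ∪ nbrs H (Finset.univ \ W) S : Finset (Fin k)) :
        Set (Fin k)) := by
      have key : ∀ x y, H.Adj x y → x ∈ W →
          (x ∈ (W \ S) ∪ nbrs H (Finset.univ \ W) S ∨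
            y ∈ (W \ S) ∪ nbrs H (Finset.univ \ W) S) := by
        intro x y hxy hx
        by_cases hxS : x ∈ S
        · by_cases hy : y ∈ W
          · refine Or.inr (Finset.mem_union_left _ (Finset.mem_sdiff.2 ⟨hy, fun hyS => ?_⟩))
            exact hZind x (hS hxS) y (hS hyS) hxy
          · exact Or.inr (Finset.mem_union_right _ (mem_nbrs.2 ⟨by simpa using hy, x, hxS, hxy⟩))
        · exact Or.inl (Finset.mem_union_left _ (Finset.mem_sdiff.2 ⟨hx, hxS⟩))
      intro x y hxy
      rcases hW.1 hxy with h | h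
      · exact_mod_cast key x y hxy h
      · exact_mod_cast (key y x hxy.symm h).symm
    have h1 := vc_le_card hcov
    rw [← hW.2] at h1
    have h2 := Finset.card_union_le (W \ S) (nbrs H (Finset.univ \ W) S)
    have h3 := Finset.card_sdiff_add_card_eq_card (hS.trans hZW)
    omega
  obtain ⟨g, hg, hgZ⟩ := match_into_maximal hU1m (CanMatch.not_of_greedy hU1g) hZW f hf
    fun z hz => ⟨by simpa using (hfZ z hz).1, (hfZ z hz).2⟩
  have hgC : Z.image g ⊆ C \ W := by
    intro y hy
    obtain ⟨z, hz, rfl⟩ := Finset.mem_image.1 hy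
    refine Finset.mem_sdiff.2 ⟨?_, Finset.disjoint_left.1 hU1d (hgZ z hz).1⟩
    exact (hedge (hgZ z hz).2 (hWs (hZW hz)) (hU1s (hgZ z hz).1)).resolve_left
      (Finset.mem_sdiff.1 hz).2
  have hcardZ : (Z.image g).card = Z.card := Finset.card_image_of_injOn hg
  have h1 := Finset.card_le_card hgC
  have h2 := Finset.card_sdiff_add_card_inter W C
  have h3 := Finset.card_sdiff_add_card_inter C W
  rw [Finset.inter_comm C W] at h3
  rw [← hZ] at h2
  -- the partners in `U₁` of the missed vertices are all of `C` outside `W`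
  have h4 : Z.image g = C \ W := Finset.eq_of_subset_of_card_le hgC (by omega)
  refine ⟨?_, by rw [← hW.2]; omega⟩
  have key : ∀ x y, H.Adj x y → x ∈ W → x ∈ C ∨ y ∈ C := by
    intro w x hwx hw
    by_contra! hcon
    have hwZ : w ∈ Z := Finset.mem_sdiff.2 ⟨hw, hcon.1⟩
    have hx : x ∉ coreSet H := fun hx => by
      rcases hedge hwx (hWs hw) hx with h | h
      exacts [hcon.1 h, hcon.2 h]
    obtain ⟨g', -, hg'⟩ := match_into_maximal (Z := {w}) hU2m (CanMatch.not_of_greedy hU2g)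
      (by simpa using hw) (fun _ => x) (by simp) fun z hz => by
        rw [Finset.mem_singleton] at hz
        subst hz
        refine ⟨fun h => hx ?_, hwx⟩
        rcases Finset.mem_union.1 h with h | h
        exacts [hWs h, hU1s h]
    obtain ⟨hyU, hwy⟩ := hg' w (Finset.mem_singleton_self _)
    have hyC := (hedge hwy (hWs hw) (hU2s hyU)).resolve_left hcon.1
    have hyn := Finset.disjoint_left.1 hU2d hyU
    rw [Finset.mem_union, not_or] at hyn
    have : g' w ∈ Z.image g := by
      rw [h4]; exact Finset.mem_sdiff.2 ⟨hyC, hyn.1⟩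
    obtain ⟨z, hz, hzy⟩ := Finset.mem_image.1 this
    exact hyn.2 (hzy ▸ (hgZ z hz).1)
  intro x y hxy
  rcases hW.1 hxy with h | h
  · exact_mod_cast key x y hxy h
  · exact_mod_cast (key y x hxy.symm h).symm

theorem vc_core {k : ℕ} (H : SimpleGraph (Fin k)) : vc (core H) = vc H := by
  refine le_antisymm (vc_mono (core_le H)) ?_
  obtain ⟨C, hC⟩ := exists_isMinVertexCover (core H)
  exact (cover_of_core hC).2.trans hC.2.le

/-- A graph and its core have the same minimum vertex covers. -/
theorem isMinVertexCover_core {k : ℕ} (H : SimpleGraph (Fin k)) :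
    IsMinVertexCover (core H) = IsMinVertexCover H := by
  funext C
  refine propext ⟨fun h => ⟨(cover_of_core h).1, h.2.trans (vc_core H)⟩, fun h => ?_⟩
  exact ⟨h.1.mono (core_le H), h.2.trans (vc_core H).symm⟩

theorem coreCover_core {k : ℕ} (H : SimpleGraph (Fin k)) : coreCover (core H) = coreCover H := by
  rw [coreCover, isMinVertexCover_core, ← coreCover]

theorem CanMatch.restrict {k : ℕ} {H : SimpleGraph (Fin k)} {U W B : Finset (Fin k)}
    (h : CanMatch H U W) (hU : U ⊆ B) (hW : W ⊆ B) : CanMatch (restrict H B) U W := by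
  obtain ⟨f, hf, hfU⟩ := h
  exact ⟨f, hf, fun u hu => ⟨(hfU u hu).1, restrict_adj.2 ⟨(hfU u hu).2, hU hu, hW (hfU u hu).1⟩⟩⟩

theorem coreU₁_core {k : ℕ} (H : SimpleGraph (Fin k)) : coreU₁ (core H) = coreU₁ H := by
  obtain ⟨h1, h2, h3⟩ := coreU₁_spec H
  rw [coreU₁, coreCover_core, matchedSet_eq_iff]
  exact ⟨h1, h2.restrict (coreU₁_subset H) (coreCover_subset H),
    fun x hx hxU h => h3 x hx hxU (h.mono (core_le H) subset_rfl)⟩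

theorem coreU₂_core {k : ℕ} (H : SimpleGraph (Fin k)) : coreU₂ (core H) = coreU₂ H := by
  obtain ⟨h1, h2, h3⟩ := coreU₂_spec H
  rw [coreU₂, coreU₁_core, coreCover_core, matchedSet_eq_iff]
  exact ⟨h1, h2.restrict (coreU₂_subset H) (coreCover_subset H),
    fun x hx hxU h => h3 x hx hxU (h.mono (core_le H) subset_rfl)⟩

theorem coreSet_core {k : ℕ} (H : SimpleGraph (Fin k)) : coreSet (core H) = coreSet H := by
  rw [coreSet_eq, coreSet_eq, coreCover_core, coreU₁_core, coreU₂_core]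

theorem core_core {k : ℕ} (H : SimpleGraph (Fin k)) : core (core H) = core H := by
  rw [core, coreSet_core]
  ext x y
  simp only [core, restrict_adj]
  tauto

theorem starEdges_adj {k : ℕ} {F : SimpleGraph (Fin k)} {x y : Fin k} :
    (starEdges F).Adj x y ↔ ∃ H, core H = F ∧ H.Adj x y ∧ ¬ F.Adj x y := by
  simp only [starEdges, SimpleGraph.sSup_adj, Set.mem_ofPred_eq]
  constructor
  · rintro ⟨E, ⟨H, hH, rfl⟩, hE⟩
    exact ⟨H, hH, by simpa using hE⟩
  · rintro ⟨H, hH, h⟩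
    exact ⟨H \ F, ⟨H, hH, rfl⟩, by simpa using h⟩

/-- The whole core construction depends only on the core. -/
theorem core_eq_imp {k : ℕ} {H F : SimpleGraph (Fin k)} (h : core H = F) :
    coreCover H = coreCover F ∧ coreU₁ H = coreU₁ F ∧ coreU₂ H = coreU₂ F ∧
      coreSet H = coreSet F ∧ IsMinVertexCover H = IsMinVertexCover F := by
  subst h
  exact ⟨(coreCover_core H).symm, (coreU₁_core H).symm, (coreU₂_core H).symm,
    (coreSet_core H).symm, (isMinVertexCover_core H).symm⟩

/-- The edges of `E*_F` lead from the cover `W` to vertices outside the core. -/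
theorem starEdges_ends {k : ℕ} {F : SimpleGraph (Fin k)} {x y : Fin k}
    (h : (starEdges F).Adj x y) :
    (x ∈ coreCover F ∧ y ∉ coreSet F) ∨ (y ∈ coreCover F ∧ x ∉ coreSet F) := by
  obtain ⟨H, hH, hxy, hF⟩ := starEdges_adj.1 h
  obtain ⟨hW, -, -, hS, -⟩ := core_eq_imp hH
  have hout : ¬ (x ∈ coreSet F ∧ y ∈ coreSet F) := fun hc => hF (by
    rw [← hH, core, restrict_adj, hS]
    exact ⟨hxy, hc⟩)
  have hWs := coreCover_subset F
  rcases (isMinVertexCover_coreCover H).1 hxy with h | h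
  · rw [hW] at h
    exact Or.inl ⟨h, fun hy => hout ⟨hWs h, hy⟩⟩
  · rw [hW] at h
    exact Or.inr ⟨h, fun hx => hout ⟨hx, hWs h⟩⟩

/-- In the greedy condition for a set inside the core, at most one edge of `E*_F` is used, so adding
several of these edges at once does no more than adding them one at a time. -/
theorem canMatch_sup_star {k : ℕ} {F E : SimpleGraph (Fin k)} (hE : E ≤ starEdges F)
    {U : Finset (Fin k)} {x : Fin k} (hU : U ⊆ coreSet F)
    (h : CanMatch (F ⊔ E) (insert x U) (coreCover F)) (hF : core F = F) :
    ∃ H, core H = F ∧ CanMatch H (insert x U) (coreCover F) := by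
  obtain ⟨f, hf, hfU⟩ := h
  have hWs := coreCover_subset F
  have hin : ∀ u, u ∈ coreSet F → f u ∈ coreCover F → (F ⊔ E).Adj u (f u) → F.Adj u (f u) := by
    intro u hu hfu hadj
    rcases hadj with h | h
    · exact h
    · rcases starEdges_ends (hE h) with h | h
      · exact absurd (hWs hfu) h.2
      · exact absurd hu h.2
  have hx := hfU x (Finset.mem_insert_self _ _)
  obtain ⟨H, hH, hHx⟩ : ∃ H, core H = F ∧ H.Adj x (f x) := by
    rcases hx.2 with h | h
    · exact ⟨F, hF, h⟩
    · obtain ⟨H, hH, hxy, -⟩ := starEdges_adj.1 (hE h)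
      exact ⟨H, hH, hxy⟩
  refine ⟨H, hH, f, hf, fun u hu => ⟨(hfU u hu).1, ?_⟩⟩
  rcases Finset.mem_insert.1 hu with rfl | hu'
  · exact hHx
  · have := hin u (hU hu') (hfU u hu).1 (hfU u hu).2
    rw [← hH] at this
    exact core_le H this

/-- The graphs with core `F` are exactly the graphs `F ∪ E` with `E ⊆ E*_F`. -/
theorem core_eq_iff {k : ℕ} {F : SimpleGraph (Fin k)} (hF : F ∈ Set.range (core (k := k)))
    {H : SimpleGraph (Fin k)} : core H = F ↔ ∃ E ≤ starEdges F, H = F ⊔ E := by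
  have hFF : core F = F := by
    obtain ⟨H, rfl⟩ := hF
    exact core_core H
  constructor
  · intro h
    refine ⟨H \ F, ?_, ?_⟩
    · intro x y hxy
      rw [SimpleGraph.sdiff_adj] at hxy
      exact starEdges_adj.2 ⟨H, h, hxy⟩
    · have hle : F ≤ H := h ▸ core_le H
      exact (sup_sdiff_cancel_right hle).symm
  · rintro ⟨E, hE, rfl⟩
    have hmin : IsMinVertexCover (F ⊔ E) = IsMinVertexCover F := by
      have hcov : ∀ C, IsMinVertexCover F C → (F ⊔ E).IsVertexCover (C : Set (Fin k)) := by
        intro C hC x y hxy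
        rcases hxy with h | h
        · exact hC.1 h
        · obtain ⟨H, hH, hxy, -⟩ := starEdges_adj.1 (hE h)
          have := (core_eq_imp hH).2.2.2.2
          rw [← this] at hC
          exact hC.1 hxy
      have hvc : vc (F ⊔ E) = vc F := by
        refine le_antisymm ?_ (vc_mono le_sup_left)
        obtain ⟨C, hC⟩ := exists_isMinVertexCover F
        rw [← hC.2]
        exact vc_le_card (hcov C hC)
      funext C
      refine propext ⟨fun h => ⟨h.1.mono le_sup_left, h.2.trans hvc⟩,
        fun h => ⟨hcov C h, h.2.trans hvc.symm⟩⟩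
    have hW : coreCover (F ⊔ E) = coreCover F := by
      rw [coreCover, hmin, ← coreCover]
    have hU1 : coreU₁ (F ⊔ E) = coreU₁ F := by
      obtain ⟨h1, h2, -⟩ := coreU₁_spec F
      rw [coreU₁, hW, matchedSet_eq_iff]
      refine ⟨h1, h2.mono le_sup_left subset_rfl, fun x hx hxU h => ?_⟩
      obtain ⟨H, hH, hm⟩ := canMatch_sup_star hE
        ((Finset.filter_subset _ _).trans (coreU₁_subset F)) h hFF
      obtain ⟨e1, e2, -⟩ := core_eq_imp hH
      have h3 := (coreU₁_spec H).2.2 x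
      rw [e1, e2] at h3
      exact h3 hx hxU hm
    have hU2 : coreU₂ (F ⊔ E) = coreU₂ F := by
      obtain ⟨h1, h2, -⟩ := coreU₂_spec F
      rw [coreU₂, hW, hU1, matchedSet_eq_iff]
      refine ⟨h1, h2.mono le_sup_left subset_rfl, fun x hx hxU h => ?_⟩
      obtain ⟨H, hH, hm⟩ := canMatch_sup_star hE
        ((Finset.filter_subset _ _).trans (coreU₂_subset F)) h hFF
      obtain ⟨e1, e2, e3, -⟩ := core_eq_imp hH
      have h3 := (coreU₂_spec H).2.2 x
      rw [e1, e2, e3] at h3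
      exact h3 hx hxU hm
    have hS : coreSet (F ⊔ E) = coreSet F := by
      rw [coreSet_eq, hW, hU1, hU2, ← coreSet_eq]
    rw [core, hS]
    ext x y
    rw [restrict_adj, SimpleGraph.sup_adj]
    constructor
    · rintro ⟨h | h, hx, hy⟩
      · exact h
      · rcases starEdges_ends (hE h) with h | h
        exacts [absurd hy h.2, absurd hx h.2]
    · intro h
      refine ⟨Or.inl h, ?_⟩
      rw [← hFF, core, restrict_adj] at h
      exact h.2

theorem core_of_mem_range {k : ℕ} {F : SimpleGraph (Fin k)}
    (hF : F ∈ Set.range (core (k := k))) : core F = F := by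
  obtain ⟨H, rfl⟩ := hF
  exact core_core H

theorem core_adj_mem {k : ℕ} {F : SimpleGraph (Fin k)} (hF : F ∈ Set.range (core (k := k)))
    {x y : Fin k} (h : F.Adj x y) : x ∈ coreSet F ∧ y ∈ coreSet F := by
  rw [← core_of_mem_range hF, core, restrict_adj] at h
  exact h.2

theorem starEdges_bot {k : ℕ} : starEdges (⊥ : SimpleGraph (Fin k)) = ⊥ := by
  rw [eq_bot_iff]
  intro x y h
  obtain ⟨H, hH, hxy, -⟩ := starEdges_adj.1 h
  have : vc H = 0 := by rw [← vc_core, hH, vc_eq_zero]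
  rw [vc_eq_zero.1 this] at hxy
  exact hxy

/-- Up to the choice of `3w` vertices containing the core, a core with vertex cover number `w` is
a graph on `3w` vertices. -/
theorem card_cores_le {k w : ℕ} (hk : 0 < k) :
    (Finset.univ.filter fun F : SimpleGraph (Fin k) =>
      F ∈ Set.range (core (k := k)) ∧ vc F = w).card ≤ k ^ (3 * w) * 2 ^ (9 * w ^ 2) := by
  let m := 3 * w
  let Φ : (Fin m → Fin k) × (Fin m → Fin m → Bool) → SimpleGraph (Fin k) := fun q =>
    SimpleGraph.fromRel fun x y => ∃ a b, q.1 a = x ∧ q.1 b = y ∧ q.2 a b = true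
  have hsub : (Finset.univ.filter fun F : SimpleGraph (Fin k) =>
      F ∈ Set.range (core (k := k)) ∧ vc F = w) ⊆ Finset.univ.image Φ := by
    intro F hF
    obtain ⟨hF, hw⟩ := (Finset.mem_filter.1 hF).2
    have hcard : (coreSet F).card ≤ m := (card_coreSet_le F).trans_eq (by rw [hw])
    obtain ⟨g, hg⟩ : ∃ g : Fin m → Fin k, ∀ x ∈ coreSet F, ∃ a, g a = x := by
      let e := (coreSet F).equivFin
      refine ⟨fun a => if h : (a : ℕ) < (coreSet F).card then e.symm ⟨a, h⟩ else ⟨0, hk⟩, ?_⟩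
      intro x hx
      refine ⟨⟨e ⟨x, hx⟩, (e ⟨x, hx⟩).2.trans_le hcard⟩, ?_⟩
      simp
    refine Finset.mem_image.2 ⟨(g, fun a b => decide (F.Adj (g a) (g b))), Finset.mem_univ _, ?_⟩
    ext x y
    simp only [Φ, SimpleGraph.fromRel_adj, decide_eq_true_eq]
    constructor
    · rintro ⟨-, ⟨a, b, rfl, rfl, h⟩ | ⟨a, b, rfl, rfl, h⟩⟩
      exacts [h, h.symm]
    · intro h
      obtain ⟨a, ha⟩ := hg x (core_adj_mem hF h).1
      obtain ⟨b, hb⟩ := hg y (core_adj_mem hF h).2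
      exact ⟨h.ne, Or.inl ⟨a, b, ha, hb, by rw [ha, hb]; exact h⟩⟩
  refine (Finset.card_le_card hsub).trans (Finset.card_image_le.trans ?_)
  simp only [Finset.card_univ, Fintype.card_prod, Fintype.card_fun, Fintype.card_fin,
    Fintype.card_bool, m]
  rw [← pow_mul, show 3 * w * (3 * w) = 9 * w ^ 2 by ring]

/-! ### Characters on tuples -/

/-- The factor contributed to a character by the pattern edge `e` placed on the tuple `t`. -/
def edgeWeight {k n : ℕ} (p : ℝ) (G : SimpleGraph (Vertex k n)) (t : Fin k → Fin n)
    (e : Sym2 (Fin k)) : ℝ :=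
  if e.map (fun i => (i, t i)) ∈ G.edgeSet then (1 - p) / p else -1

/-- The character of the pattern graph `H` placed on the tuple `t`. -/
def tupleChar {k n : ℕ} (p : ℝ) (G : SimpleGraph (Vertex k n)) (t : Fin k → Fin n)
    (H : SimpleGraph (Fin k)) : ℝ :=
  ∏ e ∈ H.edgeFinset, edgeWeight p G t e

/-- The sum of the characters of all graphs with edge set `E(F[B]) ∪ E`, `E ⊆ E*_F[B]`, placed on
`t`, in product form. -/
def familyChar {k n : ℕ} (p : ℝ) (G : SimpleGraph (Vertex k n)) (F : SimpleGraph (Fin k))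
    (B : Finset (Fin k)) (t : Fin k → Fin n) : ℝ :=
  tupleChar p G t (restrict F B) *
    ∏ e ∈ (restrict (starEdges F) B).edgeFinset, (1 + edgeWeight p G t e)

/-- The character sum over a rectangle of the graphs with core `F`, restricted to `B`. -/
def coreSum {k n : ℕ} (p : ℝ) (G : SimpleGraph (Vertex k n)) (F : SimpleGraph (Fin k))
    (B : Finset (Fin k)) (Q : Rect k n) : ℝ :=
  ∑ t ∈ Fintype.piFinset Q, familyChar p G F B t

/-- All edges of `H` are inside `B`. -/
def SupportedOn {k : ℕ} (H : SimpleGraph (Fin k)) (B : Finset (Fin k)) : Prop :=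
  ∀ ⦃x y⦄, H.Adj x y → x ∈ B

/-- The graphs inside `B` with property `P`. -/
def graphsOn {k : ℕ} (B : Finset (Fin k)) (P : SimpleGraph (Fin k) → Prop) :
    Finset (SimpleGraph (Fin k)) :=
  Finset.univ.filter fun H => SupportedOn H B ∧ P H

/-- The cores inside `B` with property `P`. -/
def coresOn {k : ℕ} (B : Finset (Fin k)) (P : SimpleGraph (Fin k) → Prop) :
    Finset (SimpleGraph (Fin k)) :=
  Finset.univ.filter fun F => F ∈ Set.range (core (k := k)) ∧ SupportedOn F B ∧ P F

theorem mem_graphsOn {k : ℕ} {B : Finset (Fin k)} {P : SimpleGraph (Fin k) → Prop}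
    {H : SimpleGraph (Fin k)} : H ∈ graphsOn B P ↔ SupportedOn H B ∧ P H := by
  simp [graphsOn]

theorem mem_coresOn {k : ℕ} {B : Finset (Fin k)} {P : SimpleGraph (Fin k) → Prop}
    {F : SimpleGraph (Fin k)} :
    F ∈ coresOn B P ↔ F ∈ Set.range (core (k := k)) ∧ SupportedOn F B ∧ P F := by
  simp only [coresOn, Finset.mem_filter, Finset.mem_univ, true_and]

theorem SupportedOn.restrict_eq {k : ℕ} {H : SimpleGraph (Fin k)} {B : Finset (Fin k)}
    (h : SupportedOn H B) : restrict H B = H := by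
  ext x y
  rw [restrict_adj]
  exact ⟨fun h => h.1, fun hxy => ⟨hxy, h hxy, h hxy.symm⟩⟩

theorem supportedOn_restrict {k : ℕ} (H : SimpleGraph (Fin k)) (B : Finset (Fin k)) :
    SupportedOn (restrict H B) B := fun _ _ h => (restrict_adj.1 h).2.1

theorem SupportedOn.mono {k : ℕ} {H H' : SimpleGraph (Fin k)} {B : Finset (Fin k)}
    (h : SupportedOn H B) (hH : H' ≤ H) : SupportedOn H' B := fun _ _ hxy => h (hH hxy)

/-- A product over the edges inside `B`, separated into the edges that avoid `j ∈ B` and those at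
`j`. -/
theorem prod_restrict_erase {k : ℕ} (H : SimpleGraph (Fin k)) {B : Finset (Fin k)} {j : Fin k}
    (hj : j ∈ B) (φ : Sym2 (Fin k) → ℝ) :
    ∏ e ∈ (restrict H B).edgeFinset, φ e =
      (∏ e ∈ (restrict H (B.erase j)).edgeFinset, φ e) *
        ∏ x ∈ B.filter (H.Adj j), φ s(j, x) := by
  have himg : ∏ x ∈ B.filter (H.Adj j), φ s(j, x) =
      ∏ e ∈ (B.filter (H.Adj j)).image (fun x => s(j, x)), φ e := by
    rw [Finset.prod_image]
    intro a _ b _ hab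
    exact Sym2.congr_right.1 hab
  rw [himg, ← Finset.prod_union]
  · congr 1
    ext e
    induction e with
    | _ x y =>
      simp only [SimpleGraph.mem_edgeFinset, SimpleGraph.mem_edgeSet, restrict_adj,
        Finset.mem_union, Finset.mem_image, Finset.mem_filter, Finset.mem_erase]
      constructor
      · rintro ⟨h, hx, hy⟩
        by_cases hxj : x = j
        · subst hxj
          exact Or.inr ⟨y, ⟨hy, h⟩, rfl⟩
        by_cases hyj : y = j
        · subst hyj
          exact Or.inr ⟨x, ⟨hx, h.symm⟩, Sym2.eq_swap⟩
        exact Or.inl ⟨h, ⟨hxj, hx⟩, hyj, hy⟩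
      · rintro (⟨h, hx, hy⟩ | ⟨z, ⟨hz, h⟩, hzz⟩)
        · exact ⟨h, hx.2, hy.2⟩
        · rcases Sym2.eq_iff.1 hzz with ⟨rfl, rfl⟩ | ⟨rfl, rfl⟩
          exacts [⟨h, hj, hz⟩, ⟨h.symm, hz, hj⟩]
  · rw [Finset.disjoint_left]
    intro e he he'
    obtain ⟨z, hz, rfl⟩ := Finset.mem_image.1 he'
    simp [restrict_adj] at he

theorem character_placed_of_injective {ι V : Type*} [Fintype ι] (p : ℝ) (G : SimpleGraph V)
    (H : SimpleGraph ι) {f : ι → V} (hf : Function.Injective f) :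
    character p G (placed H f) =
      ∏ e ∈ H.edgeFinset, if e.map f ∈ G.edgeSet then (1 - p) / p else -1 :=
  Finset.prod_image (Sym2.map.injective hf).injOn

theorem character_placed {k n : ℕ} (p : ℝ) (G : SimpleGraph (Vertex k n)) (t : Fin k → Fin n)
    (H : SimpleGraph (Fin k)) :
    character p G (placed H fun i => (i, t i)) = tupleChar p G t H := by
  rw [character_placed_of_injective p G H fun a b h => congrArg Prod.fst h]
  rfl

theorem character_placed_induce {k n : ℕ} (p : ℝ) (G : SimpleGraph (Vertex k n))
    (t : Fin k → Fin n) (H : SimpleGraph (Fin k)) (B : Finset (Fin k)) :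
    character p G (placed (H.induce (B : Set (Fin k))) fun i => ((i : Fin k), t i)) =
      tupleChar p G t (restrict H B) := by
  rw [← character_placed]
  unfold placed
  congr 1
  ext e
  simp only [Finset.mem_image, SimpleGraph.mem_edgeFinset]
  constructor
  · rintro ⟨a, ha, rfl⟩
    induction a with
    | _ x y =>
      refine ⟨s((x : Fin k), (y : Fin k)), ?_, rfl⟩
      rw [SimpleGraph.mem_edgeSet] at ha ⊢
      exact restrict_adj.2 ⟨ha, by exact_mod_cast x.2, by exact_mod_cast y.2⟩
  · rintro ⟨a, ha, rfl⟩
    induction a with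
    | _ x y =>
      rw [SimpleGraph.mem_edgeSet] at ha
      obtain ⟨h, hx, hy⟩ := restrict_adj.1 ha
      refine ⟨s(⟨x, by exact_mod_cast hx⟩, ⟨y, by exact_mod_cast hy⟩), ?_, rfl⟩
      rw [SimpleGraph.mem_edgeSet]
      exact h

theorem edgeWeight_mk {k n : ℕ} {p : ℝ} {G : SimpleGraph (Vertex k n)} {t : Fin k → Fin n}
    {x y : Fin k} :
    edgeWeight p G t s(x, y) = if G.Adj (x, t x) (y, t y) then (1 - p) / p else -1 := by
  simp [edgeWeight]

theorem one_add_edgeWeight {k n : ℕ} {p : ℝ} (hp : 0 < p) {G : SimpleGraph (Vertex k n)}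
    {t : Fin k → Fin n} {x y : Fin k} :
    1 + edgeWeight p G t s(x, y) = p⁻¹ * if G.Adj (x, t x) (y, t y) then 1 else 0 := by
  rw [edgeWeight_mk]
  split_ifs
  · field_simp
    ring
  · ring

theorem edgeWeight_eq {k n : ℕ} {p : ℝ} (hp : 0 < p) {G : SimpleGraph (Vertex k n)}
    {t : Fin k → Fin n} {x y : Fin k} :
    edgeWeight p G t s(x, y) = (p⁻¹ * if G.Adj (x, t x) (y, t y) then 1 else 0) + -1 := by
  rw [← one_add_edgeWeight hp]
  ring

/-! ### Sums over families of graphs -/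

theorem tupleChar_sup {k n : ℕ} (p : ℝ) (G : SimpleGraph (Vertex k n)) (t : Fin k → Fin n)
    {F E : SimpleGraph (Fin k)} (h : Disjoint F E) :
    tupleChar p G t (F ⊔ E) = tupleChar p G t F * tupleChar p G t E := by
  unfold tupleChar
  rw [← Finset.prod_union (by rw [SimpleGraph.disjoint_edgeFinset]; exact h)]
  congr 1
  ext e
  simp

theorem sum_tupleChar_le {k n : ℕ} (p : ℝ) (G : SimpleGraph (Vertex k n)) (t : Fin k → Fin n)
    (S : SimpleGraph (Fin k)) :
    ∑ E ∈ Finset.univ.filter (· ≤ S), tupleChar p G t E =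
      ∏ e ∈ S.edgeFinset, (1 + edgeWeight p G t e) := by
  rw [Finset.prod_one_add]
  refine Finset.sum_bij (fun E _ => E.edgeFinset) ?_ ?_ ?_ ?_
  · intro E hE
    rw [Finset.mem_powerset, SimpleGraph.edgeFinset_subset_edgeFinset]
    exact (Finset.mem_filter.1 hE).2
  · intro E _ E' _ h
    exact SimpleGraph.edgeFinset_inj.1 h
  · intro A hA
    rw [Finset.mem_powerset] at hA
    have hS : SimpleGraph.fromEdgeSet (A : Set (Sym2 (Fin k))) ≤ S := by
      intro x y hxy
      rw [SimpleGraph.fromEdgeSet_adj] at hxy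
      have := hA (by exact_mod_cast hxy.1)
      rwa [SimpleGraph.mem_edgeFinset, SimpleGraph.mem_edgeSet] at this
    refine ⟨SimpleGraph.fromEdgeSet (A : Set (Sym2 (Fin k))), by simpa using hS, ?_⟩
    have hmem : ∀ (E : SimpleGraph (Fin k)) e, e ∈ E.edgeFinset ↔ e ∈ E.edgeSet :=
      fun E e => SimpleGraph.mem_edgeFinset
    ext e
    rw [hmem, SimpleGraph.edgeSet_fromEdgeSet]
    constructor
    · intro h; exact_mod_cast h.1
    · intro h
      refine ⟨by exact_mod_cast h, fun hd => ?_⟩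
      have := hA h
      rw [SimpleGraph.mem_edgeFinset] at this
      exact S.not_isDiag_of_mem_edgeSet this hd
  · intro E _
    rfl

theorem starEdges_disjoint {k : ℕ} (F : SimpleGraph (Fin k)) : Disjoint F (starEdges F) := by
  rw [disjoint_iff, eq_bot_iff]
  intro x y h
  obtain ⟨-, -, -, h2⟩ := starEdges_adj.1 h.2
  exact h2 h.1

/-- `familyChar` is the product form of the sum over the family `H(F, E*_F[B])`: each edge of
`E*_F[B]` is either absent or present and contributes `1 + χ_e`. -/
theorem sum_family {k n : ℕ} (p : ℝ) (G : SimpleGraph (Vertex k n)) (t : Fin k → Fin n)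
    (F : SimpleGraph (Fin k)) (B : Finset (Fin k)) :
    ∑ H ∈ family F (restrict (starEdges F) B), tupleChar p G t (restrict H B) =
      familyChar p G F B t := by
  have hfam : family F (restrict (starEdges F) B) =
      (Finset.univ.filter (· ≤ restrict (starEdges F) B)).image (F ⊔ ·) := by
    ext H
    simp only [family, Finset.mem_filter, Finset.mem_univ, true_and, Finset.mem_image]
    constructor
    · rintro ⟨E, hE, rfl⟩; exact ⟨E, hE, rfl⟩
    · rintro ⟨E, hE, rfl⟩; exact ⟨E, hE, rfl⟩
  have hdis : ∀ E ≤ restrict (starEdges F) B, Disjoint F E := fun E hE =>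
    (starEdges_disjoint F).mono_right (hE.trans (restrict_le _ _))
  rw [hfam, Finset.sum_image]
  · rw [familyChar, ← sum_tupleChar_le, Finset.mul_sum]
    refine Finset.sum_congr rfl fun E hE => ?_
    have hE := (Finset.mem_filter.1 hE).2
    rw [← tupleChar_sup _ _ _ ((hdis E hE).mono_left (restrict_le _ _))]
    congr 1
    ext x y
    simp only [restrict_adj, SimpleGraph.sup_adj]
    constructor
    · rintro ⟨h | h, hx, hy⟩
      exacts [Or.inl ⟨h, hx, hy⟩, Or.inr h]
    · rintro (h | h)
      · exact ⟨Or.inl h.1, h.2⟩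
      · exact ⟨Or.inr h, (restrict_adj.1 (hE h)).2⟩
  · intro E hE E' hE' h
    have h1 := hdis E (by simpa using hE)
    have h2 := hdis E' (by simpa using hE')
    have h : F ⊔ E = F ⊔ E' := h
    rw [← h1.sdiff_eq_right, ← h2.sdiff_eq_right, ← sup_sdiff_left_self, h, sup_sdiff_left_self]

/-- Grouping pattern graphs by their cores. -/
theorem sum_tupleChar_eq_sum_core {k n : ℕ} (p : ℝ) (G : SimpleGraph (Vertex k n))
    (t : Fin k → Fin n) (B : Finset (Fin k)) (P : SimpleGraph (Fin k) → Prop)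
    (hP : ∀ H, P H ↔ P (core H)) :
    ∑ H ∈ graphsOn B P, tupleChar p G t H = ∑ F ∈ coresOn B P, familyChar p G F B t := by
  rw [← Finset.sum_fiberwise_of_maps_to (g := core) (t := coresOn B P)]
  · refine Finset.sum_congr rfl fun F hF => ?_
    obtain ⟨hFr, hFB, hFP⟩ := mem_coresOn.1 hF
    rw [← sum_family]
    have : (graphsOn B P).filter (fun H => core H = F) =
        family F (restrict (starEdges F) B) := by
      ext H
      simp only [family, Finset.mem_filter, Finset.mem_univ, true_and, mem_graphsOn]
      constructor
      · rintro ⟨⟨hHB, -⟩, hc⟩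
        obtain ⟨E, hE, rfl⟩ := (core_eq_iff hFr).1 hc
        refine ⟨E, fun x y hxy => ?_, rfl⟩
        exact restrict_adj.2 ⟨hE hxy, hHB (Or.inr hxy), hHB (Or.inr hxy.symm)⟩
      · rintro ⟨E, hE, rfl⟩
        have hc : core (F ⊔ E) = F := (core_eq_iff hFr).2 ⟨E, hE.trans (restrict_le _ _), rfl⟩
        refine ⟨⟨?_, (hP _).2 (by rw [hc]; exact hFP)⟩, hc⟩
        rintro x y (h | h)
        · exact hFB h
        · exact (restrict_adj.1 (hE h)).2.1
    rw [this]
    refine Finset.sum_congr rfl fun H hH => ?_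
    rw [← this] at hH
    have : SupportedOn H B := (mem_graphsOn.1 (Finset.mem_filter.1 hH).1).1
    rw [this.restrict_eq]
  · intro H hH
    obtain ⟨hHB, hHP⟩ := mem_graphsOn.1 hH
    exact mem_coresOn.2 ⟨⟨H, rfl⟩, hHB.mono (core_le H), (hP H).1 hHP⟩

theorem familyChar_bot {k n : ℕ} (p : ℝ) (G : SimpleGraph (Vertex k n)) (B : Finset (Fin k))
    (t : Fin k → Fin n) : familyChar p G ⊥ B t = 1 := by
  have h : ∀ E : SimpleGraph (Fin k), E = ⊥ → ∀ f : Sym2 (Fin k) → ℝ,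
      ∏ e ∈ E.edgeFinset, f e = 1 := by
    intro E hE f
    refine Finset.prod_eq_one fun e he => ?_
    rw [SimpleGraph.mem_edgeFinset, hE] at he
    simp at he
  unfold familyChar tupleChar
  rw [h _ (eq_bot_iff.2 (restrict_le _ _)),
    h _ (eq_bot_iff.2 ((restrict_le _ _).trans starEdges_bot.le)), one_mul]

theorem coreSum_bot {k n : ℕ} (p : ℝ) (G : SimpleGraph (Vertex k n)) (B : Finset (Fin k))
    (Q : Rect k n) : coreSum p G ⊥ B Q = (Fintype.piFinset Q).card := by
  simp [coreSum, familyChar_bot]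

/-! ### Fixing the vertex in one block -/

/-- The rectangle in which the blocks in `Y` are cut down to the common neighbors of `Q j`. -/
def Rect.cut {k n : ℕ} (G : SimpleGraph (Vertex k n)) (Q : Rect k n) (j : Fin k)
    (Y : Finset (Fin k)) : Rect k n := fun x =>
  if x ∈ Y then (Q x).filter fun b => ∀ a ∈ Q j, G.Adj (j, a) (x, b) else Q x

theorem Rect.cut_subset {k n : ℕ} (G : SimpleGraph (Vertex k n)) (Q : Rect k n) (j : Fin k)
    (Y : Finset (Fin k)) (x : Fin k) : Q.cut G j Y x ⊆ Q x := by
  unfold Rect.cut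
  split_ifs
  · exact Finset.filter_subset _ _
  · exact subset_rfl

/-- Indicators of adjacency to the single vertex of block `j` amount to cutting down the rectangle.
-/
theorem sum_cut {k n : ℕ} (G : SimpleGraph (Vertex k n)) {Q : Rect k n} {j : Fin k} {v : Fin n}
    (hQ : Q j = {v}) (Y : Finset (Fin k)) (φ : (Fin k → Fin n) → ℝ) :
    ∑ t ∈ Fintype.piFinset Q,
      (∏ x ∈ Y, if G.Adj (j, t j) (x, t x) then (1 : ℝ) else 0) * φ t =
    ∑ t ∈ Fintype.piFinset (Q.cut G j Y), φ t := by
  have hsub : Fintype.piFinset (Q.cut G j Y) ⊆ Fintype.piFinset Q := by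
    intro t ht
    rw [Fintype.mem_piFinset] at ht ⊢
    exact fun x => Rect.cut_subset G Q j Y x (ht x)
  rw [← Finset.sum_subset hsub]
  · refine Finset.sum_congr rfl fun t ht => ?_
    rw [Fintype.mem_piFinset] at ht
    rw [Finset.prod_eq_one, one_mul]
    intro x hx
    have h1 := ht x
    simp only [Rect.cut, hx, if_true, Finset.mem_filter] at h1
    have h2 : t j ∈ Q j := Rect.cut_subset G Q j Y j (ht j)
    rw [if_pos (h1.2 _ h2)]
  · intro t ht ht'
    rw [Fintype.mem_piFinset] at ht ht'
    push Not at ht'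
    obtain ⟨x, hx⟩ := ht'
    have hxY : x ∈ Y := by
      by_contra hxY
      exact hx (by simpa [Rect.cut, hxY] using ht x)
    have htj : t j = v := by simpa [hQ] using ht j
    simp only [Rect.cut, hxY, if_true, Finset.mem_filter, hQ, Finset.mem_singleton, forall_eq,
      not_and] at hx
    rw [Finset.prod_eq_zero hxY, zero_mul]
    rw [if_neg (htj ▸ hx (ht x))]

/-- Once block `j` consists of a single vertex, the factors of the edges at `j` turn into
restrictions of the other blocks to the neighborhood of that vertex. -/
theorem coreSum_fix {k n : ℕ} {p : ℝ} (hp : 0 < p) (G : SimpleGraph (Vertex k n))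
    (F : SimpleGraph (Fin k)) {B : Finset (Fin k)} {Q : Rect k n} {j : Fin k} {v : Fin n}
    (hjB : j ∈ B) (hQ : Q j = {v}) :
    coreSum p G F B Q = ∑ T ∈ (B.filter (F.Adj j)).powerset,
      (-1) ^ (B.filter (F.Adj j) \ T).card *
        (p⁻¹ ^ (T ∪ B.filter ((starEdges F).Adj j)).card *
          coreSum p G F (B.erase j) (Q.cut G j (T ∪ B.filter ((starEdges F).Adj j)))) := by
  set N := B.filter (F.Adj j) with hN
  set S := B.filter ((starEdges F).Adj j) with hS
  have hNS : Disjoint N S := by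
    rw [Finset.disjoint_left]
    intro x hx hx'
    obtain ⟨-, -, -, h⟩ := starEdges_adj.1 (Finset.mem_filter.1 hx').2
    exact h (Finset.mem_filter.1 hx).2
  have hpt : ∀ t, familyChar p G F B t = ∑ T ∈ N.powerset, (-1) ^ (N \ T).card *
      (p⁻¹ ^ (T ∪ S).card * ((∏ x ∈ T ∪ S, if G.Adj (j, t j) (x, t x) then (1 : ℝ) else 0) *
        familyChar p G F (B.erase j) t)) := by
    intro t
    have h1 := prod_restrict_erase F hjB (edgeWeight p G t)
    have h2 := prod_restrict_erase (starEdges F) hjB (fun e => 1 + edgeWeight p G t e)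
    simp only [one_add_edgeWeight hp] at h2
    rw [← hN] at h1
    rw [← hS] at h2
    have h3 : ∏ x ∈ N, edgeWeight p G t s(j, x) = ∑ T ∈ N.powerset,
        (∏ x ∈ T, p⁻¹ * if G.Adj (j, t j) (x, t x) then (1 : ℝ) else 0) *
          (-1) ^ (N \ T).card := by
      simp only [edgeWeight_eq hp]
      rw [Finset.prod_add]
      simp only [Finset.prod_const]
    rw [h3] at h1
    unfold familyChar tupleChar
    rw [h1, h2, Finset.mul_sum, Finset.sum_mul]
    refine Finset.sum_congr rfl fun T hT => ?_
    have hTS : Disjoint T S := hNS.mono_left (Finset.mem_powerset.1 hT)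
    rw [Finset.prod_union hTS, Finset.card_union_of_disjoint hTS, Finset.prod_mul_distrib,
      Finset.prod_mul_distrib, Finset.prod_const, Finset.prod_const, pow_add]
    ring
  unfold coreSum
  rw [Finset.sum_congr rfl fun t _ => hpt t, Finset.sum_comm]
  refine Finset.sum_congr rfl fun T _ => ?_
  rw [← Finset.mul_sum, ← Finset.mul_sum, sum_cut G hQ]

/-! ### Truncated character sums -/

/-- The sum over a rectangle of the characters of all graphs inside `B` with vertex cover number at
most `m`. -/
def truncSum {k n : ℕ} (p : ℝ) (G : SimpleGraph (Vertex k n)) (m : ℕ) (B : Finset (Fin k))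
    (Q : Rect k n) : ℝ :=
  ∑ t ∈ Fintype.piFinset Q, ∑ H ∈ graphsOn B fun H => vc H ≤ m, tupleChar p G t H

theorem sum_coreSum {k n : ℕ} (p : ℝ) (G : SimpleGraph (Vertex k n)) (B : Finset (Fin k))
    (Q : Rect k n) (P : SimpleGraph (Fin k) → Prop) (hP : ∀ H, P H ↔ P (core H)) :
    ∑ t ∈ Fintype.piFinset Q, ∑ H ∈ graphsOn B P, tupleChar p G t H =
      ∑ F ∈ coresOn B P, coreSum p G F B Q := by
  rw [Finset.sum_congr rfl fun t _ => sum_tupleChar_eq_sum_core p G t B P hP, Finset.sum_comm]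
  rfl

theorem truncSum_eq {k n : ℕ} (p : ℝ) (G : SimpleGraph (Vertex k n)) (m : ℕ)
    (B : Finset (Fin k)) (Q : Rect k n) :
    truncSum p G m B Q = ∑ F ∈ coresOn B fun F => vc F ≤ m, coreSum p G F B Q :=
  sum_coreSum p G B Q (fun H => vc H ≤ m) fun H => by rw [vc_core]

/-- The graph obtained from `H` by joining `j` to the vertices in `T`. -/
def joinAt {k : ℕ} (H : SimpleGraph (Fin k)) (j : Fin k) (T : Finset (Fin k)) :
    SimpleGraph (Fin k) :=
  H ⊔ SimpleGraph.fromRel fun x y => x = j ∧ y ∈ T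

theorem joinAt_adj {k : ℕ} {H : SimpleGraph (Fin k)} {j : Fin k} {T : Finset (Fin k)}
    {x y : Fin k} : (joinAt H j T).Adj x y ↔
      H.Adj x y ∨ (x ≠ y ∧ (x = j ∧ y ∈ T ∨ y = j ∧ x ∈ T)) := by
  simp [joinAt, SimpleGraph.fromRel_adj]

/-- Summing over all graphs inside `B` whose restriction to `B \ {j}` has a given property, the
edges at `j` contribute a factor that forces adjacency to block `j`. -/
theorem sum_tupleChar_erase {k n : ℕ} {p : ℝ} (hp : 0 < p) (G : SimpleGraph (Vertex k n))
    (t : Fin k → Fin n) {B : Finset (Fin k)} {j : Fin k} (hj : j ∈ B)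
    (P : SimpleGraph (Fin k) → Prop) :
    ∑ H ∈ graphsOn B fun H => P (restrict H (B.erase j)), tupleChar p G t H =
    p⁻¹ ^ (B.erase j).card *
      ((∏ x ∈ B.erase j, if G.Adj (j, t j) (x, t x) then (1 : ℝ) else 0) *
      ∑ H ∈ graphsOn (B.erase j) P, tupleChar p G t H) := by
  have h1 : ∏ x ∈ B.erase j, (1 + edgeWeight p G t s(j, x)) = p⁻¹ ^ (B.erase j).card *
      ∏ x ∈ B.erase j, if G.Adj (j, t j) (x, t x) then (1 : ℝ) else 0 := by
    simp only [one_add_edgeWeight hp]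
    rw [Finset.prod_mul_distrib, Finset.prod_const]
  rw [← mul_assoc, ← h1, Finset.prod_one_add, Finset.sum_mul_sum, ← Finset.sum_product']
  refine Finset.sum_bij' (fun H _ => (B.filter (H.Adj j), restrict H (B.erase j)))
    (fun q _ => joinAt q.2 j q.1) ?_ ?_ ?_ ?_ ?_
  · intro H hH
    obtain ⟨hHB, hHP⟩ := mem_graphsOn.1 hH
    refine Finset.mem_product.2 ⟨Finset.mem_powerset.2 fun x hx => ?_,
      mem_graphsOn.2 ⟨supportedOn_restrict _ _, hHP⟩⟩
    have hx := Finset.mem_filter.1 hx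
    exact Finset.mem_erase.2 ⟨hx.2.ne', hx.1⟩
  · intro q hq
    obtain ⟨hq1, hq2⟩ := Finset.mem_product.1 hq
    obtain ⟨hq2, hq3⟩ := mem_graphsOn.1 hq2
    have hq1 := Finset.mem_powerset.1 hq1
    have hr : restrict (joinAt q.2 j q.1) (B.erase j) = q.2 := by
      ext x y
      rw [restrict_adj, joinAt_adj]
      constructor
      · rintro ⟨h | ⟨-, ⟨rfl, -⟩ | ⟨rfl, -⟩⟩, hx, hy⟩
        · exact h
        · simp at hx
        · simp at hy
      · intro h
        exact ⟨Or.inl h, hq2 h, hq2 h.symm⟩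
    refine mem_graphsOn.2 ⟨?_, by rw [hr]; exact hq3⟩
    intro x y h
    rcases joinAt_adj.1 h with h | ⟨-, ⟨rfl, -⟩ | ⟨-, h⟩⟩
    · exact Finset.mem_of_mem_erase (hq2 h)
    · exact hj
    · exact Finset.mem_of_mem_erase (hq1 h)
  · intro H hH
    obtain ⟨hHB, hHP⟩ := mem_graphsOn.1 hH
    ext x y
    simp only [joinAt_adj, restrict_adj, Finset.mem_erase, Finset.mem_filter]
    constructor
    · rintro (h | ⟨-, ⟨rfl, h⟩ | ⟨rfl, h⟩⟩)
      exacts [h.1, h.2, h.2.symm]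
    · intro h
      have hx := hHB h
      have hy := hHB h.symm
      by_cases hxj : x = j
      · subst hxj
        exact Or.inr ⟨h.ne, Or.inl ⟨rfl, hy, h⟩⟩
      by_cases hyj : y = j
      · subst hyj
        exact Or.inr ⟨h.ne, Or.inr ⟨rfl, hx, h.symm⟩⟩
      exact Or.inl ⟨h, ⟨hxj, hx⟩, hyj, hy⟩
  · intro q hq
    obtain ⟨hq1, hq2⟩ := Finset.mem_product.1 hq
    obtain ⟨hq2, hq3⟩ := mem_graphsOn.1 hq2
    have hq1 := Finset.mem_powerset.1 hq1
    refine Prod.ext ?_ ?_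
    · ext x
      simp only [Finset.mem_filter, joinAt_adj]
      constructor
      · rintro ⟨-, h | ⟨hne, ⟨-, h⟩ | ⟨rfl, h⟩⟩⟩
        · exact absurd (hq2 h) (by simp)
        · exact h
        · exact absurd rfl hne
      · intro h
        have := Finset.mem_erase.1 (hq1 h)
        exact ⟨this.2, Or.inr ⟨this.1.symm, Or.inl ⟨trivial, h⟩⟩⟩
    · ext x y
      simp only [restrict_adj, joinAt_adj]
      constructor
      · rintro ⟨h | ⟨-, ⟨rfl, -⟩ | ⟨rfl, -⟩⟩, hx, hy⟩
        · exact h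
        · simp at hx
        · simp at hy
      · intro h
        exact ⟨Or.inl h, hq2 h, hq2 h.symm⟩
  · intro H hH
    obtain ⟨hHB, hHP⟩ := mem_graphsOn.1 hH
    have := prod_restrict_erase H hj (edgeWeight p G t)
    rw [hHB.restrict_eq] at this
    rw [tupleChar, this, mul_comm]
    rfl

/-- Removing `j` lowers the vertex cover number exactly if some minimum vertex cover contains `j`.
-/
theorem exists_minCover_mem_iff {k : ℕ} {H : SimpleGraph (Fin k)} {B : Finset (Fin k)} {j : Fin k}
    {m : ℕ} (hH : SupportedOn H B) :
    vc (restrict H (B.erase j)) ≤ m ↔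
      vc H ≤ m ∨ (vc H = m + 1 ∧ ∃ C, IsMinVertexCover H C ∧ j ∈ C) := by
  have hle := vc_restrict_le_erase H B j
  rw [hH.restrict_eq] at hle
  constructor
  · intro h
    by_cases hm : vc H ≤ m
    · exact Or.inl hm
    have hvc : vc H = m + 1 := by omega
    refine Or.inr ⟨hvc, ?_⟩
    obtain ⟨C, hC, hCm⟩ := vc_le_iff.1 h
    have hcov : H.IsVertexCover ((insert j C : Finset (Fin k)) : Set (Fin k)) := by
      intro x y hxy
      by_cases hxj : x = j
      · left; simp [hxj]
      by_cases hyj : y = j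
      · right; simp [hyj]
      rcases hC (restrict_adj.2 ⟨hxy, Finset.mem_erase.2 ⟨hxj, hH hxy⟩,
        Finset.mem_erase.2 ⟨hyj, hH hxy.symm⟩⟩) with h | h
      · left; simpa using Or.inr h
      · right; simpa using Or.inr h
    refine ⟨insert j C, ⟨hcov, ?_⟩, Finset.mem_insert_self _ _⟩
    have h1 := vc_le_card hcov
    have h2 := Finset.card_insert_le j C
    omega
  · rintro (h | ⟨h, C, hC, hj⟩)
    · exact (vc_mono (restrict_le _ _)).trans h
    · refine vc_le_iff.2 ⟨C.erase j, ?_, ?_⟩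
      · intro x y hxy
        obtain ⟨hxy, hx, hy⟩ := restrict_adj.1 hxy
        rcases hC.1 hxy with h | h
        · left
          simpa using ⟨h, (Finset.mem_erase.1 hx).1⟩
        · right
          simpa using ⟨h, (Finset.mem_erase.1 hy).1⟩
      · rw [Finset.card_erase_of_mem hj, hC.2, h]; simp

/-- Fixing the vertex in block `j`: the graphs with `vc H ≤ m + 1` are those for which removing `j`
leaves `vc ≤ m`, which give a truncated sum over the neighborhood of the fixed vertex, and those
with `vc H = m + 1` none of whose minimum vertex covers contains `j`, a property of the core. -/
theorem truncSum_fix {k n : ℕ} {p : ℝ} (hp : 0 < p) (G : SimpleGraph (Vertex k n)) (m : ℕ)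
    {B : Finset (Fin k)} {Q : Rect k n} {j : Fin k} {v : Fin n} (hjB : j ∈ B) (hQ : Q j = {v}) :
    truncSum p G (m + 1) B Q =
      p⁻¹ ^ (B.erase j).card * truncSum p G m (B.erase j) (Q.cut G j (B.erase j)) +
      ∑ F ∈ coresOn B fun F => vc F = m + 1 ∧ ∀ C, IsMinVertexCover F C → j ∉ C,
        coreSum p G F B Q := by
  have hcore : ∀ H : SimpleGraph (Fin k), (vc H = m + 1 ∧ ∀ C, IsMinVertexCover H C → j ∉ C) ↔
      (vc (core H) = m + 1 ∧ ∀ C, IsMinVertexCover (core H) C → j ∉ C) := by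
    intro H
    rw [vc_core, isMinVertexCover_core]
  rw [← sum_coreSum p G B Q _ hcore]
  have hcut : p⁻¹ ^ (B.erase j).card * truncSum p G m (B.erase j) (Q.cut G j (B.erase j)) =
      ∑ t ∈ Fintype.piFinset Q, ∑ H ∈ graphsOn B
        fun H => vc (restrict H (B.erase j)) ≤ m, tupleChar p G t H := by
    rw [truncSum, ← sum_cut G hQ, Finset.mul_sum]
    refine Finset.sum_congr rfl fun t _ => ?_
    rw [sum_tupleChar_erase hp G t hjB fun H => vc H ≤ m]
  rw [hcut, ← Finset.sum_add_distrib, truncSum]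
  refine Finset.sum_congr rfl fun t _ => ?_
  rw [← Finset.sum_union]
  · refine Finset.sum_congr ?_ fun _ _ => rfl
    ext H
    simp only [mem_graphsOn, Finset.mem_union]
    constructor
    · rintro ⟨hHB, hm⟩
      by_cases h : vc (restrict H (B.erase j)) ≤ m
      · exact Or.inl ⟨hHB, h⟩
      · rw [exists_minCover_mem_iff hHB, not_or, not_and] at h
        refine Or.inr ⟨hHB, by omega, fun C hC hj => h.2 (by omega) ⟨C, hC, hj⟩⟩
    · rintro (⟨hHB, h⟩ | ⟨hHB, h, -⟩)
      · rw [exists_minCover_mem_iff hHB] at h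
        refine ⟨hHB, ?_⟩
        rcases h with h | h <;> omega
      · exact ⟨hHB, h.le⟩
  · rw [Finset.disjoint_left]
    intro H hH hH'
    obtain ⟨hHB, h1⟩ := mem_graphsOn.1 hH
    obtain ⟨-, h2, h3⟩ := mem_graphsOn.1 hH'
    rw [exists_minCover_mem_iff hHB] at h1
    rcases h1 with h | ⟨-, C, hC, hj⟩
    · omega
    · exact h3 C hC hj

/-! ### Rectangles with fixed blocks -/

/-- The blocks outside `B` consist of one vertex each, and block `x ∈ B` lies in the common
neighborhood of the vertices fixed in the blocks `T x`. -/
structure FixedOutside {k n : ℕ} (G : SimpleGraph (Vertex k n)) (B : Finset (Fin k))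
    (Q : Rect k n) (T : Fin k → Finset (Fin k)) : Prop where
  single : ∀ x ∉ B, ∃ v, Q x = {v}
  disj : ∀ x ∈ B, Disjoint (T x) B
  adj : ∀ x ∈ B, ∀ i ∈ T x, ∀ a ∈ Q i, ∀ b ∈ Q x, G.Adj (i, a) (x, b)

/-- An upper bound for the number of tuples in a rectangle whose block `x ∈ B` is contained in a
common neighborhood of `|T x|` vertices. -/
def sizeBound {k : ℕ} (n : ℕ) (p β : ℝ) (B : Finset (Fin k)) (T : Fin k → Finset (Fin k)) : ℝ :=
  ∏ x ∈ B, β * (p ^ (T x).card * n)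

theorem sizeBound_congr {k n : ℕ} {p β : ℝ} {B : Finset (Fin k)} {T T' : Fin k → Finset (Fin k)}
    (h : ∀ x ∈ B, T x = T' x) : sizeBound n p β B T = sizeBound n p β B T' :=
  Finset.prod_congr rfl fun x hx => by rw [h x hx]

theorem sizeBound_nonneg {k n : ℕ} {p β : ℝ} (hp : 0 < p) (hβ : 1 ≤ β) (B : Finset (Fin k))
    (T : Fin k → Finset (Fin k)) : 0 ≤ sizeBound n p β B T :=
  Finset.prod_nonneg fun x _ => by positivity

theorem FixedOutside.congr {k n : ℕ} {G : SimpleGraph (Vertex k n)} {B : Finset (Fin k)}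
    {Q : Rect k n} {T T' : Fin k → Finset (Fin k)} (h : FixedOutside G B Q T)
    (hT : ∀ x ∈ B, T x = T' x) : FixedOutside G B Q T' where
  single := h.single
  disj x hx := hT x hx ▸ h.disj x hx
  adj x hx := hT x hx ▸ h.adj x hx

theorem FixedOutside.mono {k n : ℕ} {G : SimpleGraph (Vertex k n)} {B : Finset (Fin k)}
    {Q Q' : Rect k n} {T : Fin k → Finset (Fin k)} (h : FixedOutside G B Q T)
    (hsub : ∀ x, Q' x ⊆ Q x) (heq : ∀ x ∉ B, Q' x = Q x) : FixedOutside G B Q' T where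
  single x hx := heq x hx ▸ h.single x hx
  disj := h.disj
  adj x hx i hi a ha b hb := h.adj x hx i hi a (hsub i ha) b (hsub x hb)

/-- After cutting the blocks in `Y` down to the neighborhood of the fixed vertex of block `j`, the
block `j` joins the fixed ones. -/
theorem FixedOutside.cut {k n : ℕ} {G : SimpleGraph (Vertex k n)} {B : Finset (Fin k)}
    {Q : Rect k n} {T : Fin k → Finset (Fin k)} (h : FixedOutside G B Q T) {j : Fin k} {v : Fin n}
    (hj : j ∈ B) (hQ : Q j = {v}) {Y : Finset (Fin k)} (hY : Y ⊆ B.erase j) :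
    FixedOutside G (B.erase j) (Q.cut G j Y) fun x => if x ∈ Y then insert j (T x) else T x where
  single x hx := by
    have hxY : x ∉ Y := fun h => hx (hY h)
    simp only [Rect.cut, hxY, if_false]
    by_cases hxj : x = j
    · exact ⟨v, hxj ▸ hQ⟩
    · exact h.single x fun hxB => hx (Finset.mem_erase.2 ⟨hxj, hxB⟩)
  disj x hx := by
    have hd := (h.disj x (Finset.mem_of_mem_erase hx)).mono_right (Finset.erase_subset j B)
    split_ifs
    · rw [Finset.disjoint_insert_left]
      exact ⟨Finset.notMem_erase j B, hd⟩
    · exact hd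
  adj x hx i hi a ha b hb := by
    have hxB := Finset.mem_of_mem_erase hx
    have ha' := Rect.cut_subset G Q j Y i ha
    have hb' := Rect.cut_subset G Q j Y x hb
    by_cases hxY : x ∈ Y
    · simp only [hxY, if_true] at hi
      rcases Finset.mem_insert.1 hi with rfl | hi
      · simp only [Rect.cut, hxY, if_true, Finset.mem_filter] at hb
        exact hb.2 a ha'
      · exact h.adj x hxB i hi a ha' b hb'
    · simp only [hxY, if_false] at hi
      exact h.adj x hxB i hi a ha' b hb'

/-- The factors `p⁻¹` that arise from fixing a vertex are compensated by the shrinking of the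
blocks. -/
theorem sizeBound_cut {k n : ℕ} {G : SimpleGraph (Vertex k n)} {B : Finset (Fin k)}
    {Q : Rect k n} {T : Fin k → Finset (Fin k)} (h : FixedOutside G B Q T) {p β : ℝ} (hp : 0 < p)
    {j : Fin k} (hj : j ∈ B) {Y : Finset (Fin k)} (hY : Y ⊆ B.erase j) :
    p⁻¹ ^ Y.card * sizeBound n p β (B.erase j) (fun x => if x ∈ Y then insert j (T x) else T x) =
      sizeBound n p β (B.erase j) T := by
  unfold sizeBound
  rw [← Finset.prod_sdiff hY, ← Finset.prod_sdiff hY, ← Finset.prod_const, mul_left_comm,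
    ← Finset.prod_mul_distrib]
  congr 1
  · refine Finset.prod_congr rfl fun x hx => ?_
    simp only [if_neg (Finset.mem_sdiff.1 hx).2]
  · refine Finset.prod_congr rfl fun x hx => ?_
    have hjT : j ∉ T x := fun hjT =>
      Finset.disjoint_left.1 (h.disj x (Finset.mem_of_mem_erase (hY hx))) hjT hj
    simp only [if_pos hx, Finset.card_insert_of_notMem hjT, pow_succ]
    field_simp

theorem sum_split_block {k n : ℕ} (Q : Rect k n) (j : Fin k) (φ : (Fin k → Fin n) → ℝ) :
    ∑ t ∈ Fintype.piFinset Q, φ t =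
      ∑ v ∈ Q j, ∑ t ∈ Fintype.piFinset (Function.update Q j {v}), φ t := by
  rw [← Finset.sum_fiberwise_of_maps_to (g := fun t : Fin k → Fin n => t j) (t := Q j)
    fun t ht => Fintype.mem_piFinset.1 ht j]
  refine Finset.sum_congr rfl fun v hv => Finset.sum_congr ?_ fun _ _ => rfl
  ext t
  simp only [Finset.mem_filter, Fintype.mem_piFinset]
  constructor
  · rintro ⟨h, rfl⟩ x
    by_cases hx : x = j
    · subst hx; simp
    · simpa [hx] using h x
  · intro h
    have hj : t j = v := by simpa using h j
    refine ⟨fun x => ?_, hj⟩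
    by_cases hx : x = j
    · subst hx; rwa [hj]
    · simpa [hx] using h x

theorem card_filter_adj_le {k : ℕ} {F : SimpleGraph (Fin k)}
    (hF : F ∈ Set.range (core (k := k))) (B : Finset (Fin k)) (j : Fin k) :
    (B.filter (F.Adj j)).card ≤ 3 * vc F := by
  refine (Finset.card_le_card fun x hx => ?_).trans (card_coreSet_le F)
  exact (core_adj_mem hF (Finset.mem_filter.1 hx).2).2

/-- A bound for the sums over `B \ {j}` gives a bound for the sum over `B` with one fixed vertex in
block `j`. The factor `2 ^ (3 * vc F)` is the number of terms of `coreSum_fix`, as `j` has at most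
`3 * vc F` neighbors in the core. -/
theorem abs_coreSum_fix_le {k n : ℕ} {p β : ℝ} (hp : 0 < p) (hβ : 1 ≤ β)
    {G : SimpleGraph (Vertex k n)}
    {F : SimpleGraph (Fin k)} (hF : F ∈ Set.range (core (k := k))) {B : Finset (Fin k)}
    {Q : Rect k n} {T : Fin k → Finset (Fin k)} (h : FixedOutside G B Q T) {j : Fin k} {v : Fin n}
    (hj : j ∈ B) (hQ : Q j = {v}) {c : ℝ} (hc : 0 ≤ c)
    (hbound : ∀ Q' T', FixedOutside G (B.erase j) Q' T' →
      |coreSum p G F (B.erase j) Q'| ≤ c * sizeBound n p β (B.erase j) T') :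
    |coreSum p G F B Q| ≤ 2 ^ (3 * vc F) * c * sizeBound n p β (B.erase j) T := by
  rw [coreSum_fix hp G F hj hQ]
  refine (Finset.abs_sum_le_sum_abs _ _).trans ?_
  have hterm : ∀ S ∈ (B.filter (F.Adj j)).powerset,
      |(-1) ^ (B.filter (F.Adj j) \ S).card *
        (p⁻¹ ^ (S ∪ B.filter ((starEdges F).Adj j)).card *
          coreSum p G F (B.erase j) (Q.cut G j (S ∪ B.filter ((starEdges F).Adj j))))| ≤
      c * sizeBound n p β (B.erase j) T := by
    intro S hS
    set Y := S ∪ B.filter ((starEdges F).Adj j) with hY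
    have hYB : Y ⊆ B.erase j := by
      intro x hx
      rcases Finset.mem_union.1 hx with hx | hx
      · have hx := Finset.mem_filter.1 (Finset.mem_powerset.1 hS hx)
        exact Finset.mem_erase.2 ⟨hx.2.ne', hx.1⟩
      · have hx := Finset.mem_filter.1 hx
        exact Finset.mem_erase.2 ⟨hx.2.ne', hx.1⟩
    rw [abs_mul, abs_pow, abs_neg, abs_one, one_pow, one_mul, abs_mul,
      abs_of_nonneg (by positivity : 0 ≤ p⁻¹ ^ Y.card), ← sizeBound_cut h hp hj hYB, mul_left_comm]
    exact mul_le_mul_of_nonneg_left (hbound _ _ (h.cut hj hQ hYB)) (by positivity)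
  refine (Finset.sum_le_sum hterm).trans ?_
  rw [Finset.sum_const, Finset.card_powerset, nsmul_eq_mul, mul_assoc]
  refine mul_le_mul_of_nonneg_right ?_ (mul_nonneg hc (sizeBound_nonneg hp hβ _ _))
  push_cast
  exact pow_le_pow_right₀ (by norm_num) (card_filter_adj_le hF B j)

/-! ### The parameters of the main estimates -/

/-- The upper bound on common neighborhoods: `|N^∩(t, V_x)| ≤ β p^{|t|} n` for `|t| ≤ L`. -/
def NbhdUpper {k n : ℕ} (G : SimpleGraph (Vertex k n)) (p β : ℝ) (L : ℕ) : Prop :=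
  ∀ (T : Finset (Fin k)) (x : Fin k) (t : Fin k → Fin n), x ∉ T → T.card ≤ L →
    ((Finset.univ.filter fun b => ∀ i ∈ T, G.Adj (i, t i) (x, b)).card : ℝ) ≤
      β * (p ^ T.card * n)

/-- The sum over any rectangle with single vertices in the blocks outside `B` splits into the sum
over a subrectangle on which all core sums are small relative to its size, and at most `Θ` sums over
rectangles that have a fixed vertex in one of the blocks in `B`. -/
def Branching {k n : ℕ} (G : SimpleGraph (Vertex k n)) (p K ρ Θ : ℝ) (d : ℕ) : Prop :=
  ∀ (B : Finset (Fin k)) (Q : Rect k n), (∀ x ∉ B, ∃ v, Q x = {v}) →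
    ∃ (Q₀ : Rect k n) (I : Finset (Fin k × Fin n)) (ch : Fin k × Fin n → Rect k n),
    (∀ φ : (Fin k → Fin n) → ℝ, ∑ t ∈ Fintype.piFinset Q, φ t =
      ∑ t ∈ Fintype.piFinset Q₀, φ t + ∑ a ∈ I, ∑ t ∈ Fintype.piFinset (ch a), φ t) ∧
    (I.card : ℝ) ≤ Θ ∧ (∀ x, Q₀ x ⊆ Q x) ∧
    (∀ a ∈ I, a.1 ∈ B ∧ (∀ x, ch a x ⊆ Q x) ∧ (∀ x ∉ B, ch a x = Q x) ∧ ch a a.1 = {a.2}) ∧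
    ∀ F ∈ Set.range (core (k := k)), vc F ≤ d →
      |coreSum p G F B Q₀| ≤ K * ρ ^ vc (restrict F B) * (Fintype.piFinset Q₀).card

/-- The graph and the numbers that enter the main estimates. Here `β` is the slack in the upper
bound on neighborhoods, `K * ρ' ^ vc` the relative bound for core sums over well-behaved rectangles,
`E * (2 ^ (3 * d) * ρ) ^ vc` the bound for arbitrary rectangles, `Θ` the number of branches, and `d`
the truncation level. The number of cores with vertex cover number `w`, with weights
`(2 ^ (3 * d)) ^ w`, is at most `M ^ w`. -/
structure Setting {k n : ℕ} (G : SimpleGraph (Vertex k n)) (p β K E ρ' ρ M Θ : ℝ) (d : ℕ) :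
    Prop where
  p_pos : 0 < p
  p_le : p ≤ 1
  one_le_β : 1 ≤ β
  n_pos : 0 < n
  k_pos : 0 < k
  K_nonneg : 0 ≤ K
  K_le : 2 * K ≤ E
  one_le_E : 1 ≤ E
  ρ'_nonneg : 0 ≤ ρ'
  ρ'_le : ρ' ≤ ρ
  ρ_le : ρ ≤ 1
  Θ_nonneg : 0 ≤ Θ
  gain : 2 * (Θ * 2 ^ (3 * d)) ≤ ρ * (p ^ (3 * d) * n)
  M_nonneg : 0 ≤ M
  count : ∀ w ≤ d, (k : ℝ) ^ (3 * w) * 2 ^ (9 * w ^ 2) * (2 ^ (3 * d)) ^ w ≤ M ^ w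
  Mρ_le : M * ρ ≤ 1 / 2
  KMρ'_le : K * (2 * (M * ρ')) ≤ 1
  nbhd : NbhdUpper G p β (3 * d)
  branching : Branching G p K ρ' Θ d

theorem FixedOutside.card_block_le {k n : ℕ} {G : SimpleGraph (Vertex k n)} {B : Finset (Fin k)}
    {Q : Rect k n} {T : Fin k → Finset (Fin k)} (h : FixedOutside G B Q T) {p β : ℝ} {L : ℕ}
    (hN : NbhdUpper G p β L) (hL : Bᶜ.card ≤ L) {x : Fin k} (hx : x ∈ B) :
    ((Q x).card : ℝ) ≤ β * (p ^ (T x).card * n) := by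
  have hTsub : T x ⊆ Bᶜ := fun i hi =>
    Finset.mem_compl.2 (Finset.disjoint_left.1 (h.disj x hx) hi)
  have hxT : x ∉ T x := fun hxT => Finset.mem_compl.1 (hTsub hxT) hx
  rcases isEmpty_or_nonempty (Fin n) with hn | ⟨⟨v₀⟩⟩
  · have : n = 0 := by rw [← Fintype.card_fin n, Fintype.card_eq_zero]
    subst this
    simp [Finset.eq_empty_of_isEmpty (Q x)]
  have hv : ∀ i, ∃ v, i ∈ T x → v ∈ Q i := by
    intro i
    by_cases hi : i ∈ T x
    · obtain ⟨v, hv⟩ := h.single i (Finset.mem_compl.1 (hTsub hi))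
      exact ⟨v, fun _ => by simp [hv]⟩
    · exact ⟨v₀, fun h => absurd h hi⟩
  choose t ht using hv
  refine le_trans ?_ (hN (T x) x t hxT ((Finset.card_le_card hTsub).trans hL))
  exact_mod_cast Finset.card_le_card fun b hb => by
    simpa using fun i hi => h.adj x hx i hi (t i) (ht i hi) b hb

theorem card_rect_le {k n : ℕ} {G : SimpleGraph (Vertex k n)} {B : Finset (Fin k)}
    {Q Q' : Rect k n} {T : Fin k → Finset (Fin k)} (h : FixedOutside G B Q T) {p β : ℝ} {L : ℕ}
    (hN : NbhdUpper G p β L) (hL : Bᶜ.card ≤ L) (hsub : ∀ x, Q' x ⊆ Q x) :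
    ((Fintype.piFinset Q').card : ℝ) ≤ sizeBound n p β B T := by
  rw [Fintype.card_piFinset, ← Finset.prod_mul_prod_compl B]
  have h1 : ∏ x ∈ Bᶜ, (Q' x).card ≤ 1 := by
    refine Finset.prod_le_one' fun x hx => ?_
    obtain ⟨v, hv⟩ := h.single x (Finset.mem_compl.1 hx)
    have := Finset.card_le_card (hsub x)
    rwa [hv, Finset.card_singleton] at this
  have h2 : ((∏ x ∈ B, (Q' x).card : ℕ) : ℝ) ≤ sizeBound n p β B T := by
    push_cast
    refine Finset.prod_le_prod (fun _ _ => by positivity) fun x hx => ?_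
    exact le_trans (by exact_mod_cast Finset.card_le_card (hsub x)) (h.card_block_le hN hL hx)
  refine le_trans ?_ h2
  exact_mod_cast (Nat.mul_le_mul_left _ h1).trans_eq (mul_one _)

theorem card_compl_erase {k : ℕ} {B : Finset (Fin k)} {j : Fin k} (hj : j ∈ B) :
    (B.erase j)ᶜ.card = Bᶜ.card + 1 := by
  rw [Finset.compl_erase, Finset.card_insert_of_notMem (by simpa using hj)]

theorem sizeBound_erase {k n : ℕ} {p β : ℝ} {B : Finset (Fin k)} {T : Fin k → Finset (Fin k)}
    {j : Fin k} (hj : j ∈ B) :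
    β * (p ^ (T j).card * n) * sizeBound n p β (B.erase j) T = sizeBound n p β B T :=
  Finset.mul_prod_erase B (fun x => β * (p ^ (T x).card * (n : ℝ))) hj

/-- Without blocks of the cover in `B`, no edges of `F` or `E*_F` are left inside `B`. -/
theorem familyChar_of_disjoint {k n : ℕ} {p : ℝ} {G : SimpleGraph (Vertex k n)}
    {F : SimpleGraph (Fin k)} {B : Finset (Fin k)} (h : coreCover F ∩ B = ∅)
    (t : Fin k → Fin n) : familyChar p G F B t = 1 := by
  have hno : ∀ x, x ∈ coreCover F → x ∉ B := fun x hx hxB => by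
    have : x ∈ coreCover F ∩ B := Finset.mem_inter.2 ⟨hx, hxB⟩
    simp [h] at this
  have h : ∀ E : SimpleGraph (Fin k), E = ⊥ → ∀ f : Sym2 (Fin k) → ℝ,
      ∏ e ∈ E.edgeFinset, f e = 1 := by
    intro E hE f
    refine Finset.prod_eq_one fun e he => ?_
    rw [SimpleGraph.mem_edgeFinset, hE] at he
    simp at he
  unfold familyChar tupleChar
  rw [h, h, one_mul]
  · rw [eq_bot_iff]
    intro x y hxy
    obtain ⟨hxy, hx, hy⟩ := restrict_adj.1 hxy
    rcases starEdges_ends hxy with h | h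
    exacts [hno x h.1 hx, hno y h.1 hy]
  · rw [eq_bot_iff]
    intro x y hxy
    obtain ⟨hxy, hx, hy⟩ := restrict_adj.1 hxy
    rcases (isMinVertexCover_coreCover F).1 hxy with h | h
    exacts [hno x h hx, hno y h hy]

theorem coreSum_split_block {k n : ℕ} (p : ℝ) (G : SimpleGraph (Vertex k n))
    (F : SimpleGraph (Fin k)) (B : Finset (Fin k)) (Q : Rect k n) (j : Fin k) :
    coreSum p G F B Q = ∑ v ∈ Q j, coreSum p G F B (Function.update Q j {v}) :=
  sum_split_block Q j _

theorem update_subset {k n : ℕ} {Q : Rect k n} {j : Fin k} {v : Fin n} (hv : v ∈ Q j) (x : Fin k) :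
    Function.update Q j {v} x ⊆ Q x := by
  by_cases hx : x = j
  · subst hx; simpa using hv
  · simp [hx]

/-- The bound obtained by fixing the vertices in all blocks of the cover `W`, after which no edges
are left. -/
theorem abs_coreSum_le_trivial {k n : ℕ} {p β : ℝ} (hp : 0 < p) (hβ : 1 ≤ β)
    {G : SimpleGraph (Vertex k n)} {L : ℕ} (hN : NbhdUpper G p β L)
    {F : SimpleGraph (Fin k)} (hF : F ∈ Set.range (core (k := k))) (m : ℕ) :
    ∀ {B : Finset (Fin k)} {Q : Rect k n} {T : Fin k → Finset (Fin k)}, FixedOutside G B Q T →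
      (coreCover F ∩ B).card = m → Bᶜ.card + m ≤ L →
      |coreSum p G F B Q| ≤ ((2 : ℝ) ^ (3 * vc F)) ^ m * sizeBound n p β B T := by
  induction m with
  | zero =>
    intro B Q T h hm hL
    have h1 : coreSum p G F B Q = (Fintype.piFinset Q).card := by
      simp [coreSum, familyChar_of_disjoint (Finset.card_eq_zero.1 hm)]
    rw [h1, abs_of_nonneg (by positivity), pow_zero, one_mul]
    exact card_rect_le h hN (by omega) fun _ => subset_rfl
  | succ m ih =>
    intro B Q T h hm hL
    obtain ⟨j, hj⟩ : (coreCover F ∩ B).Nonempty := Finset.card_pos.1 (by omega)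
    have hjB := (Finset.mem_inter.1 hj).2
    have hm' : (coreCover F ∩ B.erase j).card = m := by
      rw [Finset.inter_erase, Finset.card_erase_of_mem hj]; omega
    rw [coreSum_split_block p G F B Q j]
    refine (Finset.abs_sum_le_sum_abs _ _).trans ?_
    have hterm : ∀ v ∈ Q j, |coreSum p G F B (Function.update Q j {v})| ≤
        ((2 : ℝ) ^ (3 * vc F)) ^ (m + 1) * sizeBound n p β (B.erase j) T := by
      intro v hv
      have h' : FixedOutside G B (Function.update Q j {v}) T :=
        h.mono (update_subset hv) fun x hx => by
          rw [Function.update_of_ne]; rintro rfl; exact hx hjB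
      have := abs_coreSum_fix_le hp hβ hF h' hjB (v := v) (by simp)
        (c := ((2 : ℝ) ^ (3 * vc F)) ^ m) (by positivity) fun Q' T' hQ' =>
          ih hQ' hm' (by rw [card_compl_erase hjB]; omega)
      rwa [← pow_succ'] at this
    refine (Finset.sum_le_sum hterm).trans ?_
    rw [Finset.sum_const, nsmul_eq_mul, ← sizeBound_erase hjB, mul_left_comm]
    refine mul_le_mul_of_nonneg_left ?_ (by positivity)
    exact mul_le_mul_of_nonneg_right (h.card_block_le hN (by omega) hjB)
      (sizeBound_nonneg hp hβ _ _)

/-- Giving up a block costs a factor of at least `p ^ (3 * d) * n` in the size bound. -/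
theorem Setting.sizeBound_erase_le {k n : ℕ} {G : SimpleGraph (Vertex k n)}
    {p β K E ρ' ρ M Θ : ℝ} {d : ℕ} (hS : Setting G p β K E ρ' ρ M Θ d) {B : Finset (Fin k)}
    {Q : Rect k n} {T : Fin k → Finset (Fin k)} (h : FixedOutside G B Q T)
    (hL : Bᶜ.card ≤ 3 * d) {j : Fin k} (hj : j ∈ B) :
    p ^ (3 * d) * n * sizeBound n p β (B.erase j) T ≤ sizeBound n p β B T := by
  rw [← sizeBound_erase hj]
  refine mul_le_mul_of_nonneg_right ?_ (sizeBound_nonneg hS.p_pos hS.one_le_β _ _)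
  have hTsub : T j ⊆ Bᶜ := fun i hi =>
    Finset.mem_compl.2 (Finset.disjoint_left.1 (h.disj j hj) hi)
  have h1 : p ^ (3 * d) ≤ p ^ (T j).card :=
    pow_le_pow_of_le_one hS.p_pos.le hS.p_le ((Finset.card_le_card hTsub).trans hL)
  have h2 : p ^ (3 * d) * n ≤ p ^ (T j).card * (n : ℝ) := by gcongr
  have h3 : 0 ≤ p ^ (T j).card * (n : ℝ) := by have := hS.p_pos; positivity
  nlinarith [hS.one_le_β]

/-- Core sums over arbitrary rectangles: as long as the rectangle is not well-behaved, a vertex is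
fixed in some block, of which there are so few that the loss of one in the vertex cover number of
`F[B]` is made up for. After `u` such steps the trivial bound is used. -/
theorem Setting.abs_coreSum_le_min {k n : ℕ} {G : SimpleGraph (Vertex k n)}
    {p β K E ρ' ρ M Θ : ℝ} {d : ℕ} (hS : Setting G p β K E ρ' ρ M Θ d)
    {F : SimpleGraph (Fin k)} (hF : F ∈ Set.range (core (k := k))) (hd : vc F ≤ d) (u : ℕ) :
    ∀ {B : Finset (Fin k)} {Q : Rect k n} {T : Fin k → Finset (Fin k)}, FixedOutside G B Q T →
      Bᶜ.card + u + (coreCover F ∩ B).card ≤ 3 * d →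
      |coreSum p G F B Q| ≤ E * (2 ^ (3 * d)) ^ vc F * ρ ^ min u (vc (restrict F B)) *
        sizeBound n p β B T := by
  have hρ0 : 0 ≤ ρ := hS.ρ'_nonneg.trans hS.ρ'_le
  have hp := hS.p_pos
  have hκ : (1 : ℝ) ≤ (2 ^ (3 * d)) ^ vc F := one_le_pow₀ (one_le_pow₀ (by norm_num))
  -- `E₁` dominates both the trivial bound and twice the constant `K` of the good rectangles
  obtain ⟨E₁, hE₁⟩ : ∃ E₁, E₁ = E * (2 ^ (3 * d)) ^ vc F := ⟨_, rfl⟩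
  have hE1 : E ≤ E₁ := hE₁ ▸ le_mul_of_one_le_right (by linarith [hS.one_le_E]) hκ
  have hE0 : 0 ≤ E₁ := by linarith [hS.one_le_E]
  have hpow : ((2 : ℝ) ^ (3 * d)) ^ vc F ≤ E₁ :=
    hE₁ ▸ le_mul_of_one_le_left (by linarith) hS.one_le_E
  rw [← hE₁]
  induction u with
  | zero =>
    intro B Q T h hL
    refine (abs_coreSum_le_trivial hp hS.one_le_β hS.nbhd hF _ h rfl (by omega)).trans ?_
    rw [Nat.zero_min, pow_zero, mul_one]
    refine mul_le_mul_of_nonneg_right (le_trans ?_ hpow)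
      (sizeBound_nonneg hp hS.one_le_β _ _)
    have hm : (coreCover F ∩ B).card ≤ vc F := by
      refine (Finset.card_le_card Finset.inter_subset_left).trans ?_
      rw [(isMinVertexCover_coreCover F).2]
    rw [← pow_mul, ← pow_mul]
    exact pow_le_pow_right₀ (by norm_num) (Nat.mul_le_mul (by omega) hm)
  | succ u ih =>
    intro B Q T h hL
    obtain ⟨Q₀, I, ch, hsum, hI, hQ₀, hch, hgood⟩ := hS.branching B Q h.single
    set e := min (u + 1) (vc (restrict F B)) with he
    have hb0 := sizeBound_nonneg (n := n) hp hS.one_le_β B T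
    have hsplit : coreSum p G F B Q = coreSum p G F B Q₀ + ∑ a ∈ I, coreSum p G F B (ch a) :=
      hsum _
    have h1 : |coreSum p G F B Q₀| ≤ E₁ / 2 * ρ ^ e * sizeBound n p β B T := by
      refine (hgood F hF hd).trans ?_
      have hpow : ρ' ^ vc (restrict F B) ≤ ρ ^ e :=
        (pow_le_pow_left₀ hS.ρ'_nonneg hS.ρ'_le _).trans
          (pow_le_pow_of_le_one hρ0 hS.ρ_le (min_le_right _ _))
      have hcard := card_rect_le h hS.nbhd (by omega) hQ₀
      have hKE : K ≤ E₁ / 2 := by linarith [hS.K_le]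
      have := hS.ρ'_nonneg
      gcongr
    have h2 : ∀ a ∈ I, |coreSum p G F B (ch a)| ≤
        2 ^ (3 * d) * (E₁ * ρ ^ (e - 1)) * (sizeBound n p β B T / (p ^ (3 * d) * n)) := by
      intro a ha
      obtain ⟨haB, hsub, heq, hav⟩ := hch a ha
      have h' : FixedOutside G B (ch a) T := h.mono hsub heq
      have hvc := vc_restrict_le_erase F B a.1
      have := abs_coreSum_fix_le hp hS.one_le_β hF h' haB hav (c := E₁ * ρ ^ (e - 1))
        (by positivity) fun Q' T' hQ' => by
          have hcov : (coreCover F ∩ B.erase a.1).card ≤ (coreCover F ∩ B).card :=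
            Finset.card_le_card (Finset.inter_subset_inter_left (Finset.erase_subset _ _))
          refine (ih hQ' (by rw [card_compl_erase haB]; omega)).trans ?_
          have hb0' := sizeBound_nonneg (n := n) hp hS.one_le_β (B.erase a.1) T'
          have : ρ ^ min u (vc (restrict F (B.erase a.1))) ≤ ρ ^ (e - 1) :=
            pow_le_pow_of_le_one hρ0 hS.ρ_le (by omega)
          gcongr
      refine this.trans ?_
      have hn : (0 : ℝ) < n := by exact_mod_cast hS.n_pos
      have h3 := hS.sizeBound_erase_le h (by omega) haB
      have h4 : sizeBound n p β (B.erase a.1) T ≤ sizeBound n p β B T / (p ^ (3 * d) * n) := by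
        rw [le_div_iff₀ (by positivity)]
        linarith
      have h5 : (2 : ℝ) ^ (3 * vc F) ≤ 2 ^ (3 * d) :=
        pow_le_pow_right₀ (by norm_num) (by omega)
      have := sizeBound_nonneg (n := n) hp hS.one_le_β (B.erase a.1) T
      gcongr
    have h3 : |∑ a ∈ I, coreSum p G F B (ch a)| ≤ E₁ / 2 * ρ ^ e * sizeBound n p β B T := by
      refine (Finset.abs_sum_le_sum_abs _ _).trans ((Finset.sum_le_sum h2).trans ?_)
      rw [Finset.sum_const, nsmul_eq_mul]
      have hn : (0 : ℝ) < n := by exact_mod_cast hS.n_pos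
      have hρe : ρ * ρ ^ (e - 1) ≤ ρ ^ e := by
        rw [← pow_succ']
        exact pow_le_pow_of_le_one hρ0 hS.ρ_le (by omega)
      have hg : Θ * 2 ^ (3 * d) / (p ^ (3 * d) * n) ≤ ρ / 2 := by
        rw [div_le_iff₀ (by positivity)]
        linarith [hS.gain]
      calc (I.card : ℝ) * (2 ^ (3 * d) * (E₁ * ρ ^ (e - 1)) *
            (sizeBound n p β B T / (p ^ (3 * d) * n)))
          ≤ Θ * (2 ^ (3 * d) * (E₁ * ρ ^ (e - 1)) *
            (sizeBound n p β B T / (p ^ (3 * d) * n))) := by gcongr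
        _ = (Θ * 2 ^ (3 * d) / (p ^ (3 * d) * n)) * (E₁ * ρ ^ (e - 1) * sizeBound n p β B T) := by
          ring
        _ ≤ ρ / 2 * (E₁ * ρ ^ (e - 1) * sizeBound n p β B T) := by gcongr
        _ = E₁ / 2 * (ρ * ρ ^ (e - 1)) * sizeBound n p β B T := by ring
        _ ≤ E₁ / 2 * ρ ^ e * sizeBound n p β B T := by gcongr
    rw [hsplit]
    calc |coreSum p G F B Q₀ + ∑ a ∈ I, coreSum p G F B (ch a)|
        ≤ |coreSum p G F B Q₀| + |∑ a ∈ I, coreSum p G F B (ch a)| := abs_add_le _ _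
      _ ≤ _ := by linarith

/-- The bound for core sums over arbitrary rectangles, after as many branchings as the vertex cover
number of `F`. -/
theorem Setting.abs_coreSum_le {k n : ℕ} {G : SimpleGraph (Vertex k n)}
    {p β K E ρ' ρ M Θ : ℝ} {d : ℕ} (hS : Setting G p β K E ρ' ρ M Θ d)
    {F : SimpleGraph (Fin k)} (hF : F ∈ Set.range (core (k := k))) (hd : vc F ≤ d)
    {B : Finset (Fin k)} (hFB : SupportedOn F B) {Q : Rect k n} {T : Fin k → Finset (Fin k)}
    (h : FixedOutside G B Q T) (hB : Bᶜ.card ≤ d) :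
    |coreSum p G F B Q| ≤ E * (2 ^ (3 * d) * ρ) ^ vc F * sizeBound n p β B T := by
  have hc : (coreCover F ∩ B).card ≤ vc F := by
    rw [← (isMinVertexCover_coreCover F).2]
    exact Finset.card_le_card Finset.inter_subset_left
  have := hS.abs_coreSum_le_min hF hd (vc F) h (by omega)
  rwa [hFB.restrict_eq, min_self, mul_assoc E, ← mul_pow] at this

/-! ### Sums over all cores -/

theorem bot_mem_range_core {k : ℕ} : (⊥ : SimpleGraph (Fin k)) ∈ Set.range (core (k := k)) :=
  ⟨⊥, eq_bot_iff.2 (core_le ⊥)⟩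

theorem coresOn_vc_zero {k : ℕ} (B : Finset (Fin k)) :
    coresOn B (fun F => vc F = 0) = {⊥} := by
  ext F
  rw [mem_coresOn, Finset.mem_singleton, vc_eq_zero]
  constructor
  · exact fun h => h.2.2
  · rintro rfl
    exact ⟨bot_mem_range_core, fun x y h => absurd h (by simp), rfl⟩

theorem sum_coresOn_le {k : ℕ} (B : Finset (Fin k)) (m : ℕ) (f : SimpleGraph (Fin k) → ℝ) :
    ∑ F ∈ coresOn B (fun F => vc F ≤ m), f F =
      ∑ w ∈ Finset.range (m + 1), ∑ F ∈ coresOn B (fun F => vc F = w), f F := by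
  rw [← Finset.sum_fiberwise_of_maps_to (g := vc) (t := Finset.range (m + 1))]
  · refine Finset.sum_congr rfl fun w hw => Finset.sum_congr ?_ fun _ _ => rfl
    ext F
    rw [Finset.mem_filter, mem_coresOn, mem_coresOn]
    have := Finset.mem_range.1 hw
    constructor
    · rintro ⟨⟨h1, h2, -⟩, h3⟩; exact ⟨h1, h2, h3⟩
    · rintro ⟨h1, h2, h3⟩; exact ⟨⟨h1, h2, by omega⟩, h3⟩
  · intro F hF
    have := (mem_coresOn.1 hF).2.2
    exact Finset.mem_range.2 (by omega)

theorem sum_pow_succ_le {x : ℝ} (hx : 0 ≤ x) (hx2 : x ≤ 1 / 2) (m : ℕ) :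
    ∑ w ∈ Finset.range m, x ^ (w + 1) ≤ 2 * x - 2 * x ^ (m + 1) := by
  induction m with
  | zero => simp
  | succ m ih =>
    rw [Finset.sum_range_succ]
    have : x ^ (m + 1 + 1) ≤ x ^ (m + 1) * (1 / 2) := by
      rw [pow_succ]; gcongr
    linarith

section

variable {k n : ℕ} {G : SimpleGraph (Vertex k n)} {p β K E ρ' ρ M Θ : ℝ} {d : ℕ}

theorem Setting.E_nonneg (hS : Setting G p β K E ρ' ρ M Θ d) : 0 ≤ E := by
  linarith [hS.K_le, hS.K_nonneg]

theorem Setting.ρ_nonneg (hS : Setting G p β K E ρ' ρ M Θ d) : 0 ≤ ρ :=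
  hS.ρ'_nonneg.trans hS.ρ'_le

theorem Setting.card_coresOn_le (hS : Setting G p β K E ρ' ρ M Θ d) (B : Finset (Fin k))
    (P : SimpleGraph (Fin k) → Prop) {w : ℕ} (hw : w ≤ d) :
    ((coresOn B fun F => vc F = w ∧ P F).card : ℝ) * (2 ^ (3 * d)) ^ w ≤ M ^ w := by
  refine le_trans ?_ (hS.count w hw)
  refine mul_le_mul_of_nonneg_right ?_ (by positivity)
  have h := card_cores_le (w := w) hS.k_pos
  have h2 : (coresOn B fun F => vc F = w ∧ P F).card ≤ k ^ (3 * w) * 2 ^ (9 * w ^ 2) := by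
    refine le_trans (Finset.card_le_card fun F hF => ?_) h
    obtain ⟨h1, -, h2, -⟩ := mem_coresOn.1 hF
    exact Finset.mem_filter.2 ⟨Finset.mem_univ _, h1, h2⟩
  exact_mod_cast h2

/-- The number of cores with a given vertex cover number is outweighed by the bound for each of
them. -/
theorem Setting.abs_sum_coreSum_le (hS : Setting G p β K E ρ' ρ M Θ d) {B : Finset (Fin k)}
    {Q : Rect k n} {T : Fin k → Finset (Fin k)} (h : FixedOutside G B Q T) (hB : Bᶜ.card ≤ d)
    (P : SimpleGraph (Fin k) → Prop) {w : ℕ} (hw : w ≤ d) :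
    |∑ F ∈ coresOn B fun F => vc F = w ∧ P F, coreSum p G F B Q| ≤
      E * (M * ρ) ^ w * sizeBound n p β B T := by
  have hb := sizeBound_nonneg (n := n) hS.p_pos hS.one_le_β B T
  have hρ := hS.ρ_nonneg
  have hE := hS.E_nonneg
  refine (Finset.abs_sum_le_sum_abs _ _).trans ?_
  refine (Finset.sum_le_card_nsmul _ _ (E * (2 ^ (3 * d) * ρ) ^ w * sizeBound n p β B T)
    ?_).trans ?_
  · intro F hF
    obtain ⟨h1, h2, h3, -⟩ := mem_coresOn.1 hF
    have := hS.abs_coreSum_le h1 (h3.trans_le hw) h2 h hB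
    rwa [h3] at this
  · rw [nsmul_eq_mul]
    calc _ = ((coresOn B fun F => vc F = w ∧ P F).card : ℝ) * (2 ^ (3 * d)) ^ w *
          (E * ρ ^ w * sizeBound n p β B T) := by rw [mul_pow]; ring
      _ ≤ M ^ w * (E * ρ ^ w * sizeBound n p β B T) := by
          gcongr
          exact hS.card_coresOn_le B P hw
      _ = _ := by rw [mul_pow]; ring

theorem coresOn_and_true (B : Finset (Fin k)) (w : ℕ) :
    coresOn B (fun F => vc F = w) = coresOn B fun F => vc F = w ∧ True := by
  ext F
  simp [mem_coresOn]

/-- All truncated sums are bounded in terms of the size bound alone. -/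
theorem Setting.abs_truncSum_sub_le (hS : Setting G p β K E ρ' ρ M Θ d) {B : Finset (Fin k)}
    {Q : Rect k n} {T : Fin k → Finset (Fin k)} (h : FixedOutside G B Q T) (hB : Bᶜ.card ≤ d)
    {m : ℕ} (hm : m ≤ d) :
    |truncSum p G m B Q - (Fintype.piFinset Q).card| ≤
      E * (2 * (M * ρ)) * sizeBound n p β B T := by
  have hb := sizeBound_nonneg (n := n) hS.p_pos hS.one_le_β B T
  have hρ := hS.ρ_nonneg
  have hE := hS.E_nonneg
  have hMρ : 0 ≤ M * ρ := mul_nonneg hS.M_nonneg hρ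
  rw [truncSum_eq, sum_coresOn_le, Finset.sum_range_succ', coresOn_vc_zero, Finset.sum_singleton,
    coreSum_bot, add_sub_cancel_right]
  refine (Finset.abs_sum_le_sum_abs _ _).trans ?_
  have hterm : ∀ w ∈ Finset.range m, |∑ F ∈ coresOn B fun F => vc F = w + 1, coreSum p G F B Q| ≤
      E * (M * ρ) ^ (w + 1) * sizeBound n p β B T := by
    intro w hw
    rw [coresOn_and_true]
    exact hS.abs_sum_coreSum_le h hB _ (by have := Finset.mem_range.1 hw; omega)
  refine (Finset.sum_le_sum hterm).trans ?_
  rw [← Finset.sum_mul, ← Finset.mul_sum]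
  have h1 := sum_pow_succ_le hMρ hS.Mρ_le m
  have h2 : 0 ≤ (M * ρ) ^ (m + 1) := by positivity
  gcongr
  linarith

/-- On well-behaved rectangles the empty pattern dominates the truncated sum. -/
theorem Setting.truncSum_nonneg (hS : Setting G p β K E ρ' ρ M Θ d) {B : Finset (Fin k)}
    {Q : Rect k n} (hQ : ∀ F ∈ Set.range (core (k := k)), vc F ≤ d →
      |coreSum p G F B Q| ≤ K * ρ' ^ vc (restrict F B) * (Fintype.piFinset Q).card)
    {m : ℕ} (hm : m ≤ d) : 0 ≤ truncSum p G m B Q := by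
  have hρ := hS.ρ'_nonneg
  have hK := hS.K_nonneg
  have hMρ : 0 ≤ M * ρ' := mul_nonneg hS.M_nonneg hρ
  have hMρ2 : M * ρ' ≤ 1 / 2 :=
    (mul_le_mul_of_nonneg_left hS.ρ'_le hS.M_nonneg).trans hS.Mρ_le
  rw [truncSum_eq, sum_coresOn_le, Finset.sum_range_succ', coresOn_vc_zero, Finset.sum_singleton,
    coreSum_bot]
  set q : ℝ := ((Fintype.piFinset Q).card : ℝ) with hq
  have hq0 : 0 ≤ q := by positivity
  have hterm : ∀ w ∈ Finset.range m, |∑ F ∈ coresOn B fun F => vc F = w + 1, coreSum p G F B Q| ≤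
      K * (M * ρ') ^ (w + 1) * q := by
    intro w hw
    have hwd : w + 1 ≤ d := by have := Finset.mem_range.1 hw; omega
    refine (Finset.abs_sum_le_sum_abs _ _).trans ?_
    refine (Finset.sum_le_card_nsmul _ _ (K * ρ' ^ (w + 1) * q) ?_).trans ?_
    · intro F hF
      obtain ⟨h1, h2, h3⟩ := mem_coresOn.1 hF
      have := hQ F h1 (h3.trans_le hwd)
      rwa [h2.restrict_eq, h3] at this
    · rw [nsmul_eq_mul]
      have := hS.card_coresOn_le B (fun _ => True) hwd
      rw [← coresOn_and_true] at this
      have := (le_mul_of_one_le_right (Nat.cast_nonneg _)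
        (one_le_pow₀ (one_le_pow₀ (by norm_num)))).trans this
      calc _ ≤ M ^ (w + 1) * (K * ρ' ^ (w + 1) * q) := by gcongr
        _ = _ := by rw [mul_pow]; ring
  have hsum : |∑ w ∈ Finset.range m, ∑ F ∈ coresOn B fun F => vc F = w + 1, coreSum p G F B Q| ≤
      q := by
    refine (Finset.abs_sum_le_sum_abs _ _).trans ((Finset.sum_le_sum hterm).trans ?_)
    rw [← Finset.sum_mul, ← Finset.mul_sum]
    have h1 := sum_pow_succ_le hMρ hMρ2 m
    have h2 : 0 ≤ (M * ρ') ^ (m + 1) := by positivity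
    have h3 : K * ∑ w ∈ Finset.range m, (M * ρ') ^ (w + 1) ≤ 1 := by
      refine le_trans ?_ hS.KMρ'_le
      gcongr
      linarith
    nlinarith
  linarith [neg_abs_le (∑ w ∈ Finset.range m, ∑ F ∈ coresOn B fun F => vc F = w + 1,
    coreSum p G F B Q)]

/-- The lower bound on truncated sums: vertices in blocks that are not well-behaved are fixed for
up to `u` rounds. Each round gains a constant power of `n`, and what is lost in a round are cores
with a large vertex cover number. -/
theorem Setting.neg_le_truncSum (hS : Setting G p β K E ρ' ρ M Θ d) (m₀ u : ℕ)
    (hg : 2 * Θ ≤ p ^ (3 * d) * n) :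
    ∀ {B : Finset (Fin k)} {Q : Rect k n}, FixedOutside G B Q (fun _ => Bᶜ) → Bᶜ.card + u ≤ d →
      m₀ + u ≤ d →
      -((Θ / (p ^ (3 * d) * n)) ^ u * (2 * E) + 2 * Θ * E * (M * ρ) ^ m₀) *
        sizeBound n p β B (fun _ => Bᶜ) ≤ truncSum p G (m₀ + u) B Q := by
  have hρ := hS.ρ_nonneg
  have hE := hS.E_nonneg
  have hp := hS.p_pos
  have hΘ := hS.Θ_nonneg
  have hMρ : 0 ≤ M * ρ := mul_nonneg hS.M_nonneg hρ
  have hn : (0 : ℝ) < n := by exact_mod_cast hS.n_pos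
  set g := Θ / (p ^ (3 * d) * n) with hgdef
  have hg0 : 0 ≤ g := by positivity
  have hg2 : g ≤ 1 / 2 := by
    rw [hgdef, div_le_iff₀ (by positivity)]
    linarith
  set x := M * ρ with hx
  induction u with
  | zero =>
    intro B Q h hB hm
    have hb := sizeBound_nonneg (n := n) hp hS.one_le_β B (fun _ => Bᶜ)
    have h1 := (abs_le.1 (hS.abs_truncSum_sub_le h (by omega) (m := m₀ + 0) (by omega))).1
    have h2 : E * (2 * x) * sizeBound n p β B (fun _ => Bᶜ) ≤
        (g ^ 0 * (2 * E) + 2 * Θ * E * x ^ m₀) * sizeBound n p β B (fun _ => Bᶜ) := by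
      refine mul_le_mul_of_nonneg_right ?_ hb
      have h3 : 0 ≤ 2 * Θ * E * x ^ m₀ := by positivity
      have h4 : E * x ≤ E * (1 / 2) := mul_le_mul_of_nonneg_left hS.Mρ_le hE
      rw [pow_zero]
      linarith
    have h3 : (0 : ℝ) ≤ (Fintype.piFinset Q).card := by positivity
    linarith
  | succ u ih =>
    intro B Q h hB hm
    obtain ⟨Q₀, I, ch, hsum, hI, hQ₀, hch, hgood⟩ := hS.branching B Q h.single
    have hb := sizeBound_nonneg (n := n) hp hS.one_le_β B (fun _ => Bᶜ)
    set b := sizeBound n p β B (fun _ => Bᶜ) with hbdef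
    have hsplit : truncSum p G (m₀ + (u + 1)) B Q = truncSum p G (m₀ + (u + 1)) B Q₀ +
        ∑ a ∈ I, truncSum p G (m₀ + (u + 1)) B (ch a) := hsum _
    have h0 := hS.truncSum_nonneg hgood hm
    set ε := g ^ u * (2 * E) + 2 * Θ * E * x ^ m₀ with hε
    have hε0 : 0 ≤ ε := by positivity
    have hterm : ∀ a ∈ I, -(ε / (p ^ (3 * d) * n) * b + E * x ^ m₀ * b) ≤
        truncSum p G (m₀ + (u + 1)) B (ch a) := by
      intro a ha
      obtain ⟨haB, hsub, heq, hav⟩ := hch a ha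
      have h' : FixedOutside G B (ch a) (fun _ => Bᶜ) := h.mono hsub heq
      have hcompl : insert a.1 Bᶜ = (B.erase a.1)ᶜ := (Finset.compl_erase).symm
      have hT : ∀ y ∈ B.erase a.1, (if y ∈ B.erase a.1 then insert a.1 Bᶜ else Bᶜ) =
          (B.erase a.1)ᶜ := by
        intro y hy
        rw [if_pos hy, hcompl]
      have h2 := (h'.cut haB hav subset_rfl).congr hT
      have h3 := ih h2 (by rw [card_compl_erase haB]; omega) (by omega)
      have h4 := sizeBound_cut (n := n) (β := β) h' hp haB (Y := B.erase a.1) subset_rfl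
      rw [sizeBound_congr hT] at h4
      have h5 := hS.sizeBound_erase_le h' (by omega) haB
      have h6 := mul_le_mul_of_nonneg_left h3
        (by positivity : 0 ≤ p⁻¹ ^ (B.erase a.1).card)
      have h7 := hS.abs_sum_coreSum_le h' (by omega)
        (fun F => ∀ C, IsMinVertexCover F C → a.1 ∉ C) (w := m₀ + u + 1) (by omega)
      have h8 := (abs_le.1 h7).1
      rw [← add_assoc, truncSum_fix hp G (m₀ + u) haB hav]
      have h9 : x ^ (m₀ + u + 1) ≤ x ^ m₀ :=
        pow_le_pow_of_le_one hMρ (hS.Mρ_le.trans (by norm_num)) (by omega)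
      have h10 : E * x ^ (m₀ + u + 1) * b ≤ E * x ^ m₀ * b := by gcongr
      have h11 : sizeBound n p β (B.erase a.1) (fun _ => Bᶜ) ≤ b / (p ^ (3 * d) * n) := by
        rw [le_div_iff₀ (by positivity)]
        linarith
      have h12 : p⁻¹ ^ (B.erase a.1).card * (-ε *
          sizeBound n p β (B.erase a.1) fun _ => (B.erase a.1)ᶜ) =
          -(ε * sizeBound n p β (B.erase a.1) (fun _ => Bᶜ)) := by
        rw [← h4]; ring
      rw [h12] at h6
      have h13 : ε * sizeBound n p β (B.erase a.1) (fun _ => Bᶜ) ≤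
          ε * (b / (p ^ (3 * d) * n)) := mul_le_mul_of_nonneg_left h11 hε0
      have h14 : ε * (b / (p ^ (3 * d) * n)) = ε / (p ^ (3 * d) * n) * b := by ring
      linarith
    have hsumI := Finset.card_nsmul_le_sum I _ _ hterm
    rw [nsmul_eq_mul] at hsumI
    have h1 : (I.card : ℝ) * (ε / (p ^ (3 * d) * n) * b + E * x ^ m₀ * b) ≤
        Θ * (ε / (p ^ (3 * d) * n) * b + E * x ^ m₀ * b) := by gcongr
    have h2 : Θ * (ε / (p ^ (3 * d) * n) * b + E * x ^ m₀ * b) =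
        (g * ε + Θ * E * x ^ m₀) * b := by rw [hgdef]; ring
    have h3 : g * ε + Θ * E * x ^ m₀ ≤ g ^ (u + 1) * (2 * E) + 2 * Θ * E * x ^ m₀ := by
      have h4 : g * (2 * Θ * E * x ^ m₀) ≤ 1 / 2 * (2 * Θ * E * x ^ m₀) := by gcongr
      rw [hε, mul_add, pow_succ]
      linarith
    have h4 := mul_le_mul_of_nonneg_right h3 hb
    rw [hsplit]
    linarith

/-- If the rectangle forces a non-edge between the blocks `i` and `j`, the characters of `H` and of
`H` with the edge `ij` added or removed cancel, and only cores with vertex cover number exactly `m`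
remain. -/
theorem truncSum_nonedge (p : ℝ) (m : ℕ) {Q : Rect k n} {i j : Fin k} (hij : i ≠ j)
    (hQ : ∀ t ∈ Fintype.piFinset Q, ¬ G.Adj (i, t i) (j, t j)) :
    truncSum p G m Finset.univ Q = ∑ F ∈ coresOn Finset.univ fun F => vc F = m ∧
      ∀ C, IsMinVertexCover F C → i ∉ C ∧ j ∉ C, coreSum p G F Finset.univ Q := by
  have hcore : ∀ H : SimpleGraph (Fin k),
      (vc H = m ∧ ∀ C, IsMinVertexCover H C → i ∉ C ∧ j ∉ C) ↔
      (vc (core H) = m ∧ ∀ C, IsMinVertexCover (core H) C → i ∉ C ∧ j ∉ C) := by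
    intro H
    rw [vc_core, isMinVertexCover_core]
  rw [← sum_coreSum p G _ Q _ hcore, truncSum]
  refine Finset.sum_congr rfl fun t ht => ?_
  set A := graphsOn (Finset.univ : Finset (Fin k)) fun H => vc H ≤ m with hA
  set R := graphsOn (Finset.univ : Finset (Fin k)) fun H =>
    vc H = m ∧ ∀ C, IsMinVertexCover H C → i ∉ C ∧ j ∉ C with hR
  have hRA : R ⊆ A := fun H hH => by
    rw [hR, mem_graphsOn] at hH
    rw [hA, mem_graphsOn]
    exact ⟨hH.1, hH.2.1.le⟩
  rw [← Finset.sum_sdiff hRA]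
  refine (add_eq_right).2 ?_
  obtain ⟨e, head⟩ : ∃ e : SimpleGraph (Fin k), ∀ {x y}, e.Adj x y ↔
      x = i ∧ y = j ∨ x = j ∧ y = i := by
    refine ⟨SimpleGraph.edge i j, ?_⟩
    intro x y
    rw [SimpleGraph.edge_adj]
    constructor
    · rintro ⟨h, -⟩; tauto
    · rintro (⟨rfl, rfl⟩ | ⟨rfl, rfl⟩)
      exacts [⟨Or.inl ⟨rfl, rfl⟩, hij⟩, ⟨Or.inr ⟨rfl, rfl⟩, hij.symm⟩]
  -- the graphs that take part in the cancellation
  have hmem : ∀ H, H ∈ A \ R ↔ vc (H ⊔ e) ≤ m := by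
    intro H
    rw [Finset.mem_sdiff, hA, hR, mem_graphsOn, mem_graphsOn]
    have huniv : SupportedOn H Finset.univ := fun _ _ _ => Finset.mem_univ _
    constructor
    · rintro ⟨⟨-, h1⟩, h2⟩
      by_cases hlt : vc H < m
      · obtain ⟨C, hC⟩ := exists_isMinVertexCover H
        refine vc_le_iff.2 ⟨insert i C, ?_, (Finset.card_insert_le _ _).trans (by rw [hC.2]; omega)⟩
        rintro x y (h | h)
        · rcases hC.1 h with h | h
          · left; simpa using Or.inr h
          · right; simpa using Or.inr h
        · rcases head.1 h with ⟨rfl, rfl⟩ | ⟨rfl, rfl⟩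
          · left; simp
          · right; simp
      · have hm : vc H = m := by omega
        have : ∃ C, IsMinVertexCover H C ∧ (i ∈ C ∨ j ∈ C) := by
          by_contra! hcon
          exact h2 ⟨huniv, hm, hcon⟩
        obtain ⟨C, hC, hCij⟩ := this
        refine vc_le_iff.2 ⟨C, ?_, by rw [hC.2]; omega⟩
        rintro x y (h | h)
        · exact hC.1 h
        · rcases head.1 h with ⟨rfl, rfl⟩ | ⟨rfl, rfl⟩
          · exact_mod_cast hCij
          · exact_mod_cast hCij.symm
    · intro h
      have h1 : vc H ≤ m := (vc_mono le_sup_left).trans h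
      refine ⟨⟨huniv, h1⟩, ?_⟩
      rintro ⟨-, h2, h3⟩
      obtain ⟨C, hC, hCm⟩ := vc_le_iff.1 h
      have hCH : H.IsVertexCover (C : Set (Fin k)) := hC.mono le_sup_left
      have hCmin : IsMinVertexCover H C := ⟨hCH, le_antisymm (hCm.trans h2.ge) (vc_le_card hCH)⟩
      have hh : (H ⊔ e).Adj i j := Or.inr (head.2 (Or.inl ⟨rfl, rfl⟩))
      rcases hC hh with h | h
      · exact (h3 C hCmin).1 (by exact_mod_cast h)
      · exact (h3 C hCmin).2 (by exact_mod_cast h)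
  have hneg : ∀ H : SimpleGraph (Fin k), ¬ H.Adj i j →
      tupleChar p G t (H ⊔ e) = - tupleChar p G t H := by
    intro H hH
    rw [tupleChar_sup]
    · have : tupleChar p G t e = -1 := by
        have : e.edgeFinset = {s(i, j)} := by
          ext a
          induction a with
          | _ x y =>
            rw [SimpleGraph.mem_edgeFinset, SimpleGraph.mem_edgeSet, head, Finset.mem_singleton,
              Sym2.eq_iff]
        rw [tupleChar, this, Finset.prod_singleton, edgeWeight_mk, if_neg (hQ t ht)]
      rw [this, mul_neg_one]
    · rw [disjoint_iff, eq_bot_iff]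
      intro x y h
      rcases head.1 h.2 with ⟨rfl, rfl⟩ | ⟨rfl, rfl⟩
      exacts [hH h.1, hH h.1.symm]
  refine Finset.sum_involution (fun H _ => if H.Adj i j then H \ e else H ⊔ e) ?_ ?_ ?_ ?_
  · intro H hH
    split_ifs with hadj
    · have hnot : ¬ (H \ e).Adj i j := fun h => by
        rw [SimpleGraph.sdiff_adj] at h
        exact h.2 (head.2 (Or.inl ⟨rfl, rfl⟩))
      have := hneg (H \ e) hnot
      have hsup : H \ e ⊔ e = H := sdiff_sup_cancel fun x y h => by
        rcases head.1 h with ⟨rfl, rfl⟩ | ⟨rfl, rfl⟩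
        exacts [hadj, hadj.symm]
      rw [hsup] at this
      linarith
    · rw [hneg H hadj]; ring
  · intro H hH _
    split_ifs with hadj
    · intro h
      rw [← h, SimpleGraph.sdiff_adj] at hadj
      exact hadj.2 (head.2 (Or.inl ⟨rfl, rfl⟩))
    · intro h
      rw [← h] at hadj
      exact hadj (Or.inr (head.2 (Or.inl ⟨rfl, rfl⟩)))
  · intro H hH
    rw [hmem] at hH ⊢
    refine (vc_mono ?_).trans hH
    split_ifs
    · exact sup_le (sdiff_le.trans le_sup_left) le_sup_right
    · exact sup_le le_rfl le_sup_right
  · intro H hH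
    by_cases hadj : H.Adj i j
    · have hnot : ¬ (H \ e).Adj i j := fun h => by
        rw [SimpleGraph.sdiff_adj] at h
        exact h.2 (head.2 (Or.inl ⟨rfl, rfl⟩))
      rw [if_pos hadj, if_neg hnot]
      exact sdiff_sup_cancel fun x y h => by
        rcases head.1 h with ⟨rfl, rfl⟩ | ⟨rfl, rfl⟩
        exacts [hadj, hadj.symm]
    · have hyes : (H ⊔ e).Adj i j := Or.inr (head.2 (Or.inl ⟨rfl, rfl⟩))
      rw [if_neg hadj, if_pos hyes]
      ext x y
      rw [SimpleGraph.sdiff_adj, SimpleGraph.sup_adj]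
      constructor
      · rintro ⟨h | h, h2⟩
        exacts [h, absurd h h2]
      · intro h
        refine ⟨Or.inl h, fun h2 => hadj ?_⟩
        rcases head.1 h2 with ⟨rfl, rfl⟩ | ⟨rfl, rfl⟩
        exacts [h, h.symm]

end

/-! ### Equitable partitions -/

/-- The moment generating function of a centered indicator. -/
theorem sum_exp_indicator_le {N : ℕ} (hN : 0 < N) (c : Fin N) {a : ℝ} (ha : |a| ≤ 1) :
    ∑ y : Fin N, Real.exp (a * ((if y = c then 1 else 0) - 1 / N)) ≤ N * Real.exp (a ^ 2) := by
  have hN1 : (1 : ℝ) ≤ N := by exact_mod_cast hN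
  have hterm : ∀ y : Fin N, Real.exp (a * ((if y = c then 1 else 0) - 1 / N)) ≤
      1 + a * ((if y = c then 1 else 0) - 1 / N) + a ^ 2 := by
    intro y
    set z : ℝ := (if y = c then 1 else 0) - 1 / N with hz
    have h1 : (1 : ℝ) / N ≤ 1 := by rw [div_le_one (by linarith)]; exact hN1
    have h2 : (0 : ℝ) < 1 / N := by positivity
    have hz1 : |z| ≤ 1 := by
      rw [hz, abs_le]
      split_ifs <;> constructor <;> linarith
    have haz : |a * z| ≤ 1 := by
      rw [abs_mul]; exact mul_le_one₀ ha (abs_nonneg _) hz1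
    have h3 := (abs_le.1 (Real.abs_exp_sub_one_sub_id_le haz)).2
    have h4 : (a * z) ^ 2 ≤ a ^ 2 := by
      rw [mul_pow]
      have : z ^ 2 ≤ 1 := by rw [← sq_abs]; exact pow_le_one₀ (abs_nonneg _) hz1
      nlinarith [sq_nonneg a]
    linarith
  refine (Finset.sum_le_sum fun y _ => hterm y).trans ?_
  have h1 : ∑ y : Fin N, (1 + a * ((if y = c then 1 else 0) - 1 / (N : ℝ)) + a ^ 2) =
      N * (1 + a ^ 2) := by
    rw [Finset.sum_add_distrib, Finset.sum_add_distrib, ← Finset.mul_sum, Finset.sum_sub_distrib]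
    simp
    field_simp
    ring
  rw [h1]
  have := Real.add_one_le_exp (a ^ 2)
  gcongr
  linarith

/-- A random function splits every set of a small family almost evenly, by a Chernoff bound. -/
theorem exists_equitable {n N : ℕ} (hN : 0 < N) (hn : 0 < n) {ι : Type*} [Fintype ι]
    (X : ι → Finset (Fin n)) {Δ : ℝ} (hΔ : 0 < Δ) (hΔn : Δ ≤ 2 * n)
    (hcard : 2 * (Fintype.card ι * N : ℝ) < Real.exp (Δ ^ 2 / (4 * n))) :
    ∃ g : Fin n → Fin N, ∀ i c,
      |(((X i).filter fun b => g b = c).card : ℝ) - (X i).card / N| ≤ Δ := by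
  by_contra! hcon
  have hn' : (0 : ℝ) < n := by exact_mod_cast hn
  have hN' : (0 : ℝ) < N := by exact_mod_cast hN
  -- the minimizer of the exponent `lam ^ 2 * n - lam * Δ`
  set lam : ℝ := Δ / (2 * n) with hlam
  have hlam0 : 0 < lam := by positivity
  have hlam1 : lam ≤ 1 := by rw [hlam, div_le_one (by positivity)]; exact hΔn
  let dev : (Fin n → Fin N) → ι → Fin N → ℝ := fun g i c =>
    (((X i).filter fun b => g b = c).card : ℝ) - (X i).card / N
  have hmgf : ∀ (i : ι) (c : Fin N) (a : ℝ), |a| = lam →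
      ∑ g : Fin n → Fin N, Real.exp (a * dev g i c) ≤ N ^ n * Real.exp (lam ^ 2 * n) := by
    intro i c a ha
    have h1 : ∀ g : Fin n → Fin N, Real.exp (a * dev g i c) = ∏ b : Fin n,
        (if b ∈ X i then Real.exp (a * ((if g b = c then 1 else 0) - 1 / N)) else 1) := by
      intro g
      rw [Finset.prod_ite_mem, Finset.univ_inter, ← Real.exp_sum, ← Finset.mul_sum,
        Finset.sum_sub_distrib]
      congr 2
      simp [dev, Finset.sum_boole, div_eq_mul_inv]
    have h2 := Finset.prod_univ_sum (fun _ : Fin n => (Finset.univ : Finset (Fin N)))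
      (fun b y => (if b ∈ X i then Real.exp (a * ((if y = c then 1 else 0) - 1 / (N : ℝ)))
        else 1))
    rw [Fintype.piFinset_univ] at h2
    rw [Finset.sum_congr rfl fun g _ => h1 g, ← h2]
    calc _ ≤ ∏ b : Fin n, (N * Real.exp (lam ^ 2)) := by
          refine Finset.prod_le_prod (fun b _ => Finset.sum_nonneg fun y _ => ?_) fun b _ => ?_
          · split_ifs <;> positivity
          · split_ifs with hb
            · have := sum_exp_indicator_le hN c (a := a) (by rw [ha]; exact hlam1)
              rwa [← sq_abs, ha] at this
            · simp only [Finset.sum_const, Finset.card_univ, Fintype.card_fin, nsmul_eq_mul,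
                mul_one]
              have : 1 ≤ Real.exp (lam ^ 2) := Real.one_le_exp (by positivity)
              nlinarith
      _ = _ := by
          rw [Finset.prod_const, Finset.card_univ, Fintype.card_fin, mul_pow, ← Real.exp_nat_mul,
            mul_comm (n : ℝ)]
  have htotal : ∑ g : Fin n → Fin N, ∑ i, ∑ c,
      (Real.exp (lam * dev g i c) + Real.exp (-lam * dev g i c)) ≤
      (Fintype.card ι * N) * (2 * (N ^ n * Real.exp (lam ^ 2 * n))) := by
    rw [Finset.sum_comm]
    have : ∀ i ∈ (Finset.univ : Finset ι), ∑ g : Fin n → Fin N, ∑ c,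
        (Real.exp (lam * dev g i c) + Real.exp (-lam * dev g i c)) ≤
        N * (2 * (N ^ n * Real.exp (lam ^ 2 * n))) := by
      intro i _
      rw [Finset.sum_comm]
      refine (Finset.sum_le_card_nsmul _ _ (2 * (N ^ n * Real.exp (lam ^ 2 * n))) ?_).trans
        (by simp)
      intro c _
      rw [Finset.sum_add_distrib]
      have h1 := hmgf i c lam (abs_of_pos hlam0)
      have h2 := hmgf i c (-lam) (by rw [abs_neg, abs_of_pos hlam0])
      linarith
    refine (Finset.sum_le_card_nsmul _ _ _ this).trans ?_
    rw [nsmul_eq_mul, Finset.card_univ, mul_assoc]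
  have hbad : ∀ g ∈ (Finset.univ : Finset (Fin n → Fin N)), Real.exp (lam * Δ) ≤ ∑ i, ∑ c,
      (Real.exp (lam * dev g i c) + Real.exp (-lam * dev g i c)) := by
    intro g _
    obtain ⟨i, c, hic⟩ := hcon g
    have h0 : ∀ i c, 0 ≤ Real.exp (lam * dev g i c) + Real.exp (-lam * dev g i c) :=
      fun i c => by positivity
    refine le_trans ?_ (Finset.single_le_sum (fun i _ => Finset.sum_nonneg fun c _ => h0 i c)
      (Finset.mem_univ i))
    refine le_trans ?_ (Finset.single_le_sum (fun c _ => h0 i c) (Finset.mem_univ c))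
    change Δ < |dev g i c| at hic
    rcases lt_abs.1 hic with h | h
    · have : Real.exp (lam * Δ) ≤ Real.exp (lam * dev g i c) := by
        apply Real.exp_le_exp.2; gcongr
      linarith [Real.exp_pos (-lam * dev g i c)]
    · have : Real.exp (lam * Δ) ≤ Real.exp (-lam * dev g i c) := by
        apply Real.exp_le_exp.2
        rw [neg_mul, ← mul_neg]; gcongr
      linarith [Real.exp_pos (lam * dev g i c)]
  have hsum := (Finset.card_nsmul_le_sum _ _ _ hbad).trans htotal
  rw [nsmul_eq_mul, Finset.card_univ, Fintype.card_fun, Fintype.card_fin, Fintype.card_fin] at hsum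
  push_cast at hsum
  have hNn : (0 : ℝ) < N ^ n := by positivity
  have h1 : Real.exp (lam * Δ) ≤ 2 * (Fintype.card ι * N : ℝ) * Real.exp (lam ^ 2 * n) := by
    by_contra! hlt
    have := mul_lt_mul_of_pos_left hlt hNn
    linarith
  have h2 : Real.exp (lam * Δ) = Real.exp (Δ ^ 2 / (4 * n)) * Real.exp (lam ^ 2 * n) := by
    rw [← Real.exp_add]
    congr 1
    rw [hlam]
    field_simp
    ring
  rw [h2] at h1
  exact absurd (le_of_mul_le_mul_right h1 (Real.exp_pos _)) (not_le.2 hcard)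

/-! ### Local character sums -/

/-- All edges meet a minimum vertex cover. -/
theorem card_edgeFinset_le {ι : Type*} [Fintype ι] (H : SimpleGraph ι) (S : Finset ι)
    (hS : ∀ x y, H.Adj x y → x ∈ S) : H.edgeFinset.card ≤ vc H * S.card := by
  obtain ⟨C, hC, hCm⟩ := (vc_le_iff (H := H)).1 le_rfl
  refine le_trans ?_ (Nat.mul_le_mul_right _ hCm)
  rw [← Finset.card_product]
  refine (Finset.card_le_card fun e he => ?_).trans
    (Finset.card_image_le (f := fun q : ι × ι => s(q.1, q.2)))
  rw [SimpleGraph.mem_edgeFinset] at he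
  induction e with
  | _ x y =>
    rw [SimpleGraph.mem_edgeSet] at he
    rw [Finset.mem_image]
    rcases hC he with h | h
    · exact ⟨(x, y), Finset.mem_product.2 ⟨by exact_mod_cast h, hS y x he.symm⟩, rfl⟩
    · exact ⟨(y, x), Finset.mem_product.2 ⟨by exact_mod_cast h, hS x y he⟩, Sym2.eq_swap⟩

/-- Tuples on the blocks in `B` extend uniquely to a rectangle whose other blocks are single
vertices. -/
theorem sum_tuples {k n : ℕ} {Q : Rect k n} {B : Finset (Fin k)}
    (hQ : ∀ x ∉ B, ∃ v, Q x = {v}) (φ : Tuple n B → ℝ) :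
    ∑ t ∈ Fintype.piFinset Q, φ (fun i => t i) = ∑ s ∈ Q.tuples B, φ s := by
  refine Finset.sum_nbij (fun t i => t i) ?_ ?_ ?_ fun _ _ => rfl
  · intro t ht
    exact Fintype.mem_piFinset.2 fun i => Fintype.mem_piFinset.1 ht i
  · intro t ht t' ht' h
    funext x
    by_cases hx : x ∈ B
    · exact congrFun h ⟨x, hx⟩
    · obtain ⟨v, hv⟩ := hQ x hx
      have h1 := Fintype.mem_piFinset.1 (Finset.mem_coe.1 ht) x
      have h2 := Fintype.mem_piFinset.1 (Finset.mem_coe.1 ht') x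
      rw [hv, Finset.mem_singleton] at h1 h2
      rw [h1, h2]
  · intro s hs
    have hs := Fintype.mem_piFinset.1 (Finset.mem_coe.1 hs)
    refine ⟨fun x => if hx : x ∈ B then s ⟨x, hx⟩ else (hQ x hx).choose, ?_, ?_⟩
    · rw [Finset.mem_coe, Fintype.mem_piFinset]
      intro x
      by_cases hx : x ∈ B
      · simpa [hx] using hs ⟨x, hx⟩
      · rw [dif_neg hx]
        exact (Finset.ext_iff.1 (hQ x hx).choose_spec _).2 (Finset.mem_singleton_self _)
    · funext i
      simp

theorem BoundedCharSums.abs_coreSum_le {k n : ℕ} {G : SimpleGraph (Vertex k n)} {p s : ℝ}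
    {Q : Rect k n} {B : Finset (Fin k)} {F : SimpleGraph (Fin k)}
    (h : BoundedCharSums G p s Q B F) (hQ : ∀ x ∉ B, ∃ v, Q x = {v}) :
    |coreSum p G F B Q| ≤ s := by
  unfold BoundedCharSums at h
  rw [← sum_tuples hQ] at h
  convert h using 2
  refine Finset.sum_congr rfl fun t _ => ?_
  rw [← sum_family]
  refine Finset.sum_congr rfl fun H _ => ?_
  exact (character_placed_induce p G t H B).symm

theorem card_commonNbhd_side {k n : ℕ} (G : SimpleGraph (Vertex k n)) {S : Finset (Fin k)}
    (t : Tuple n S) (Q : Rect k n) (j : Fin k) :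
    (commonNbhd G t (Q.side j)).card =
      ((Q j).filter fun b => ∀ i : S, G.Adj ((i : Fin k), t i) (j, b)).card := by
  unfold commonNbhd Rect.side
  rw [Finset.filter_image, Finset.card_image_of_injective]
  intro a b h
  exact congrArg Prod.snd h

theorem card_side {k n : ℕ} (Q : Rect k n) (j : Fin k) : (Q.side j).card = (Q j).card := by
  unfold Rect.side
  rw [Finset.card_image_of_injective]
  intro a b h
  exact congrArg Prod.snd h

/-- The sum over a rectangle whose blocks are partitioned by the functions `g x`. -/
theorem sum_pieces {k n : ℕ} (Q : Rect k n) (g : Fin k → Fin n → ℕ) (N : Fin k → ℕ)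
    (hg : ∀ x b, g x b < N x) (φ : (Fin k → Fin n) → ℝ) :
    ∑ t ∈ Fintype.piFinset Q, φ t = ∑ c ∈ Fintype.piFinset fun x => Finset.range (N x),
      ∑ t ∈ Fintype.piFinset (fun x => (Q x).filter fun b => g x b = c x), φ t := by
  rw [← Finset.sum_fiberwise_of_maps_to (g := fun t x => g x (t x))
    (t := Fintype.piFinset fun x => Finset.range (N x))]
  · refine Finset.sum_congr rfl fun c _ => Finset.sum_congr ?_ fun _ _ => rfl
    ext t
    simp only [Finset.mem_filter, Fintype.mem_piFinset]
    constructor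
    · rintro ⟨h, rfl⟩ x
      exact ⟨h x, rfl⟩
    · intro h
      exact ⟨fun x => (h x).1, funext fun x => (h x).2⟩
  · intro t _
    exact Fintype.mem_piFinset.2 fun x => Finset.mem_range.2 (hg x _)

/-- Every set of at most `ℓ` vertices is the set of values of a function on `Fin ℓ`. -/
theorem exists_enumeration {V : Type*} (A : Finset V) {ℓ : ℕ} (hA : A.card ≤ ℓ) :
    ∃ f : Fin ℓ → Option V, ∀ v, v ∈ A ↔ ∃ i, f i = some v := by
  refine ⟨fun i => if h : (i : ℕ) < A.card then some (A.equivFin.symm ⟨i, h⟩) else none, ?_⟩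
  intro v
  constructor
  · intro hv
    refine ⟨⟨A.equivFin ⟨v, hv⟩, (A.equivFin ⟨v, hv⟩).2.trans_le hA⟩, ?_⟩
    simp
  · rintro ⟨i, hi⟩
    dsimp only at hi
    split_ifs at hi with h
    rw [← Option.some.inj hi]
    exact (A.equivFin.symm ⟨i, h⟩).2

/-- Deviations of `Δ` in the size `P` of a piece (expected size `q`) and in the number `y` of
neighbors in it (expected number `μ ≈ τ q`) widen the relative error from `κ` to `3 κ`. -/
theorem mem_Icc_of_deviation {κ τ P q Δ y μ : ℝ} (hκ0 : 0 ≤ κ) (hκ1 : κ ≤ 1) (hτ0 : 0 < τ)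
    (hτ1 : τ ≤ 1) (hΔ : 0 < Δ) (hP : -Δ ≤ P - q ∧ P - q ≤ Δ) (hy : -Δ ≤ y - μ ∧ y - μ ≤ Δ)
    (hμ1 : (1 - κ) * (τ * q) ≤ μ) (hμ2 : μ ≤ (1 + κ) * (τ * q))
    (hΔκ : 3 * Δ ≤ 2 * κ * (τ * P)) :
    (1 - 3 * κ) * (τ * P) ≤ y ∧ y ≤ (1 + 3 * κ) * (τ * P) := by
  have hτΔ : τ * Δ ≤ Δ := mul_le_of_le_one_left hΔ.le hτ1
  have hτΔ0 : 0 ≤ τ * Δ := by positivity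
  have hκΔ : κ * (τ * Δ) ≤ τ * Δ := mul_le_of_le_one_left hτΔ0 hκ1
  have hκΔ0 : 0 ≤ κ * (τ * Δ) := by positivity
  constructor
  · have h1 : (1 - κ) * (τ * (P - Δ)) ≤ (1 - κ) * (τ * q) := by
      have : 0 ≤ 1 - κ := by linarith
      gcongr
      linarith
    linarith
  · have h1 : (1 + κ) * (τ * q) ≤ (1 + κ) * (τ * (P + Δ)) := by
      gcongr
      linarith
    linarith

/-- A well-behaved block can be partitioned into pieces of size between `Λ` and `4Λ` in which all
small tuples of `Q` still have about the expected number of neighbors. -/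
theorem exists_block_partition {k n : ℕ} (G : SimpleGraph (Vertex k n)) {p : ℝ} (hp : 0 < p)
    (hp1 : p ≤ 1) (hk : 0 < k) (hn : 0 < n) {ℓ Λ : ℕ} {Δ : ℝ} (hΔ : 0 < Δ) (hΔn : Δ ≤ 2 * n)
    (hΔΛ : Δ < Λ) (hΔp : 3 * Δ * k ≤ 2 * p ^ ℓ * Λ)
    (hexp : 2 * (((k : ℝ) * n + 1) ^ ℓ * n) < Real.exp (Δ ^ 2 / (4 * n)))
    (Q : Rect k n) (x : Fin k) (hx : 4 * Λ ≤ (Q x).card) :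
    ∃ (N : ℕ) (g : Fin n → ℕ), (∀ b, g b < N) ∧ ∀ c < N,
      Λ < ((Q x).filter fun b => g b = c).card ∧ ((Q x).filter fun b => g b = c).card ≤ 4 * Λ ∧
      ∀ (S : Finset (Fin k)) (t : Tuple n S), S.card ≤ ℓ →
        HasExpectedNbhd G (1 / k) p t (Q.side x) → ∀ Q' : Rect k n,
          Q' x = (Q x).filter (fun b => g b = c) →
          HasExpectedNbhd G (3 / k) p t (Q'.side x) := by
  set R := (Q x).card with hR
  have hΛ : 0 < Λ := by
    have : (0 : ℝ) < Λ := hΔ.trans hΔΛ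
    exact_mod_cast this
  set N := R / (2 * Λ) with hNdef
  have hN2 : 2 ≤ N := by
    rw [hNdef, Nat.le_div_iff_mul_le (by omega)]; omega
  have hN0 : 0 < N := by omega
  have hRn : R ≤ n := by
    rw [hR]; exact (Finset.card_le_univ _).trans_eq (Fintype.card_fin n)
  have hNn : N ≤ n := (Nat.div_le_self _ _).trans hRn
  have hlow : N * (2 * Λ) ≤ R := Nat.div_mul_le_self _ _
  have hupp : R < (N + 1) * (2 * Λ) := by
    rw [mul_comm]
    exact Nat.lt_mul_div_succ R (by omega)
  -- the family to be split evenly: all common neighborhoods of at most `ℓ` vertices, the empty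
  -- family of vertices giving the block itself
  let X : (Fin ℓ → Option (Vertex k n)) → Finset (Fin n) := fun f =>
    (Q x).filter fun b => ∀ i v, f i = some v → G.Adj v (x, b)
  obtain ⟨g, hg⟩ := exists_equitable hN0 hn X hΔ hΔn (by
    refine lt_of_le_of_lt ?_ hexp
    rw [Fintype.card_fun, Fintype.card_option, Fintype.card_prod, Fintype.card_fin,
      Fintype.card_fin, Fintype.card_fin]
    push_cast
    have : (N : ℝ) ≤ n := by exact_mod_cast hNn
    gcongr)
  have hN0' : (0 : ℝ) < N := by exact_mod_cast hN0
  have hq1 : (2 * Λ : ℝ) ≤ R / N := by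
    rw [le_div_iff₀ hN0']
    have : ((N * (2 * Λ) : ℕ) : ℝ) ≤ R := by exact_mod_cast hlow
    push_cast at this
    linarith
  have hq2 : (R / N : ℝ) ≤ 3 * Λ := by
    rw [div_le_iff₀ hN0']
    have h1 : (R : ℝ) ≤ ((N + 1) * (2 * Λ) : ℕ) := by exact_mod_cast hupp.le
    push_cast at h1
    have h2 : (2 : ℝ) ≤ N := by exact_mod_cast hN2
    have h3 : (0 : ℝ) < Λ := by exact_mod_cast hΛ
    nlinarith
  refine ⟨N, fun b => g b, fun b => (g b).2, fun c hc => ?_⟩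
  have hfilt : ∀ Y : Finset (Fin n), Y.filter (fun b => ((g b : ℕ) = c)) =
      Y.filter fun b => g b = ⟨c, hc⟩ := by
    intro Y
    refine Finset.filter_congr fun b _ => ?_
    rw [Fin.ext_iff]
  have hX0 : X (fun _ => none) = Q x := by simp [X]
  have hpiece := hg (fun _ => none) ⟨c, hc⟩
  rw [hX0, ← hfilt, ← hR, abs_le] at hpiece
  set P := (Q x).filter fun b => (g b : ℕ) = c with hP
  have hP1 : (Λ : ℝ) < P.card := by linarith
  have hP2 : (P.card : ℝ) ≤ 4 * Λ := by linarith
  refine ⟨by exact_mod_cast hP1, by exact_mod_cast hP2, ?_⟩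
  intro S t hS hexpd Q' hQ'
  obtain ⟨f, hf⟩ := exists_enumeration (Finset.univ.image fun i : S => (((i : Fin k), t i) :
    Vertex k n)) (ℓ := ℓ) (Finset.card_image_le.trans (by simpa using hS))
  have hXf : X f = (Q x).filter fun b => ∀ i : S, G.Adj ((i : Fin k), t i) (x, b) := by
    refine Finset.filter_congr fun b _ => ?_
    constructor
    · intro h i
      obtain ⟨a, ha⟩ := (hf ((i : Fin k), t i)).1 (Finset.mem_image_of_mem _ (Finset.mem_univ i))
      exact h a _ ha
    · intro h a v hav
      obtain ⟨i, -, hi⟩ := Finset.mem_image.1 ((hf v).2 ⟨a, hav⟩)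
      rw [← hi]
      exact h i
  have hpf := hg f ⟨c, hc⟩
  rw [← hfilt, hXf, abs_le] at hpf
  unfold HasExpectedNbhd at hexpd ⊢
  rw [card_commonNbhd_side, card_side, Set.mem_Icc] at hexpd ⊢
  rw [← hR] at hexpd
  rw [hQ']
  have hcomm : (P.filter fun b => ∀ i : S, G.Adj ((i : Fin k), t i) (x, b)) =
      ((Q x).filter fun b => ∀ i : S, G.Adj ((i : Fin k), t i) (x, b)).filter
        fun b => (g b : ℕ) = c := by
    rw [hP, Finset.filter_filter, Finset.filter_filter]
    exact Finset.filter_congr fun b _ => and_comm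
  rw [hcomm]
  have hk' : (1 : ℝ) ≤ k := by exact_mod_cast hk
  have hτℓ : p ^ ℓ ≤ p ^ S.card := pow_le_pow_of_le_one hp.le hp1 hS
  rw [show (3 : ℝ) / k = 3 * (1 / k) by ring]
  refine mem_Icc_of_deviation (by positivity) ?_ (by positivity) (pow_le_one₀ hp.le hp1) hΔ hpiece
    hpf ?_ ?_ ?_
  · rw [div_le_one (by linarith)]
    exact hk'
  · rw [le_div_iff₀ hN0', mul_assoc, mul_assoc, div_mul_cancel₀ _ hN0'.ne']
    exact hexpd.1
  · rw [div_le_iff₀ hN0', mul_assoc, mul_assoc, div_mul_cancel₀ _ hN0'.ne']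
    exact hexpd.2
  -- the deviation `Δ` is absorbed by the increase of the relative error from `1/k` to `3/k`
  · have h2 : p ^ ℓ * (Λ : ℝ) ≤ p ^ S.card * P.card := by gcongr
    have h3 : 3 * Δ * k ≤ 2 * (p ^ S.card * P.card) := by linarith
    rw [show 2 * (1 / (k : ℝ)) * (p ^ S.card * P.card) = 2 * (p ^ S.card * P.card) / k by ring,
      le_div_iff₀ (by linarith)]
    exact h3

/-- The relative bound on the core sums over well-behaved rectangles, per unit of the vertex cover
number. -/
def localRate (k n : ℕ) (p : ℝ) (d Λ : ℕ) : ℝ :=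
  p⁻¹ ^ (3 * d) * ((Λ : ℝ) / (10 * k * Real.logb 2 n)) ^ (-(1 / 4) : ℝ)

/-- Over a rectangle in which all small tuples have about the expected number of common neighbors,
core sums are small relative to the size of the rectangle: the rectangle is partitioned into
well-behaved pieces of size about `Λ`, to which the local bound on character sums applies. -/
theorem WellBehaved.abs_coreSum_le {k n : ℕ} {G : SimpleGraph (Vertex k n)} {C K D p : ℝ}
    (hG : WellBehaved C K D G) (hpD : p = (n : ℝ) ^ (-2 / D)) (hn : 0 < n) (hk : 0 < k)
    (hp1 : p ≤ 1) (hK : 0 ≤ K) {d Λ : ℕ} (hd : ((3 * d : ℕ) : ℝ) ≤ D / 4)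
    (hΛ : 20 * k * Real.logb 2 n ≤ Λ) {Δ : ℝ} (hΔ : 0 < Δ) (hΔn : Δ ≤ 2 * n) (hΔΛ : Δ < Λ)
    (hΔp : 3 * Δ * k ≤ 2 * p ^ (3 * d) * Λ)
    (hexp : 2 * (((k : ℝ) * n + 1) ^ (3 * d) * n) < Real.exp (Δ ^ 2 / (4 * n)))
    {B : Finset (Fin k)} {Q : Rect k n} (hQB : ∀ x ∉ B, ∃ v, Q x = {v})
    (hQ : ∀ x ∈ B, 4 * Λ ≤ (Q x).card)
    (hnb : ∀ S : Finset (Fin k), S ⊆ B → S.card ≤ 3 * d → ∀ t ∈ Q.tuples S, ∀ j ∈ B, j ∉ S →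
      HasExpectedNbhd G (1 / k) p t (Q.side j))
    {F : SimpleGraph (Fin k)} (hF : F ∈ Set.range (core (k := k))) (hFd : vc F ≤ d) :
    |coreSum p G F B Q| ≤
      K * localRate k n p d Λ ^ vc (restrict F B) * (Fintype.piFinset Q).card := by
  have hp : 0 < p := hpD ▸ Real.rpow_pos_of_pos (by exact_mod_cast hn) _
  have hpart : ∀ x, ∃ (N : ℕ) (g : Fin n → ℕ), (∀ b, g b < N) ∧
      (x ∉ B → N = 1) ∧ (x ∈ B → ∀ c < N,
      Λ < ((Q x).filter fun b => g b = c).card ∧ ((Q x).filter fun b => g b = c).card ≤ 4 * Λ ∧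
      ∀ (S : Finset (Fin k)) (t : Tuple n S), S.card ≤ 3 * d →
        HasExpectedNbhd G (1 / k) p t (Q.side x) → ∀ Q' : Rect k n,
          Q' x = (Q x).filter (fun b => g b = c) →
          HasExpectedNbhd G (3 / k) p t (Q'.side x)) := by
    intro x
    by_cases hx : x ∈ B
    · obtain ⟨N, g, h1, h2⟩ := exists_block_partition G hp hp1 hk hn hΔ hΔn hΔΛ hΔp hexp Q x
        (hQ x hx)
      exact ⟨N, g, h1, fun h => absurd hx h, fun _ => h2⟩
    · exact ⟨1, fun _ => 0, fun _ => Nat.one_pos, fun _ => rfl, fun h => absurd h hx⟩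
  choose N g hgN hout hin using hpart
  have hpieces := sum_pieces Q g N hgN
  have hΛ0 : 0 < Λ := by
    have : (0 : ℝ) < Λ := hΔ.trans hΔΛ
    exact_mod_cast this
  have hsupp : ∀ x ∈ F.support, x ∈ coreSet F := by
    intro x hx
    obtain ⟨y, hy⟩ := F.mem_support.1 hx
    exact (core_adj_mem hF hy).1
  have hlog : 0 ≤ Real.logb 2 n :=
    Real.logb_nonneg (by norm_num) (by exact_mod_cast hn)
  -- the bound of the local character sum property in terms of `localRate`
  have hrate : K * (p ^ (F.induce (B : Set (Fin k))).edgeFinset.card)⁻¹ *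
      (Λ / (10 * k * Real.logb 2 n)) ^ (-(vc (F.induce (B : Set (Fin k))) : ℝ) / 4) ≤
      K * localRate k n p d Λ ^ vc (restrict F B) := by
    rw [mul_assoc, vc_induce]
    refine mul_le_mul_of_nonneg_left ?_ hK
    rw [localRate, mul_pow]
    have hx0 : 0 ≤ (Λ : ℝ) / (10 * k * Real.logb 2 n) := by positivity
    refine mul_le_mul ?_ (le_of_eq ?_) (by positivity) (by have := hp; positivity)
    · rw [← pow_mul, ← inv_pow]
      refine pow_le_pow_right₀ ((one_le_inv₀ hp).2 hp1) ?_
      have h1 := card_edgeFinset_le (F.induce (B : Set (Fin k)))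
        (Finset.univ.filter fun x : (B : Set (Fin k)) => (x : Fin k) ∈ coreSet F)
        (fun x y hxy => by simpa using (core_adj_mem hF hxy).1)
      rw [vc_induce] at h1
      refine h1.trans ?_
      rw [mul_comm]
      refine Nat.mul_le_mul_right _ (le_trans ?_ ((card_coreSet_le F).trans (by omega)))
      refine Finset.card_le_card_of_injOn (fun x => (x : Fin k)) ?_ ?_
      · intro x hx
        simpa using hx
      · intro x _ y _ hxy
        exact Subtype.ext hxy
    · rw [← Real.rpow_mul_natCast hx0]
      congr 1
      ring
  have hterm : ∀ c ∈ Fintype.piFinset (fun x => Finset.range (N x)),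
      |coreSum p G F B fun x => (Q x).filter fun b => g x b = c x| ≤
      K * localRate k n p d Λ ^ vc (restrict F B) *
        (Fintype.piFinset fun x => (Q x).filter fun b => g x b = c x).card := by
    intro c hc
    have hc : ∀ x, c x < N x := fun x => Finset.mem_range.1 (Fintype.mem_piFinset.1 hc x)
    set P : Rect k n := fun x => (Q x).filter fun b => g x b = c x with hP
    have hPsub : ∀ x, P x ⊆ Q x := fun x => Finset.filter_subset _ _
    have hPB : ∀ x ∉ B, ∃ v, P x = {v} := by
      intro x hx
      have : P x = Q x := Finset.filter_true_of_mem fun b _ => by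
        have h1 := hgN x b
        have h2 := hc x
        rw [hout x hx] at h1 h2
        omega
      rw [this]
      exact hQB x hx
    have hcs := hG.char_sums_local F hF
      (le_trans (by exact_mod_cast (show vc F ≤ 3 * d by omega)) hd) Λ hΛ B P ?_ ?_ ?_
    · have htup : (((P.tuples B).card : ℕ) : ℝ) = (Fintype.piFinset P).card := by
        have := sum_tuples hPB fun _ => (1 : ℝ)
        simpa using this.symm
      rw [← hpD] at hcs
      refine (hcs.abs_coreSum_le hPB).trans ?_
      rw [htup]
      exact mul_le_mul_of_nonneg_right hrate (by positivity)
    · intro x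
      by_cases hx : x ∈ B
      · exact (hin x hx (c x) (hc x)).2.1
      · obtain ⟨v, hv⟩ := hPB x hx
        rw [hv, Finset.card_singleton]
        omega
    · intro x hx
      exact (hin x hx (c x) (hc x)).1
    · intro x hx hxF S hS t ht
      rw [← hpD]
      have hScard : S.card ≤ 3 * d := by
        refine (Finset.card_le_card fun y hy => hsupp y ?_).trans
          ((card_coreSet_le F).trans (by omega))
        exact (Finset.mem_filter.1 (hS hy)).2
      refine (hin x hx (c x) (hc x)).2.2 S t hScard ?_ P rfl
      refine hnb S (fun y hy => (Finset.mem_filter.1 (hS hy)).1) hScard t ?_ x hx ?_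
      · exact Fintype.mem_piFinset.2 fun i => hPsub i (Fintype.mem_piFinset.1 ht i)
      · exact fun hxS => hxF (Finset.mem_filter.1 (hS hxS)).2
  have hcount : ((Fintype.piFinset Q).card : ℝ) = ∑ c ∈ Fintype.piFinset fun x =>
      Finset.range (N x), ((Fintype.piFinset fun x =>
        (Q x).filter fun b => g x b = c x).card : ℝ) := by
    have := hpieces fun _ => (1 : ℝ)
    simpa using this
  rw [hcount, Finset.mul_sum, coreSum, hpieces]
  exact (Finset.abs_sum_le_sum_abs _ _).trans (Finset.sum_le_sum hterm)

/-- Splitting a rectangle according to the first block in `B` whose vertex is in a set `W`. -/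
theorem sum_split_first {k n : ℕ} (B : Finset (Fin k)) (Q : Rect k n)
    (W : Finset (Vertex k n)) (φ : (Fin k → Fin n) → ℝ) :
    ∑ t ∈ Fintype.piFinset Q, φ t =
      ∑ t ∈ Fintype.piFinset (fun x => if x ∈ B then (Q x).filter fun b => (x, b) ∉ W else Q x),
        φ t +
      ∑ a ∈ W.filter fun a => a.1 ∈ B ∧ a.2 ∈ Q a.1,
        ∑ t ∈ Fintype.piFinset (fun x => if x = a.1 then {a.2} else
          if x ∈ B ∧ x < a.1 then (Q x).filter fun b => (x, b) ∉ W else Q x), φ t := by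
  set I := W.filter fun a => a.1 ∈ B ∧ a.2 ∈ Q a.1 with hI
  have hmemI : ∀ {a}, a ∈ I ↔ a ∈ W ∧ a.1 ∈ B ∧ a.2 ∈ Q a.1 := by
    intro a; rw [hI, Finset.mem_filter]
  have hch : ∀ {a t}, a ∈ I → (t ∈ Fintype.piFinset (fun x => if x = a.1 then {a.2} else
      if x ∈ B ∧ x < a.1 then (Q x).filter fun b => (x, b) ∉ W else Q x) ↔
      t ∈ Fintype.piFinset Q ∧ t a.1 = a.2 ∧ ∀ x ∈ B, x < a.1 → (x, t x) ∉ W) := by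
    intro a t ha
    rw [Fintype.mem_piFinset, Fintype.mem_piFinset]
    constructor
    · intro h
      have hta : t a.1 = a.2 := by simpa using h a.1
      refine ⟨fun x => ?_, hta, fun x hxB hx => ?_⟩
      · have := h x
        by_cases h1 : x = a.1
        · subst h1
          rw [hta]
          exact (hmemI.1 ha).2.2
        · by_cases h2 : x ∈ B ∧ x < a.1
          · simp only [h1, if_false, h2, and_self, if_true, Finset.mem_filter] at this
            exact this.1
          · simpa only [h1, if_false, h2] using this
      · have := h x
        simp only [hx.ne, if_false, hxB, hx, and_self, if_true, Finset.mem_filter] at this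
        exact this.2
    · rintro ⟨h1, h2, h3⟩ x
      by_cases h4 : x = a.1
      · subst h4; simp [h2]
      · by_cases h5 : x ∈ B ∧ x < a.1
        · simp only [h4, if_false, h5, and_self, if_true, Finset.mem_filter]
          exact ⟨h1 x, h3 x h5.1 h5.2⟩
        · simpa only [h4, if_false, h5] using h1 x
  have h0 : ∀ t, (t ∈ Fintype.piFinset (fun x => if x ∈ B then
      (Q x).filter fun b => (x, b) ∉ W else Q x) ↔
      t ∈ Fintype.piFinset Q ∧ ∀ x ∈ B, (x, t x) ∉ W) := by
    intro t
    rw [Fintype.mem_piFinset, Fintype.mem_piFinset]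
    constructor
    · intro h
      refine ⟨fun x => ?_, fun x hx => ?_⟩
      · have := h x
        split_ifs at this
        · exact (Finset.mem_filter.1 this).1
        · exact this
      · have := h x
        rw [if_pos hx] at this
        exact (Finset.mem_filter.1 this).2
    · rintro ⟨h1, h2⟩ x
      split_ifs with hx
      · exact Finset.mem_filter.2 ⟨h1 x, h2 x hx⟩
      · exact h1 x
  rw [← Finset.sum_biUnion, ← Finset.sum_union]
  · refine Finset.sum_congr ?_ fun _ _ => rfl
    ext t
    rw [Finset.mem_union, h0, Finset.mem_biUnion]
    constructor
    · intro ht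
      by_cases hbad : ∀ x ∈ B, (x, t x) ∉ W
      · exact Or.inl ⟨ht, hbad⟩
      · push Not at hbad
        have hne : (B.filter fun x => (x, t x) ∈ W).Nonempty := by
          obtain ⟨x, hx, hxW⟩ := hbad
          exact ⟨x, Finset.mem_filter.2 ⟨hx, hxW⟩⟩
        set j := (B.filter fun x => (x, t x) ∈ W).min' hne with hj
        have hjm := Finset.mem_filter.1 (Finset.min'_mem _ hne)
        rw [← hj] at hjm
        have hjI : (j, t j) ∈ I := hmemI.2 ⟨hjm.2, hjm.1, Fintype.mem_piFinset.1 ht j⟩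
        refine Or.inr ⟨(j, t j), hjI, (hch hjI).2 ⟨ht, rfl, fun x hxB hx hxW => ?_⟩⟩
        exact absurd (Finset.min'_le _ x (Finset.mem_filter.2 ⟨hxB, hxW⟩)) (not_le.2 hx)
    · rintro (h | ⟨a, ha, h⟩)
      · exact h.1
      · exact ((hch ha).1 h).1
  · rw [Finset.disjoint_left]
    intro t ht ht'
    obtain ⟨a, ha, h⟩ := Finset.mem_biUnion.1 ht'
    obtain ⟨-, h1, -⟩ := (hch ha).1 h
    have h2 := ((h0 t).1 ht).2 a.1 (hmemI.1 ha).2.1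
    rw [h1] at h2
    exact h2 (hmemI.1 ha).1
  · intro a ha a' ha' hne
    rw [Function.onFun, Finset.disjoint_left]
    intro t ht ht'
    have ha : a ∈ I := ha
    have ha' : a' ∈ I := ha'
    obtain ⟨-, h1, h2⟩ := (hch ha).1 ht
    obtain ⟨-, h1', h2'⟩ := (hch ha').1 ht'
    rcases lt_trichotomy a.1 a'.1 with h | h | h
    · have := h2' a.1 (hmemI.1 ha).2.1 h
      rw [h1] at this
      exact this (hmemI.1 ha).1
    · exact hne (Prod.ext h (by rw [← h1, ← h1', h]))
    · have := h2 a'.1 (hmemI.1 ha').2.1 h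
      rw [h1'] at this
      exact this (hmemI.1 ha').1

/-- The branching property of well-behaved graphs. If a block has fewer than `θ` vertices, its
vertices are fixed one by one and no good rectangle is left. Otherwise removing the error set `W`
leaves a good rectangle, and the tuples that meet `W` are split according to the first vertex in
`W`. -/
theorem WellBehaved.branching {k n : ℕ} {G : SimpleGraph (Vertex k n)} {C K D p : ℝ}
    (hG : WellBehaved C K D G) (hpD : p = (n : ℝ) ^ (-2 / D)) (hn : 0 < n) (hk : 0 < k)
    (hp1 : p ≤ 1) (hK : 0 ≤ K) {d Λ s θ : ℕ} (hd : ((3 * d : ℕ) : ℝ) ≤ D / 4)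
    (hΛ : 20 * k * Real.logb 2 n ≤ Λ) {Δ : ℝ} (hΔ : 0 < Δ) (hΔn : Δ ≤ 2 * n) (hΔΛ : Δ < Λ)
    (hΔp : 3 * Δ * k ≤ 2 * p ^ (3 * d) * Λ)
    (hexp : 2 * (((k : ℝ) * n + 1) ^ (3 * d) * n) < Real.exp (Δ ^ 2 / (4 * n)))
    (hs : C * (k : ℝ) ^ 4 * (3 * d : ℕ) * Real.log n / p ^ (2 * (3 * d)) ≤ s)
    (hθ : s + 4 * Λ ≤ θ) (hθ2 : 2 * s ≤ θ) :
    Branching G p K (localRate k n p d Λ) θ d := by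
  intro B Q hQB
  by_cases hsmall : ∃ j ∈ B, (Q j).card < θ
  · obtain ⟨j, hjB, hj⟩ := hsmall
    refine ⟨fun x => if x = j then ∅ else Q x, (Q j).image fun v => (j, v),
      fun a => Function.update Q a.1 {a.2}, ?_, ?_, ?_, ?_, ?_⟩
    · intro φ
      have hempty : Fintype.piFinset (fun x => if x = j then ∅ else Q x) = ∅ := by
        refine Finset.eq_empty_of_forall_notMem fun t ht => ?_
        have := Fintype.mem_piFinset.1 ht j
        simp at this
      rw [hempty, Finset.sum_empty, zero_add, Finset.sum_image, sum_split_block Q j]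
      intro a _ b _ hab
      exact congrArg Prod.snd hab
    · exact_mod_cast Finset.card_image_le.trans hj.le
    · intro x
      dsimp only
      split_ifs
      · exact Finset.empty_subset _
      · exact subset_rfl
    · intro a ha
      obtain ⟨v, hv, rfl⟩ := Finset.mem_image.1 ha
      refine ⟨hjB, update_subset hv, fun x hx => ?_, by simp⟩
      dsimp only
      rw [Function.update_of_ne]
      rintro rfl
      exact hx hjB
    · intro F _ _
      have hempty : Fintype.piFinset (fun x => if x = j then ∅ else Q x) = ∅ := by
        refine Finset.eq_empty_of_forall_notMem fun t ht => ?_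
        have := Fintype.mem_piFinset.1 ht j
        simp at this
      rw [coreSum, hempty]
      simp
  · push Not at hsmall
    rw [hpD] at hs
    obtain ⟨W, hW, hWn⟩ := hG.error_sets (3 * d) s hd hs (fun x => if x ∈ B then Q x else ∅) (by
      intro x
      split_ifs with hx
      · left
        have := hθ2.trans (hsmall x hx)
        exact_mod_cast this
      · right; simp)
    rw [← hpD] at hWn
    have hWs : W.card ≤ s := by exact_mod_cast hW
    refine ⟨_, _, _, sum_split_first B Q W, ?_, ?_, ?_, ?_⟩
    · have : (W.filter fun a => a.1 ∈ B ∧ a.2 ∈ Q a.1).card ≤ θ :=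
        (Finset.card_le_card (Finset.filter_subset _ _)).trans (by omega)
      exact_mod_cast this
    · intro x
      split_ifs
      · exact Finset.filter_subset _ _
      · exact subset_rfl
    · intro a ha
      obtain ⟨haW, haB, haQ⟩ := Finset.mem_filter.1 ha
      refine ⟨haB, fun x => ?_, fun x hx => ?_, by simp⟩
      · split_ifs with h1 h2
        · subst h1; simpa using haQ
        · exact Finset.filter_subset _ _
        · exact subset_rfl
      · have h1 : x ≠ a.1 := by rintro rfl; exact hx haB
        simp [h1, hx]
    · intro F hF hFd
      set Q₀ : Rect k n := fun x => if x ∈ B then (Q x).filter fun b => (x, b) ∉ W else Q x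
        with hQ₀
      refine hG.abs_coreSum_le hpD hn hk hp1 hK hd hΛ hΔ hΔn hΔΛ hΔp hexp ?_ ?_ ?_ hF hFd
      · intro x hx
        simp only [hQ₀, hx, if_false]
        exact hQB x hx
      · intro x hx
        simp only [hQ₀, hx, if_true]
        have h1 := Finset.card_filter_add_card_filter_not (s := Q x) (fun b => (x, b) ∉ W)
        have h2 : ((Q x).filter fun b => ¬ (x, b) ∉ W).card ≤ W.card := by
          refine Finset.card_le_card_of_injOn (fun b => (x, b)) ?_ ?_
          · intro b hb
            simpa using (Finset.mem_filter.1 hb).2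
          · intro b _ b' _ h
            exact congrArg Prod.snd h
        have h3 := hsmall x hx
        omega
      · intro S hSB hS t ht j hj hjS
        have ht := fun i => Fintype.mem_piFinset.1 ht i
        have hside : Rect.side (fun x => if x ∈ B then Q x else ∅) j \ W = Q₀.side j := by
          ext a
          simp only [Rect.side, Finset.mem_sdiff, Finset.mem_image, hQ₀, hj, if_true,
            Finset.mem_filter]
          constructor
          · rintro ⟨⟨b, hb, rfl⟩, h⟩
            exact ⟨b, ⟨hb, h⟩, rfl⟩
          · rintro ⟨b, ⟨hb, h⟩, rfl⟩
            exact ⟨⟨b, hb, rfl⟩, h⟩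
        rw [← hside]
        have ht' : ∀ i : S, t i ∈ Q i ∧ ((i : Fin k), t i) ∉ W := by
          intro i
          have := ht i
          simp only [hQ₀, hSB i.2, if_true, Finset.mem_filter] at this
          exact this
        refine hWn S (by exact_mod_cast hS) t ?_ (fun i => (ht' i).2) j hjS
        refine Fintype.mem_piFinset.2 fun i => ?_
        simp only [hSB i.2, if_true]
        exact (ht' i).1

theorem WellBehaved.nbhdUpper {k n : ℕ} {G : SimpleGraph (Vertex k n)} {C K D p : ℝ}
    (hG : WellBehaved C K D G) (hpD : p = (n : ℝ) ^ (-2 / D)) {L : ℕ} (hL : (L : ℝ) ≤ D / 4) :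
    NbhdUpper G p (1 + 1 / k) L := by
  intro T x t hx hT
  have h := (hG.nbhds T (le_trans (by exact_mod_cast hT) hL) x hx T subset_rfl (fun i => t i)
    (Fintype.mem_piFinset.2 fun _ => Finset.mem_univ _)).2
  rw [card_commonNbhd_side, card_side, Finset.card_univ, Fintype.card_fin, ← hpD] at h
  refine le_trans (le_of_eq ?_) h
  congr 2
  refine Finset.filter_congr fun b _ => ?_
  exact ⟨fun h i => h i i.2, fun h i hi => h ⟨i, hi⟩⟩

/-! ### The functional on monomials -/

theorem mem_ruledOut {k n : ℕ} {m : Var k n →₀ ℕ} {t : Fin k → Fin n} :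
    t ∈ ruledOut m ↔ ∀ v ∈ m.support, assignment t v = 1 := by
  rw [ruledOut, Finset.mem_filter, MvPolynomial.eval_monomial, one_mul, Finsupp.prod]
  constructor
  · rintro ⟨-, h⟩ v hv
    by_contra hne
    have h0 : assignment t v = 0 := by
      rcases v with v | v <;> simp only [assignment] at hne ⊢ <;> split_ifs at hne ⊢ <;> simp_all
    rw [Finset.prod_eq_zero hv (by rw [h0, zero_pow (Finsupp.mem_support_iff.1 hv)])] at h
    exact zero_ne_one h
  · intro h
    exact ⟨Finset.mem_univ _, Finset.prod_eq_one fun v hv => by rw [h v hv, one_pow]⟩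

theorem mem_ruledOut_add_single {k n : ℕ} {m : Var k n →₀ ℕ} {v : Vertex k n} {t : Fin k → Fin n} :
    t ∈ ruledOut (m + Finsupp.single (Sum.inl v) 1) ↔ t ∈ ruledOut m ∧ t v.1 = v.2 := by
  have hv : assignment t (Sum.inl v) = 1 ↔ t v.1 = v.2 := by
    simp only [assignment]
    split_ifs with h <;> simp [h]
  rw [mem_ruledOut, mem_ruledOut, ← hv]
  constructor
  · intro h
    refine ⟨fun w hw => h w ?_, h _ ?_⟩ <;>
      simp only [Finsupp.mem_support_iff, Finsupp.add_apply, Finsupp.single_eq_same] at *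
    · omega
    · omega
  · rintro ⟨h1, h2⟩ w hw
    by_cases hwv : w = Sum.inl v
    · rw [hwv, h2]
    · refine h1 w ?_
      simpa [Finsupp.single_apply, Ne.symm hwv] using hw

/-- The vertices of block `i` that are compatible with the monomial `m`; these sets are the sides of
the rectangle `Q(m)`. -/
def monomialRect {k n : ℕ} (m : Var k n →₀ ℕ) : Rect k n := fun i =>
  Finset.univ.filter fun a =>
    ∀ b, (Sum.inl (i, b) ∈ m.support → a = b) ∧ (Sum.inr (i, b) ∈ m.support → a ≠ b)

theorem ruledOut_eq {k n : ℕ} (m : Var k n →₀ ℕ) :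
    ruledOut m = Fintype.piFinset (monomialRect m) := by
  ext t
  rw [mem_ruledOut, Fintype.mem_piFinset]
  have hl : ∀ v : Vertex k n, assignment t (Sum.inl v) = 1 ↔ t v.1 = v.2 := by
    intro v
    simp only [assignment]
    split_ifs with h <;> simp [h]
  have hr : ∀ v : Vertex k n, assignment t (Sum.inr v) = 1 ↔ t v.1 ≠ v.2 := by
    intro v
    simp only [assignment]
    split_ifs with h <;> simp [h]
  simp only [monomialRect, Finset.mem_filter, Finset.mem_univ, true_and]
  constructor
  · intro h i b
    exact ⟨fun hb => (hl _).1 (h _ hb), fun hb => (hr _).1 (h _ hb)⟩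
  · rintro h (v | v) hv
    · exact (hl v).2 ((h v.1 v.2).1 hv)
    · exact (hr v).2 ((h v.1 v.2).2 hv)

theorem cliqueMeasure_monomial {k n : ℕ} (p d : ℝ) (G : SimpleGraph (Vertex k n))
    (m : Var k n →₀ ℕ) :
    cliqueMeasure p d G (MvPolynomial.monomial m 1) = tupleMeasure p d G (ruledOut m) := by
  have h : MvPolynomial.monomial m (1 : ℝ) = MvPolynomial.basisMonomials (Var k n) ℝ m := by
    rw [MvPolynomial.coe_basisMonomials]
  rw [cliqueMeasure, h]
  exact Module.Basis.constr_basis _ _ _ _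

theorem tupleMeasure_piFinset {k n : ℕ} (p : ℝ) {d : ℝ} (hd : 0 ≤ d) (G : SimpleGraph (Vertex k n))
    (Q : Rect k n) :
    tupleMeasure p d G (Fintype.piFinset Q) =
      ((n : ℝ) ^ k)⁻¹ * truncSum p G ⌊d⌋₊ Finset.univ Q := by
  rw [tupleMeasure, truncSum]
  congr 1
  refine Finset.sum_congr rfl fun t _ => Finset.sum_congr ?_ fun H _ => character_placed p G t H
  ext H
  rw [mem_graphsOn, Finset.mem_filter, Nat.le_floor_iff hd]
  simp [SupportedOn]

theorem sum_ruledOut_add_single {k n : ℕ} (m : Var k n →₀ ℕ) (i : Fin k)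
    (φ : (Fin k → Fin n) → ℝ) :
    ∑ a : Fin n, ∑ t ∈ ruledOut (m + Finsupp.single (Sum.inl (i, a)) 1), φ t =
      ∑ t ∈ ruledOut m, φ t := by
  rw [← Finset.sum_fiberwise (ruledOut m) fun t => t i]
  refine Finset.sum_congr rfl fun a _ => Finset.sum_congr ?_ fun _ _ => rfl
  ext t
  rw [mem_ruledOut_add_single, Finset.mem_filter]

/-- The block axioms hold exactly. -/
theorem cliqueMeasure_block_axiom {k n : ℕ} (p d : ℝ) (G : SimpleGraph (Vertex k n))
    (m : Var k n →₀ ℕ) (i : Fin k) :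
    cliqueMeasure p d G (MvPolynomial.monomial m 1 *
      ((∑ a : Fin n, MvPolynomial.X (Sum.inl (i, a))) - 1)) = 0 := by
  have h : ∀ a : Fin n, MvPolynomial.monomial m (1 : ℝ) * MvPolynomial.X (Sum.inl (i, a)) =
      MvPolynomial.monomial (m + Finsupp.single (Sum.inl (i, a)) 1) 1 := by
    intro a
    rw [MvPolynomial.X, MvPolynomial.monomial_mul, one_mul]
  rw [mul_sub, mul_one, Finset.mul_sum, map_sub, map_sum, sub_eq_zero]
  simp only [h, cliqueMeasure_monomial, tupleMeasure]
  rw [← Finset.mul_sum, sum_ruledOut_add_single]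

section

variable {k n : ℕ} {G : SimpleGraph (Vertex k n)} {p β K E ρ' ρ M Θ : ℝ} {d : ℕ}

theorem fixedOutside_univ (G : SimpleGraph (Vertex k n)) (Q : Rect k n) :
    FixedOutside G Finset.univ Q fun _ => Finset.univᶜ where
  single x hx := absurd (Finset.mem_univ x) hx
  disj x _ := by simp
  adj x _ i hi := by simp at hi

theorem sizeBound_univ (n : ℕ) (p β : ℝ) :
    sizeBound n p β Finset.univ (fun _ => (Finset.univ : Finset (Fin k))ᶜ) =
      β ^ k * (n : ℝ) ^ k := by
  simp [sizeBound, mul_pow]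

/-- The functional is a pseudo-measure as soon as the error terms of the main estimates, relative to
the number of all tuples, are small. -/
theorem Setting.isPseudoMeasure (hS : Setting G p β K E ρ' ρ M Θ d) {r δ : ℝ} (hr : 0 ≤ r)
    (hrd : ⌊r⌋₊ = d) {m₀ u : ℕ} (hmu : m₀ + u = d) (hg : 2 * Θ ≤ p ^ (3 * d) * n)
    (hhalf : β ^ k * (E * (2 * (M * ρ))) ≤ 1 / 2)
    (hneg : 2 * (β ^ k * ((Θ / (p ^ (3 * d) * n)) ^ u * (2 * E) + 2 * Θ * E * (M * ρ) ^ m₀)) ≤ δ)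
    (hedge : 2 * (β ^ k * (E * (M * ρ) ^ d)) ≤ δ) :
    IsPseudoMeasure δ (cliqueFormula G) (normalizedMeasure p r G) := by
  have hn : (0 : ℝ) < n := by exact_mod_cast hS.n_pos
  have hnk : (0 : ℝ) < (n : ℝ) ^ k := by positivity
  have hβ : (0 : ℝ) ≤ β := by linarith [hS.one_le_β]
  have hΘ := hS.Θ_nonneg
  have hE := hS.E_nonneg
  have hp := hS.p_pos
  have hMρ : 0 ≤ M * ρ := mul_nonneg hS.M_nonneg hS.ρ_nonneg
  have hmono : ∀ m : Var k n →₀ ℕ, cliqueMeasure p r G (MvPolynomial.monomial m 1) =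
      ((n : ℝ) ^ k)⁻¹ * truncSum p G d Finset.univ (monomialRect m) := by
    intro m
    rw [cliqueMeasure_monomial, ruledOut_eq, tupleMeasure_piFinset p hr, hrd]
  have hcompl : ((Finset.univ : Finset (Fin k))ᶜ).card = 0 := by simp
  -- the total mass
  have htotal : 1 / 2 ≤ cliqueMeasure p r G 1 := by
    have h1 : (1 : MvPolynomial (Var k n) ℝ) = MvPolynomial.monomial 0 1 := rfl
    have hrect : monomialRect (0 : Var k n →₀ ℕ) = fun _ => Finset.univ := by
      funext i
      simp [monomialRect]
    rw [h1, hmono, hrect]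
    have h2 := (abs_le.1 (hS.abs_truncSum_sub_le (fixedOutside_univ G fun _ => Finset.univ)
      (by rw [hcompl]; exact Nat.zero_le _) le_rfl)).1
    have h3 : ((Fintype.piFinset fun _ : Fin k => (Finset.univ : Finset (Fin n))).card : ℝ) =
        (n : ℝ) ^ k := by simp
    rw [sizeBound_univ, h3] at h2
    rw [inv_mul_eq_div, le_div_iff₀ hnk]
    have h4 := mul_le_mul_of_nonneg_right hhalf hnk.le
    linarith
  have hpos : 0 < cliqueMeasure p r G 1 := by linarith
  have hinv : (cliqueMeasure p r G 1)⁻¹ ≤ 2 := by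
    rw [inv_le_comm₀ hpos two_pos]
    linarith
  have hinv0 : 0 < (cliqueMeasure p r G 1)⁻¹ := inv_pos.2 hpos
  have hδ : 0 ≤ δ := le_trans (by positivity) hedge
  have happ : ∀ q, normalizedMeasure p r G q = (cliqueMeasure p r G 1)⁻¹ * cliqueMeasure p r G q :=
    fun q => rfl
  refine ⟨?_, ?_, ?_⟩
  · rw [happ, inv_mul_cancel₀ hpos.ne']
  · rintro m q (⟨i, rfl⟩ | ⟨v, w, hvw, hadj, rfl⟩)
    · rw [happ, cliqueMeasure_block_axiom, mul_zero, abs_zero]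
      exact hδ
    · have hmul : MvPolynomial.monomial m (1 : ℝ) *
          (MvPolynomial.X (Sum.inl v) * MvPolynomial.X (Sum.inl w)) =
          MvPolynomial.monomial
            (m + Finsupp.single (Sum.inl v) 1 + Finsupp.single (Sum.inl w) 1) 1 := by
        rw [MvPolynomial.X, MvPolynomial.X, ← mul_assoc, MvPolynomial.monomial_mul,
          MvPolynomial.monomial_mul, one_mul, one_mul]
      rw [happ, hmul, hmono, truncSum_nonedge p d hvw ?_, abs_mul, abs_mul, abs_of_pos hinv0,
        abs_of_pos (inv_pos.2 hnk)]
      · have h1 := hS.abs_sum_coreSum_le (fixedOutside_univ G (monomialRect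
          (m + Finsupp.single (Sum.inl v) 1 + Finsupp.single (Sum.inl w) 1)))
          (by rw [hcompl]; exact Nat.zero_le _)
          (fun F => ∀ C, IsMinVertexCover F C → v.1 ∉ C ∧ w.1 ∉ C) le_rfl
        rw [sizeBound_univ] at h1
        have h2 : ((n : ℝ) ^ k)⁻¹ * |∑ F ∈ coresOn Finset.univ fun F => vc F = d ∧
            ∀ C, IsMinVertexCover F C → v.1 ∉ C ∧ w.1 ∉ C, coreSum p G F Finset.univ (monomialRect
              (m + Finsupp.single (Sum.inl v) 1 + Finsupp.single (Sum.inl w) 1))| ≤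
            β ^ k * (E * (M * ρ) ^ d) := by
          rw [inv_mul_eq_div, div_le_iff₀ hnk]
          linarith
        exact (mul_le_mul hinv h2 (by positivity) two_pos.le).trans hedge
      · intro t ht
        rw [← ruledOut_eq, mem_ruledOut_add_single, mem_ruledOut_add_single] at ht
        rw [ht.1.2, ht.2]
        exact hadj
  · intro m
    have h1 := hS.neg_le_truncSum m₀ u hg (fixedOutside_univ G (monomialRect m))
      (by rw [hcompl]; omega) hmu.le
    rw [hmu, sizeBound_univ] at h1
    rw [happ, hmono]
    set ε := (Θ / (p ^ (3 * d) * n)) ^ u * (2 * E) + 2 * Θ * E * (M * ρ) ^ m₀ with hε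
    have hε0 : 0 ≤ ε := by positivity
    have h2 : -(β ^ k * ε) ≤ ((n : ℝ) ^ k)⁻¹ * truncSum p G d Finset.univ (monomialRect m) := by
      rw [inv_mul_eq_div, le_div_iff₀ hnk]
      linarith
    have h3 : 0 ≤ β ^ k * ε := by positivity
    nlinarith

end

/-! ### Choice of the parameters -/

theorem one_add_inv_pow_le {k : ℕ} (hk : 0 < k) : (1 + 1 / (k : ℝ)) ^ k ≤ 3 := by
  have hk' : (0 : ℝ) < k := by exact_mod_cast hk
  calc (1 + 1 / (k : ℝ)) ^ k ≤ Real.exp (1 / k) ^ k := by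
        gcongr
        linarith [Real.add_one_le_exp (1 / (k : ℝ))]
    _ = Real.exp 1 := by
        rw [← Real.exp_nat_mul]
        congr 1
        field_simp
    _ ≤ 3 := by linarith [Real.exp_one_lt_d9]

/-- The number of sets to be split evenly is outweighed by the Chernoff bound. -/
theorem tuples_lt_exp {k n z y : ℝ} {d : ℕ} (hk : 1 ≤ k) (hkn : k * 2 ≤ n) (hz : 100 ≤ z)
    (hlog : Real.log n ≤ z) (hd : (d : ℝ) ≤ z) (hy : z ^ 3 ≤ y) :
    2 * ((k * n + 1) ^ (3 * d) * n) < Real.exp (y / 4) := by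
  have hn2 : 2 ≤ n := by linarith
  have hkn2 : k * n + 1 ≤ n ^ 2 := by nlinarith
  have h1 : 2 * ((k * n + 1) ^ (3 * d) * n) ≤ n ^ (6 * d + 2) := by
    calc 2 * ((k * n + 1) ^ (3 * d) * n) ≤ n * ((n ^ 2) ^ (3 * d) * n) := by gcongr
      _ = n ^ (6 * d + 2) := by ring
  refine h1.trans_lt ?_
  rw [← Real.exp_log (by positivity : 0 < n ^ (6 * d + 2)), Real.exp_lt_exp, Real.log_pow]
  push_cast
  have hz2 : 0 < z ^ 2 := by positivity
  calc (6 * (d : ℝ) + 2) * Real.log n ≤ (6 * z + 2) * z := by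
        have := Real.log_nonneg (by linarith : 1 ≤ n)
        gcongr
    _ < 25 * z ^ 2 := by nlinarith
    _ ≤ z ^ 3 / 4 := by nlinarith
    _ ≤ y / 4 := by linarith

/-- All parameters are powers of `z = n ^ (1 / 1000)`. The local character sums are used with
`Λ ≈ z ^ 600` and concentration with deviation `Δ = z ^ 560`, between `√n` and `Λ`. -/
theorem WellBehaved.setting {k n : ℕ} {G : SimpleGraph (Vertex k n)} {C K D p z : ℝ} {d : ℕ}
    (hG : WellBehaved C K D G) (hpD : p = (n : ℝ) ^ (-2 / D)) (hp : 0 < p) (hp1 : p ≤ 1)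
    (hn : 0 < n) (hk : 0 < k) (hK : 0 < K) (hnz : (n : ℝ) = z ^ 1000) (hz : 100 ≤ z)
    (hCz : C ≤ z) (hKz : 48 * (2 * K + 1) ≤ z) (hlog : Real.log n ≤ z)
    (hdlog : (d : ℝ) ≤ Real.log n)
    (hkz : (k : ℝ) ≤ z ^ 16) (hpz : z⁻¹ ≤ p ^ d) (h2z : (2 : ℝ) ^ d ≤ z)
    (hdD : ((3 * d : ℕ) : ℝ) ≤ D / 4) :
    ∃ ρ' M Θ : ℝ, M * (z ^ 100)⁻¹ ≤ (z ^ 40)⁻¹ ∧ Θ / (p ^ (3 * d) * n) ≤ (z ^ 40)⁻¹ ∧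
      Θ ≤ z ^ 601 ∧
      Setting G p (1 + 1 / k) K (2 * K + 1) ρ' (z ^ 100)⁻¹ M Θ d := by
  have hz0 : 0 < z := by linarith
  have hz1 : 1 ≤ z := by linarith
  have hk' : (0 : ℝ) < k := by exact_mod_cast hk
  have hk1 : (1 : ℝ) ≤ k := by exact_mod_cast hk
  have hn' : (0 : ℝ) < n := by exact_mod_cast hn
  have hn1 : (1 : ℝ) ≤ n := by exact_mod_cast hn
  have hpow : ∀ {a b : ℕ}, a ≤ b → z ^ a ≤ z ^ b := fun h => pow_le_pow_right₀ hz1 h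
  have hc : ∀ {c : ℝ} (a : ℕ), c ≤ z → c * z ^ a ≤ z ^ (a + 1) := fun a h => by
    rw [pow_succ']; gcongr
  have hlog0 : 0 ≤ Real.log n := Real.log_nonneg hn1
  have hp3 : (z ^ 3)⁻¹ ≤ p ^ (3 * d) := by
    rw [mul_comm, pow_mul, ← inv_pow]; gcongr
  have hp3' : p⁻¹ ^ (3 * d) ≤ z ^ 3 := by
    rw [inv_pow]; exact inv_le_of_inv_le₀ (by positivity) hp3
  have hp6 : (p ^ (2 * (3 * d)))⁻¹ ≤ z ^ 6 := by
    rw [mul_comm 2, pow_mul, ← inv_pow, ← inv_pow, show 6 = 3 * 2 by norm_num, pow_mul z]; gcongr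
  have h23 : (2 : ℝ) ^ (3 * d) ≤ z ^ 3 := by
    rw [mul_comm, pow_mul]; gcongr
  have hln2 : Real.logb 2 n ≤ 2 * z := by
    rw [Real.logb, div_le_iff₀ (Real.log_pos (by norm_num))]
    have := Real.log_two_gt_d9
    nlinarith
  have hlogb0 : 0 ≤ Real.logb 2 n := Real.logb_nonneg (by norm_num) hn1
  -- the block size of the local character sums
  set Λ : ℕ := ⌈z ^ 600⌉₊ with hΛ
  have hΛ1 : z ^ 600 ≤ Λ := Nat.le_ceil _
  have hΛ2 : (Λ : ℝ) ≤ 2 * z ^ 600 := by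
    have h1 := (Nat.ceil_lt_add_one (by positivity : 0 ≤ z ^ 600)).le
    have h2 : 1 ≤ z ^ 600 := one_le_pow₀ hz1
    linarith
  -- the size of the error sets
  set s : ℕ := ⌈C * (k : ℝ) ^ 4 * (3 * d : ℕ) * Real.log n / p ^ (2 * (3 * d))⌉₊ with hs
  have hs1 : C * (k : ℝ) ^ 4 * (3 * d : ℕ) * Real.log n / p ^ (2 * (3 * d)) ≤ s := Nat.le_ceil _
  have hs0 : C * (k : ℝ) ^ 4 * (3 * d : ℕ) * Real.log n / p ^ (2 * (3 * d)) ≤ z ^ 74 := by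
    rw [div_eq_mul_inv]
    push_cast
    calc C * (k : ℝ) ^ 4 * (3 * d) * Real.log n * (p ^ (2 * (3 * d)))⁻¹
        ≤ z * (z ^ 16) ^ 4 * (3 * z) * z * z ^ 6 := by
          have : (d : ℝ) ≤ z := hdlog.trans hlog
          gcongr
      _ = 3 * z ^ 73 := by ring
      _ ≤ z ^ 74 := hc 73 (by linarith)
  have hs2 : (s : ℝ) ≤ z ^ 600 := by
    have h1 : (s : ℝ) ≤ ⌈z ^ 74⌉₊ := Nat.cast_le.2 (Nat.ceil_le_ceil hs0)
    have h2 := (Nat.ceil_lt_add_one (by positivity : 0 ≤ z ^ 74)).le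
    have h3 : 1 ≤ z ^ 74 := one_le_pow₀ hz1
    have h4 := hc (c := 2) 74 (by linarith)
    have h5 : z ^ (74 + 1) ≤ z ^ 600 := hpow (by norm_num)
    linarith
  have hsΛ : s ≤ Λ := by exact_mod_cast hs2.trans hΛ1
  set Θ : ℕ := s + 4 * Λ with hΘ
  have hΘ1 : (Θ : ℝ) ≤ z ^ 601 := by
    have h1 : (Θ : ℝ) = s + 4 * Λ := by rw [hΘ]; push_cast; ring
    have h2 := hc (c := 10) 600 (by linarith)
    have h3 : 0 < z ^ 600 := by positivity
    rw [h1]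
    refine le_trans ?_ h2
    linarith
  have hpn : z ^ 997 ≤ p ^ (3 * d) * n := by
    calc z ^ 997 = (z ^ 3)⁻¹ * z ^ 1000 := by field_simp
      _ ≤ _ := by rw [hnz]; gcongr
  have hM : (k : ℝ) ^ 3 * (2 ^ (3 * d)) ^ 4 ≤ z ^ 60 := by
    calc (k : ℝ) ^ 3 * (2 ^ (3 * d)) ^ 4 ≤ (z ^ 16) ^ 3 * (z ^ 3) ^ 4 := by gcongr
      _ = z ^ 60 := by ring
  have hMρ : (k : ℝ) ^ 3 * (2 ^ (3 * d)) ^ 4 * (z ^ 100)⁻¹ ≤ (z ^ 40)⁻¹ := by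
    calc _ ≤ z ^ 60 * (z ^ 100)⁻¹ := by gcongr
      _ = (z ^ 40)⁻¹ := by field_simp
  have hz40 : (z ^ 40)⁻¹ ≤ z⁻¹ := by
    gcongr
    exact le_self_pow₀ hz1 (by norm_num)
  have hzi : z⁻¹ ≤ 1 / 2 := by
    rw [one_div]; gcongr; linarith
  -- the relative size of the local character sums
  have hrate : localRate k n p d Λ ≤ (z ^ 100)⁻¹ := by
    have hlogb : 0 < Real.logb 2 n := by
      refine Real.logb_pos (by norm_num) ?_
      rw [hnz]
      exact one_lt_pow₀ (by linarith) (by norm_num)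
    -- the exponent `103` leaves `z ^ 100` after the loss of `p⁻¹ ^ (3 * d) ≤ z ^ 3`
    have hbase : (z ^ 103) ^ (4 : ℝ) ≤ Λ / (10 * k * Real.logb 2 n) := by
      rw [le_div_iff₀ (by positivity)]
      calc (z ^ 103) ^ (4 : ℝ) * (10 * k * Real.logb 2 n)
          ≤ (z ^ 103) ^ (4 : ℝ) * (10 * z ^ 16 * (2 * z)) := by gcongr
        _ = 20 * z ^ 429 := by
          rw [show (4 : ℝ) = (4 : ℕ) by norm_num, Real.rpow_natCast]; ring
        _ ≤ z ^ 430 := hc 429 (by linarith)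
        _ ≤ z ^ 600 := hpow (by norm_num)
        _ ≤ Λ := hΛ1
    have h1 : (Λ / (10 * k * Real.logb 2 n) : ℝ) ^ (-(1 / 4) : ℝ) ≤ (z ^ 103)⁻¹ := by
      have h2 := Real.rpow_le_rpow_of_nonpos (by positivity) hbase
        (by norm_num : (-(1 / 4) : ℝ) ≤ 0)
      rw [← Real.rpow_mul (by positivity)] at h2
      norm_num at h2 ⊢
      rwa [Real.rpow_neg_one] at h2
    calc localRate k n p d Λ ≤ z ^ 3 * (z ^ 103)⁻¹ := by
          unfold localRate
          gcongr
      _ = (z ^ 100)⁻¹ := by field_simp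
  have hrate0 : 0 ≤ localRate k n p d Λ := by
    unfold localRate
    positivity
  refine ⟨localRate k n p d Λ, (k : ℝ) ^ 3 * (2 ^ (3 * d)) ^ 4, Θ, hMρ, ?_, hΘ1, ?_⟩
  · rw [div_le_iff₀ (by positivity)]
    calc (Θ : ℝ) ≤ z ^ 957 := hΘ1.trans (hpow (by norm_num))
      _ = (z ^ 40)⁻¹ * z ^ 997 := by field_simp
      _ ≤ _ := by gcongr
  refine
    { p_pos := hp
      p_le := hp1
      one_le_β := by simp
      n_pos := hn
      k_pos := hk
      K_nonneg := hK.le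
      K_le := by linarith
      one_le_E := by linarith
      ρ'_nonneg := hrate0
      ρ'_le := hrate
      ρ_le := inv_le_one_of_one_le₀ (one_le_pow₀ hz1)
      Θ_nonneg := by positivity
      gain := ?_
      M_nonneg := by positivity
      count := ?_
      Mρ_le := hMρ.trans (hz40.trans hzi)
      KMρ'_le := ?_
      nbhd := hG.nbhdUpper hpD hdD
      branching := ?_ }
  · calc 2 * ((Θ : ℝ) * 2 ^ (3 * d)) ≤ 2 * (z ^ 601 * z ^ 3) := by gcongr
      _ = 2 * z ^ 604 := by ring
      _ ≤ z ^ 605 := hc 604 (by linarith)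
      _ ≤ z ^ 897 := hpow (by norm_num)
      _ = (z ^ 100)⁻¹ * z ^ 997 := by field_simp
      _ ≤ _ := by gcongr
  · intro w hw
    have h1 : (2 : ℝ) ^ (9 * w ^ 2) ≤ ((2 ^ (3 * d)) ^ 3) ^ w := by
      rw [← pow_mul, ← pow_mul]
      refine pow_le_pow_right₀ (by norm_num) ?_
      calc 9 * w ^ 2 = 9 * w * w := by ring
        _ ≤ 9 * d * w := by gcongr
        _ = 3 * d * (3 * w) := by ring
    calc (k : ℝ) ^ (3 * w) * 2 ^ (9 * w ^ 2) * (2 ^ (3 * d)) ^ w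
        ≤ (k : ℝ) ^ (3 * w) * ((2 ^ (3 * d)) ^ 3) ^ w * (2 ^ (3 * d)) ^ w := by gcongr
      _ = ((k : ℝ) ^ 3 * (2 ^ (3 * d)) ^ 4) ^ w := by
        rw [pow_mul, ← mul_pow, ← mul_pow]; ring
  · have h1 : (k : ℝ) ^ 3 * (2 ^ (3 * d)) ^ 4 * localRate k n p d Λ ≤ z⁻¹ :=
      (mul_le_mul_of_nonneg_left hrate (by positivity)).trans (hMρ.trans hz40)
    calc K * (2 * ((k : ℝ) ^ 3 * (2 ^ (3 * d)) ^ 4 * localRate k n p d Λ))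
        ≤ K * (2 * z⁻¹) := by gcongr
      _ = (2 * K) * z⁻¹ := by ring
      _ ≤ z * z⁻¹ := by gcongr; linarith
      _ = 1 := mul_inv_cancel₀ hz0.ne'
  · refine hG.branching hpD hn hk hp1 hK.le hdD ?_ (Δ := z ^ 560) (by positivity) ?_ ?_ ?_ ?_ hs1
      le_rfl (by omega)
    · calc 20 * (k : ℝ) * Real.logb 2 n ≤ 20 * z ^ 16 * (2 * z) := by gcongr
        _ = 40 * z ^ 17 := by ring
        _ ≤ z ^ 18 := hc 17 (by linarith)
        _ ≤ z ^ 600 := hpow (by norm_num)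
        _ ≤ Λ := hΛ1
    · have : z ^ 560 ≤ n := by
        rw [hnz]
        exact hpow (by norm_num)
      exact this.trans (by linarith)
    · exact (pow_lt_pow_right₀ (by linarith) (by norm_num)).trans_le hΛ1
    · calc 3 * z ^ 560 * k ≤ 3 * z ^ 560 * z ^ 16 := by gcongr
        _ = 3 * z ^ 576 := by ring
        _ ≤ z ^ 577 := hc 576 (by linarith)
        _ ≤ 2 * z ^ 597 := by
          have h1 : z ^ 577 ≤ z ^ 597 := hpow (by norm_num)
          have h2 : 0 < z ^ 597 := by positivity
          linarith
        _ = 2 * (z ^ 3)⁻¹ * z ^ 600 := by field_simp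
        _ ≤ _ := by gcongr
    · have hexp : (z ^ 560) ^ 2 / (4 * (n : ℝ)) = z ^ 120 / 4 := by rw [hnz]; field_simp
      rw [hexp]
      refine tuples_lt_exp hk1 ?_ hz hlog (hdlog.trans hlog) ?_
      · calc (k : ℝ) * 2 ≤ z ^ 16 * z := by gcongr; linarith
          _ = z ^ 17 := by ring
          _ ≤ n := by rw [hnz]; exact hpow (by norm_num)
      · exact hpow (by norm_num)

section

variable {k n : ℕ} {G : SimpleGraph (Vertex k n)} {p β K E ρ' ρ M Θ : ℝ} {d : ℕ}

/-- With parameters that are powers of `z`, all error terms are at most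
`z ^ 602 * z ^ (-40 * ⌊d / 2⌋)`. -/
theorem Setting.isPseudoMeasure_of_le (hS : Setting G p β K E ρ' ρ M Θ d) {r z δ : ℝ} (hr : 0 ≤ r)
    (hrd : ⌊r⌋₊ = d) (hz : 100 ≤ z) (hβ : β ^ k ≤ 3) (hE : 48 * E ≤ z)
    (hx : M * ρ ≤ (z ^ 40)⁻¹) (hg : Θ / (p ^ (3 * d) * n) ≤ (z ^ 40)⁻¹) (hΘ : Θ ≤ z ^ 601)
    (hδ : z ^ 602 * ((z ^ 40)⁻¹) ^ (d / 2) ≤ δ) :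
    IsPseudoMeasure δ (cliqueFormula G) (normalizedMeasure p r G) := by
  have hn : (0 : ℝ) < n := by exact_mod_cast hS.n_pos
  have hp := hS.p_pos
  have hβ0 : (0 : ℝ) ≤ β := by linarith [hS.one_le_β]
  have hE0 := hS.E_nonneg
  have hΘ0 := hS.Θ_nonneg
  have hx0 : 0 ≤ M * ρ := mul_nonneg hS.M_nonneg hS.ρ_nonneg
  have hz0 : 0 < z := by linarith
  have hz1 : 1 ≤ z := by linarith
  obtain ⟨y, hy⟩ : ∃ y, y = (z ^ 40)⁻¹ := ⟨_, rfl⟩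
  rw [← hy] at hx hg hδ
  have hy0 : 0 < y := hy ▸ by positivity
  have hyz : y ≤ z⁻¹ := by
    rw [hy]
    gcongr
    exact le_self_pow₀ hz1 (by norm_num)
  have hy2 : y ≤ 1 / 2 := hyz.trans (by rw [one_div]; gcongr; linarith)
  have hy1 : y ≤ 1 := by linarith
  have hEy : 48 * E * y ≤ 1 := by
    calc 48 * E * y ≤ z * z⁻¹ := by gcongr
      _ = 1 := mul_inv_cancel₀ hz0.ne'
  obtain ⟨Z, hZ⟩ : ∃ Z, Z = z ^ 601 := ⟨_, rfl⟩
  have hZ1 : 1 ≤ Z := hZ ▸ one_le_pow₀ hz1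
  rw [← hZ] at hΘ
  have hmain : 48 * E * Z * y ^ (d / 2) ≤ δ := by
    refine le_trans ?_ hδ
    calc 48 * E * Z * y ^ (d / 2) ≤ z * Z * y ^ (d / 2) := by gcongr
      _ = z ^ 602 * y ^ (d / 2) := by rw [hZ, ← pow_succ']
  have hyd : ∀ m, d / 2 ≤ m → y ^ m ≤ y ^ (d / 2) := fun m hm =>
    pow_le_pow_of_le_one hy0.le hy1 hm
  have hYpos : 0 < y ^ (d / 2) := by positivity
  have hEY : E * y ^ (d / 2) ≤ E * Z * y ^ (d / 2) := by
    rw [mul_right_comm]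
    exact le_mul_of_one_le_right (by positivity) hZ1
  refine hS.isPseudoMeasure hr hrd (m₀ := d - d / 2) (u := d / 2) (by omega) ?_ ?_ ?_ ?_
  · have := (div_le_iff₀ (by positivity)).1 (hg.trans hy2)
    linarith
  · calc β ^ k * (E * (2 * (M * ρ))) ≤ 3 * (E * (2 * y)) := by gcongr
      _ ≤ 1 / 2 := by linarith
  · have h1 : (M * ρ) ^ (d - d / 2) ≤ y ^ (d / 2) :=
      (pow_le_pow_left₀ hx0 hx _).trans (hyd _ (by omega))
    calc 2 * (β ^ k * ((Θ / (p ^ (3 * d) * n)) ^ (d / 2) * (2 * E) +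
          2 * Θ * E * (M * ρ) ^ (d - d / 2)))
        ≤ 2 * (3 * (y ^ (d / 2) * (2 * E) + 2 * Z * E * y ^ (d / 2))) := by gcongr
      _ = 12 * (E * y ^ (d / 2)) + 12 * (E * Z * y ^ (d / 2)) := by ring
      _ ≤ 48 * E * Z * y ^ (d / 2) := by
        have : 0 ≤ E * Z * y ^ (d / 2) := by positivity
        linarith
      _ ≤ δ := hmain
  · have h1 : (M * ρ) ^ d ≤ y ^ (d / 2) :=
      (pow_le_pow_left₀ hx0 hx _).trans (hyd _ (Nat.div_le_self _ _))
    calc 2 * (β ^ k * (E * (M * ρ) ^ d)) ≤ 2 * (3 * (E * y ^ (d / 2))) := by gcongr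
      _ ≤ 48 * E * Z * y ^ (d / 2) := by
        have : 0 ≤ E * Z * y ^ (d / 2) := by positivity
        linarith
      _ ≤ δ := hmain

end

/-- The lower bound on `n`: the number `z = n ^ (1 / 1000)` exceeds all constants and `log n`. -/
theorem eventually_le_rpow (A : ℝ) :
    ∀ᶠ n : ℕ in Filter.atTop, A ≤ (n : ℝ) ^ (1 / 1000 : ℝ) ∧
      Real.log n ≤ (n : ℝ) ^ (1 / 1000 : ℝ) := by
  have h1 := (tendsto_rpow_atTop (by norm_num : (0 : ℝ) < 1 / 1000)).eventually_ge_atTop A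
  have h2 := (isLittleO_log_rpow_atTop (by norm_num : (0 : ℝ) < 1 / 1000)).bound one_pos
  have h3 := tendsto_natCast_atTop_atTop (R := ℝ)
  filter_upwards [h3.eventually h1, h3.eventually h2] with n hn1 hn2
  refine ⟨hn1, (le_abs_self _).trans ?_⟩
  rwa [one_mul, Real.norm_eq_abs, Real.norm_of_nonneg (Real.rpow_nonneg (Nat.cast_nonneg n) _)]
    at hn2

end

end CliqueSA

theorem mainTheorem2 :
    ∃ η c : ℝ, 0 < η ∧ 0 < c ∧ ∃ D₀ : ℕ,
      ∀ C K : ℝ, 0 < C → 0 < K → ∃ n₀ : ℕ, ∀ n : ℕ, n₀ ≤ n →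
        ∀ D : ℝ, (D₀ : ℝ) < D → D ≤ 2 * Real.logb 2 n →
        ∀ k : ℕ, D ≤ k → (k : ℝ) ≤ (n : ℝ) ^ ((1 : ℝ) / 66) →
        ∀ G : SimpleGraph (CliqueSA.Vertex k n), CliqueSA.IsBlockPartite G →
          CliqueSA.WellBehaved C K D G →
          CliqueSA.IsPseudoMeasure ((n : ℝ) ^ (-(c * D))) (CliqueSA.cliqueFormula G)
            (CliqueSA.normalizedMeasure ((n : ℝ) ^ (-2 / D)) (η * D) G) := by
  -- `η = 1 / 2000` makes `p⁻¹ ^ d` and `2 ^ d` at most `z = n ^ (1 / 1000)`; `D > 200000` makes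
  -- the gain `z ^ (-40 * ⌊d / 2⌋)` outweigh the factor `z ^ 602`
  refine ⟨1 / 2000, 1 / 10 ^ 6, by norm_num, by norm_num, 200000, fun C K hC hK => ?_⟩
  obtain ⟨n₀, hn₀⟩ := Filter.eventually_atTop.1
    (CliqueSA.eventually_le_rpow (C + 48 * (2 * K + 1) + 100))
  refine ⟨max n₀ 1, fun n hn D hD hDn k hDk hkn G _ hG => ?_⟩
  push_cast at hD
  obtain ⟨hA, hlog⟩ := hn₀ n ((le_max_left _ _).trans hn)
  have hn0 : 0 < n := (le_max_right _ _).trans hn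
  have hn1 : (1 : ℝ) ≤ n := by exact_mod_cast hn0
  have hnpos : (0 : ℝ) < n := by linarith
  have hD0 : 0 < D := by linarith
  have hk : 0 < k := by
    have : (0 : ℝ) < k := by linarith
    exact_mod_cast this
  obtain ⟨z, hz⟩ : ∃ z, z = (n : ℝ) ^ (1 / 1000 : ℝ) := ⟨_, rfl⟩
  rw [← hz] at hA hlog
  have hzpow : ∀ j : ℕ, z ^ j = (n : ℝ) ^ ((j : ℝ) / 1000) := by
    intro j
    rw [hz, ← Real.rpow_natCast, ← Real.rpow_mul hnpos.le]
    congr 1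
    ring
  have hnz : (n : ℝ) = z ^ 1000 := by
    rw [hzpow]
    norm_num
  obtain ⟨d, hd⟩ : ∃ d, d = ⌊1 / 2000 * D⌋₊ := ⟨_, rfl⟩
  have hd1 : (d : ℝ) ≤ 1 / 2000 * D := hd ▸ Nat.floor_le (by positivity)
  have hd2 : 1 / 2000 * D < d + 1 := hd ▸ Nat.lt_floor_add_one _
  have hp : (0 : ℝ) < (n : ℝ) ^ (-2 / D) := Real.rpow_pos_of_pos hnpos _
  have hp1 : (n : ℝ) ^ (-2 / D) ≤ 1 :=
    Real.rpow_le_one_of_one_le_of_nonpos hn1 (div_nonpos_of_nonpos_of_nonneg (by norm_num) hD0.le)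
  have hpz : z⁻¹ ≤ ((n : ℝ) ^ (-2 / D)) ^ d := by
    rw [hz, ← Real.rpow_neg hnpos.le, ← Real.rpow_natCast, ← Real.rpow_mul hnpos.le]
    refine Real.rpow_le_rpow_of_exponent_le hn1 ?_
    rw [div_mul_eq_mul_div, le_div_iff₀ hD0]
    linarith
  have h2z : (2 : ℝ) ^ d ≤ z := by
    calc (2 : ℝ) ^ d = (2 : ℝ) ^ (d : ℝ) := (Real.rpow_natCast _ _).symm
      _ ≤ (2 : ℝ) ^ (Real.logb 2 n * (1 / 1000)) :=
        Real.rpow_le_rpow_of_exponent_le (by norm_num) (by linarith)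
      _ = z := by
        rw [Real.rpow_mul (by norm_num), Real.rpow_logb (by norm_num) (by norm_num) hnpos, hz]
  have hdlog : (d : ℝ) ≤ Real.log n := by
    have h1 : Real.logb 2 n ≤ 1000 * Real.log n := by
      rw [Real.logb, div_le_iff₀ (Real.log_pos (by norm_num))]
      have := Real.log_two_gt_d9
      have := Real.log_nonneg hn1
      nlinarith
    linarith
  have hkz : (k : ℝ) ≤ z ^ 16 := by
    rw [hzpow]
    exact hkn.trans (Real.rpow_le_rpow_of_exponent_le hn1 (by norm_num))
  have hdD : ((3 * d : ℕ) : ℝ) ≤ D / 4 := by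
    push_cast
    linarith
  obtain ⟨ρ', M, Θ, hx, hg, hΘ, hS⟩ := hG.setting rfl hp hp1 hn0 hk hK hnz (by linarith)
    (by linarith) (by linarith) hlog hdlog hkz hpz h2z hdD
  refine hS.isPseudoMeasure_of_le (by positivity) hd.symm (by linarith)
    (CliqueSA.one_add_inv_pow_le hk) (by linarith) hx hg hΘ ?_
  -- the error `z ^ (602 - 40 * ⌊d / 2⌋)` in terms of `n`
  rw [inv_pow, ← pow_mul, hzpow, hzpow, ← Real.rpow_neg hnpos.le, ← Real.rpow_add hnpos]
  refine Real.rpow_le_rpow_of_exponent_le hn1 ?_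
  have h1 : (d : ℝ) ≤ 2 * (d / 2 : ℕ) + 1 := by
    have : d ≤ 2 * (d / 2) + 1 := by omega
    exact_mod_cast this
  push_cast at h1 ⊢
  linarith
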